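/- Let $K/\mathbb{Q}$ be a finite Galois extension of degree $n$ with group $G$ (acting on the left, $\alpha^{\nu}:=\nu(\alpha)$), and let $\eta\in K^\times$ be such that the multiplicative $\mathbb{Z}[G]$-module generated by $\eta$ has $\mathbb{Z}$-rank $n$. Let $p>2$ be a prime unramified in $K$, prime to $n$ and to $\eta$. Let $Z_{K,(p)}$ be the ring of $p$-integers of $K$, $n_p$ the residue degree of $p$ in $K$, and put $\alpha_p(\eta):=\frac1p(\eta^{p^{n_p}-1}-1)$. Fix an embedding of $K$ in an algebraic closure $\overline{\mathbb{Q}}_p$ of $\mathbb{Q}_p$. Let $\mathcal{L}\subseteq\mathbb{F}_p[G]$ be the $G$-module of the reductions modulo $p$ of the elements $U=\sum_{\nu\in G}u(\nu)\nu^{-1}\in\mathbb{Z}_{(p)}[G]$ such that $\sum_{\nu\in G}u(\nu)\,\alpha_p(\eta)^{\nu^{-1}}\equiv0\pmod{p\,Z_{K,(p)}}$. Let $\theta$ be an irreducible $p$-adic character of $G$, that is, the sum of the distinct $\mathrm{Gal}(\overline{\mathbb{Q}}_p/\mathbb{Q}_p)$-conjugates of an absolutely irreducible character of $G$ with values in $\overline{\mathbb{Q}}_p$;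 write $\varphi\mid\theta$ for these conjugates. Let $f$ be the residue degree of $p$ in the field $\mathbb{Q}(\varphi(\nu),\,\nu\in G)$ for $\varphi\mid\theta$. Put $e_\theta:=\sum_{\varphi\mid\theta}\frac{\varphi(1)}{n}\sum_{\nu\in G}\varphi(\nu^{-1})\,\nu\in\mathbb{Z}_p[G]$ and $\mathcal{L}^\theta:=e_\theta\mathcal{L}$, with $e_\theta$ reduced modulo $p$. The local $\theta$-regulator, defined modulo $p$ only, is $$\Delta_p^\theta(\eta):=\prod_{\varphi\mid\theta}\det\Big(\sum_{\nu\in G}\alpha^{\nu}\rho_\varphi(\nu^{-1})\Big),$$ where $\rho_\varphi$ is a representation over $\overline{\mathbb{Q}}_p$ of character $\varphi$ and $\alpha\in Z_{K,(p)}$ is any element with $\alpha\equiv\alpha_p(\eta)\pmod{p\,Z_{K,(p)}}$. Then $\alpha_p(\eta)\in Z_{K,(p)}$, and $\mathcal{L}^\theta\neq0$ if and only if $\Delta_p^\theta(\eta)\equiv0\pmod p$ in the ring of integers of $\overline{\mathbb{Q}}_p$ (for any choice of $\alpha$). In that case $\dim_{\mathbb{F}_p}\mathcal{L}^\theta=\delta\,f\,\varphi(1)$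 for an integer $\delta$ with $1\le\delta\le\varphi(1)$. -/

import Mathlib

open scoped NumberField BigOperators

noncomputable section

namespace LocalRegulator

/-! ### `p`-integers, Fermat quotients and relations -/

/-- The ring of `p`-integers of a field `K` (written `Z_{K,(p)}`; it is `ℤ_(p)` for `K = ℚ`):
the elements that become algebraic integers after multiplication by a natural number
prime to `p`. -/
def pIntegers (p : ℕ) [Fact p.Prime] (K : Type*) [Field K] : Subring K where
  carrier := {x | ∃ d : ℕ, ¬ p ∣ d ∧ IsIntegral ℤ ((d : K) * x)}
  mul_mem' := by
    rintro x y ⟨a, ha, hax⟩ ⟨b, hb, hby⟩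
    refine ⟨a * b, (Fact.out : p.Prime).not_dvd_mul ha hb, ?_⟩
    have h := hax.mul hby
    rwa [mul_mul_mul_comm, ← Nat.cast_mul] at h
  one_mem' := ⟨1, (Fact.out : p.Prime).not_dvd_one, by simpa using isIntegral_one⟩
  add_mem' := by
    rintro x y ⟨a, ha, hax⟩ ⟨b, hb, hby⟩
    refine ⟨a * b, (Fact.out : p.Prime).not_dvd_mul ha hb, ?_⟩
    have h1 := (isIntegral_algebraMap (R := ℤ) (A := K) (x := (b : ℤ))).mul hax
    have h2 := (isIntegral_algebraMap (R := ℤ) (A := K) (x := (a : ℤ))).mul hby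
    have h := h1.add h2
    simp only [algebraMap_int_eq, eq_intCast, Int.cast_natCast] at h
    have h' : ((a * b : ℕ) : K) * (x + y) = (b : K) * (a * x) + (a : K) * (b * y) := by
      rw [Nat.cast_mul]; ring
    rwa [h']
  zero_mem' := ⟨1, (Fact.out : p.Prime).not_dvd_one, by simpa using isIntegral_zero⟩
  neg_mem' := by
    rintro x ⟨a, ha, hax⟩
    exact ⟨a, ha, by simpa using hax.neg⟩

/-- `x ≡ y (mod p)`, i.e. `x - y ∈ p Z_{K,(p)}`. -/
def CongrModP (p : ℕ) [Fact p.Prime] {K : Type*} [Field K] (x y : K) : Prop :=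
  ∃ z ∈ pIntegers p K, x - y = (p : K) * z

/-- `p` is unramified in `K`: every prime of `𝓞 K` above `p` has ramification index `1`. -/
def IsUnramifiedIn (p : ℕ) (K : Type*) [Field K] : Prop :=
  ∀ P : Ideal (𝓞 K), P.IsPrime → P.LiesOver (Ideal.span {(p : ℤ)}) → P.ramificationIdx ℤ = 1

/-- The common residue degree of the primes above `p` in a Galois number field `K`. -/
def residueDegree (p : ℕ) (K : Type*) [Field K] : ℕ :=
  (Ideal.span {(p : ℤ)}).inertiaDegIn (𝓞 K)

/-- `η` is prime to `p`: no prime of `K` above `p` occurs in the ideal factorization of `η`;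
in other words `η` is a unit of the ring of `p`-integers. -/
def IsPrimeTo (p : ℕ) [Fact p.Prime] {K : Type*} [Field K] (η : Kˣ) : Prop :=
  (η : K) ∈ pIntegers p K ∧ ((η⁻¹ : Kˣ) : K) ∈ pIntegers p K

/-- The generalized Fermat quotient `α_p(η) = (η ^ (p ^ n_p - 1) - 1) / p`, with `n_p` the residue
degree of `p` in `K`. -/
def fermatQuotient (p : ℕ) {K : Type*} [Field K] (η : Kˣ) : K :=
  ((η : K) ^ (p ^ residueDegree p K - 1) - 1) / (p : K)

/-- The multiplicative `ℤ[G]`-module generated by `η`: the subgroup of `Kˣ` generated by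
the conjugates of `η`. -/
def conjugateGroup {K : Type*} [Field K] [NumberField K] (η : Kˣ) : Subgroup Kˣ :=
  Subgroup.closure (Set.range fun σ : Gal(K/ℚ) => Units.map (σ : K →* K) η)

section Relations

variable (p : ℕ) [hp : Fact p.Prime] {K : Type*} [Field K] [NumberField K]

theorem intCast_mem_pIntegers (L : Type*) [Field L] (c : ℤ) : (c : L) ∈ pIntegers p L :=
  intCast_mem _ c

theorem den_ne_zero {x : ℚ} (hx : x ∈ pIntegers p ℚ) : (x.den : ZMod p) ≠ 0 := by
  obtain ⟨d, hd, hdx⟩ := hx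
  obtain ⟨z, hz⟩ := IsIntegrallyClosed.isIntegral_iff.mp hdx
  simp only [algebraMap_int_eq, eq_intCast] at hz
  rw [Ne, ZMod.natCast_eq_zero_iff]
  intro h
  apply hd
  refine h.trans ?_
  have h1 : (d : ℚ) * x.num = z * x.den := by
    rw [hz, mul_assoc, Rat.mul_den_eq_num]
  have h2 : (d : ℤ) * x.num = z * x.den := by exact_mod_cast h1
  have h3 : (x.den : ℤ) ∣ (d : ℤ) * x.num := ⟨z, by rw [h2, mul_comm]⟩
  have h4 : IsCoprime (x.den : ℤ) x.num := by
    rw [Int.isCoprime_iff_gcd_eq_one]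
    have := x.reduced
    rw [Int.gcd_comm]
    exact this
  exact_mod_cast h4.dvd_of_dvd_mul_right h3

theorem castModP_add {x y : ℚ} (hx : x ∈ pIntegers p ℚ) (hy : y ∈ pIntegers p ℚ) :
    ((x + y : ℚ) : ZMod p) = (x : ZMod p) + (y : ZMod p) :=
  Rat.cast_add_of_ne_zero (den_ne_zero p hx) (den_ne_zero p hy)

theorem castModP_mul {x y : ℚ} (hx : x ∈ pIntegers p ℚ) (hy : y ∈ pIntegers p ℚ) :
    ((x * y : ℚ) : ZMod p) = (x : ZMod p) * (y : ZMod p) :=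
  Rat.cast_mul_of_ne_zero (den_ne_zero p hx) (den_ne_zero p hy)

theorem map_mem_pIntegers (σ : Gal(K/ℚ)) {x : K} (hx : x ∈ pIntegers p K) :
    σ x ∈ pIntegers p K := by
  obtain ⟨d, hd, h⟩ := hx
  refine ⟨d, hd, ?_⟩
  have := h.map (σ : K →ₐ[ℚ] K)
  simpa using this

/-- `u : G → ℤ_(p)` are the coefficients of a relation `∑ u(ν) ν⁻¹` associated with `α`, i.e.
`∑ u(ν) ν⁻¹(α) ≡ 0 (mod p)`. -/
def IsRelation (α : K) (u : Gal(K/ℚ) → ℚ) : Prop :=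
  (∀ ν, u ν ∈ pIntegers p ℚ) ∧ CongrModP p (∑ ν, (u ν : K) * ν⁻¹ α) 0

/-- The `G`-module `ℒ` of relations `U = ∑ u(ν) ν⁻¹ ∈ ℤ_(p)[G]` associated with `α`,
seen in `𝔽_p[G]` (as a left ideal). -/
def relations (α : K) : Ideal (MonoidAlgebra (ZMod p) Gal(K/ℚ)) where
  carrier := {U | ∃ u : Gal(K/ℚ) → ℚ, IsRelation p α u ∧
    U = ∑ ν, MonoidAlgebra.single ν⁻¹ (u ν : ZMod p)}
  add_mem' := by
    rintro _ _ ⟨u, ⟨hu, z, hz, hzu⟩, rfl⟩ ⟨v, ⟨hv, w, hw, hwv⟩, rfl⟩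
    refine ⟨u + v, ⟨fun ν => add_mem (hu ν) (hv ν), z + w, add_mem hz hw, ?_⟩, ?_⟩
    · rw [mul_add, ← hzu, ← hwv]
      simp [add_mul, Finset.sum_add_distrib]
    · rw [← Finset.sum_add_distrib]
      refine Finset.sum_congr rfl fun ν _ => ?_
      rw [Pi.add_apply, castModP_add p (hu ν) (hv ν), MonoidAlgebra.single_add]
  zero_mem' := ⟨0, ⟨fun _ => zero_mem _, 0, zero_mem _, by simp⟩, by simp⟩
  smul_mem' := by
    intro f U hU
    induction f using MonoidAlgebra.induction_linear with
    | zero =>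
      rw [zero_smul]
      exact ⟨0, ⟨fun _ => zero_mem _, 0, zero_mem _, by simp⟩, by simp⟩
    | add f g hf hg =>
      obtain ⟨u, ⟨hu, z, hz, hzu⟩, hf⟩ := hf
      obtain ⟨v, ⟨hv, w, hw, hwv⟩, hg⟩ := hg
      rw [add_smul, hf, hg]
      refine ⟨u + v, ⟨fun ν => add_mem (hu ν) (hv ν), z + w, add_mem hz hw, ?_⟩, ?_⟩
      · rw [mul_add, ← hzu, ← hwv]
        simp [add_mul, Finset.sum_add_distrib]
      · rw [← Finset.sum_add_distrib]
        refine Finset.sum_congr rfl fun ν _ => ?_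
        rw [Pi.add_apply, castModP_add p (hu ν) (hv ν), MonoidAlgebra.single_add]
    | single σ c =>
      obtain ⟨u, ⟨hu, z, hz, hzu⟩, rfl⟩ := hU
      obtain ⟨c, rfl⟩ := ZMod.intCast_surjective c
      have hc := intCast_mem_pIntegers p ℚ c
      refine ⟨fun ν => c * u (ν * σ), ⟨fun ν => mul_mem hc (hu _), c * σ z,
        mul_mem (intCast_mem_pIntegers p K c) (map_mem_pIntegers p σ hz), ?_⟩, ?_⟩
      · have h1 : (∑ ν, (u ν : K) * ν⁻¹ α) = p * z := by simpa using hzu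
        have h2 := congrArg σ h1
        rw [map_sum] at h2
        rw [sub_zero, mul_left_comm]
        have h3 : (p : K) * σ z = σ (p * z) := by simp
        rw [h3, ← h2, Finset.mul_sum]
        refine Fintype.sum_equiv (Equiv.mulRight σ) _ _ fun ν => ?_
        simp [AlgEquiv.mul_apply, mul_assoc]
      · rw [smul_eq_mul, Finset.mul_sum]
        symm
        refine Fintype.sum_equiv (Equiv.mulRight σ) _ _ fun ν => ?_
        rw [MonoidAlgebra.single_mul_single, castModP_mul p hc (hu _)]
        simp

end Relations

/-! ### Irreducible characters over an algebraic closure of `ℚ_p` and over `ℚ_p` -/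

section Characters

variable (p : ℕ) [hp : Fact p.Prime] (G : Type*) [Group G]

variable {G} in
/-- `φ` is the character of the absolutely irreducible matrix representation `ρ`. -/
def Affords {d : ℕ} (φ : G → PadicAlgCl p) (ρ : Representation (PadicAlgCl p) G (Fin d → PadicAlgCl p)) :
    Prop :=
  ρ.IsIrreducible ∧ ρ.character = φ

variable {G} in
/-- `φ` is an absolutely irreducible character of `G` (with values in the algebraic closure
of `ℚ_p`). -/
def IsIrreducibleCharacter (φ : G → PadicAlgCl p) : Prop :=
  ∃ (d : ℕ) (ρ : Representation (PadicAlgCl p) G (Fin d → PadicAlgCl p)), Affords p φ ρ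

theorem finite_irreducibleCharacters [Fintype G] :
    {φ : G → PadicAlgCl p | IsIrreducibleCharacter p φ}.Finite := by
  classical
  have hinv : Invertible (Nat.card G : PadicAlgCl p) :=
    invertibleOfNonzero (by exact_mod_cast Nat.card_pos.ne')
  have key : ∀ φ ψ : G → PadicAlgCl p, IsIrreducibleCharacter p φ → IsIrreducibleCharacter p ψ →
      (Nat.card G : PadicAlgCl p)⁻¹ * ∑ g, φ g * ψ g⁻¹ = if φ = ψ then 1 else 0 := by
    rintro φ ψ ⟨d, ρ, hρ, rfl⟩ ⟨e, σ, hσ, rfl⟩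
    have h := Representation.char_orthonormal ρ σ
    by_cases hn : Nonempty (Representation.Equiv σ ρ)
    · have heq : ρ.character = σ.character := (Representation.char_iso hn.some).symm
      rw [if_pos hn] at h
      rw [if_pos heq, h]
    · rw [if_neg hn] at h
      have hne : ρ.character ≠ σ.character := by
        intro heq
        have h' := Representation.char_orthonormal σ σ
        rw [if_pos ⟨Representation.Equiv.refl σ⟩] at h'
        rw [heq, h'] at h
        exact one_ne_zero h
      rw [if_neg hne, h]
  have hli : LinearIndependent (PadicAlgCl p)
      (fun φ : {φ : G → PadicAlgCl p | IsIrreducibleCharacter p φ} => (φ : G → PadicAlgCl p)) := by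
    rw [linearIndependent_iff']
    intro s c hs j hj
    have h1 : (Nat.card G : PadicAlgCl p)⁻¹ *
        ∑ g, (∑ i ∈ s, c i • (i : G → PadicAlgCl p)) g * (j : G → PadicAlgCl p) g⁻¹ = 0 := by
      rw [hs]
      simp
    have h2 : (Nat.card G : PadicAlgCl p)⁻¹ *
        ∑ g, (∑ i ∈ s, c i • (i : G → PadicAlgCl p)) g * (j : G → PadicAlgCl p) g⁻¹ =
        ∑ i ∈ s, c i * ((Nat.card G : PadicAlgCl p)⁻¹ *
          ∑ g, (i : G → PadicAlgCl p) g * (j : G → PadicAlgCl p) g⁻¹) := by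
      simp only [Finset.sum_apply, Pi.smul_apply, smul_eq_mul, Finset.sum_mul, Finset.mul_sum]
      rw [Finset.sum_comm]
      refine Finset.sum_congr rfl fun i _ => Finset.sum_congr rfl fun g _ => ?_
      ring
    rw [h2] at h1
    rw [Finset.sum_eq_single j] at h1
    · rw [key _ _ j.2 j.2, if_pos rfl, mul_one] at h1
      exact h1
    · intro i _ hij
      rw [key _ _ i.2 j.2, if_neg (fun h => hij (Subtype.ext h)), mul_zero]
    · exact fun h => absurd hj h
  exact hli.setFinite

variable [Fintype G]

/-- The finite set of absolutely irreducible characters of `G`. -/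
def irreducibleCharacters : Finset (G → PadicAlgCl p) :=
  (finite_irreducibleCharacters p G).toFinset

variable {G}

/-- The distinct conjugates `φ^s` of `φ` under the Galois group of the algebraic closure
of `ℚ_p` over `ℚ_p`. On the field of values `C = ℚ(φ)` of an irreducible character `φ` this group
acts through the decomposition group of the prime above `p` given by the embedding of `C` into the
algebraic closure of `ℚ_p`, so that these are the `φ^s` for `s` in that decomposition group. -/
def conjugateCharacters (φ : G → PadicAlgCl p) : Set (G → PadicAlgCl p) :=
  Set.range fun s : Gal(PadicAlgCl p/ℚ_[p]) => fun ν => s (φ ν)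

theorem finite_conjugateCharacters (φ : G → PadicAlgCl p) :
    (conjugateCharacters p φ).Finite := by
  have hfin : (Set.pi Set.univ fun ν : G =>
      ((minpoly ℚ_[p] (φ ν)).rootSet (PadicAlgCl p))).Finite :=
    Set.Finite.pi fun ν => Polynomial.rootSet_finite _ _
  refine hfin.subset ?_
  rintro _ ⟨s, rfl⟩ ν -
  have hint : IsIntegral ℚ_[p] (φ ν) := (PadicAlgCl.isAlgebraic p).isAlgebraic _ |>.isIntegral
  rw [Polynomial.mem_rootSet]
  refine ⟨minpoly.ne_zero hint, ?_⟩
  have := congrArg s (minpoly.aeval ℚ_[p] (φ ν))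
  rw [map_zero] at this
  rw [← this]
  exact Polynomial.aeval_algHom_apply (s : PadicAlgCl p →ₐ[ℚ_[p]] PadicAlgCl p) _ _

/-- The `p`-adic character `θ = ∑ φ^s` above `φ`, the sum of the distinct conjugates of `φ`
over `ℚ_p`. -/
def padicCharacter (φ : G → PadicAlgCl p) : G → PadicAlgCl p :=
  ∑ ψ ∈ (finite_conjugateCharacters p φ).toFinset, ψ

/-- `θ` is an irreducible `p`-adic character of `G`. -/
def IsIrreduciblePadicCharacter (θ : G → PadicAlgCl p) : Prop :=
  ∃ φ ∈ irreducibleCharacters p G, θ = padicCharacter p φ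

open scoped Classical in
/-- The absolutely irreducible characters `φ ∣ θ`. -/
def constituents (θ : G → PadicAlgCl p) : Finset (G → PadicAlgCl p) :=
  {φ ∈ irreducibleCharacters p G | padicCharacter p φ = θ}

/-- The central idempotent `e_φ = (φ(1) / |G|) ∑ φ(ν⁻¹) ν`. -/
def idempotentPhi (φ : G → PadicAlgCl p) : MonoidAlgebra (PadicAlgCl p) G :=
  ∑ ν : G, MonoidAlgebra.single ν (φ 1 / (Fintype.card G : PadicAlgCl p) * φ ν⁻¹)

/-- The idempotent `e_θ = ∑_{φ ∣ θ} e_φ`; its coefficients lie in `ℤ_p` when `p` does not divide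
the order of `G`. -/
def idempotentTheta (θ : G → PadicAlgCl p) : MonoidAlgebra (PadicAlgCl p) G :=
  ∑ φ ∈ constituents p θ, idempotentPhi p φ

open scoped Classical in
/-- Reduction modulo `p` of the elements of `ℤ_p`, seen in the algebraic closure of `ℚ_p`: the
class `a ∈ 𝔽_p` with `|x - a| < 1` (and the junk value `0` for an `x` congruent to no rational
integer). -/
def reduceModP (x : PadicAlgCl p) : ZMod p :=
  if h : ∃ a : ZMod p, ‖x - (a.val : PadicAlgCl p)‖ < 1 then h.choose else 0

/-- The idempotent `e_θ` seen in `𝔽_p[G]`. -/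
def idempotentThetaModP (θ : G → PadicAlgCl p) : MonoidAlgebra (ZMod p) G :=
  ∑ ν : G, MonoidAlgebra.single ν (reduceModP p ((idempotentTheta p θ).coeff ν))

/-- The field of values `C = ℚ(φ(ν), ν ∈ G)` of `φ`. -/
abbrev fieldOfValues (φ : G → PadicAlgCl p) : IntermediateField ℚ (PadicAlgCl p) :=
  IntermediateField.adjoin ℚ (Set.range φ)

/-! ### Local regulators -/

open scoped Classical in
/-- The value at `X = x` of the factor `P^φ(X) = det (∑ X_ν ρ_φ(ν⁻¹))` of the group determinant,
where `ρ_φ` is a representation of character `φ` (it is unique up to isomorphism, and the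
determinant does not depend on the choice). -/
def groupDeterminantFactor (φ : G → PadicAlgCl p) (x : G → PadicAlgCl p) : PadicAlgCl p :=
  if h : IsIrreducibleCharacter p φ then
    LinearMap.det (∑ ν : G, x ν • (h.choose_spec.choose ν⁻¹))
  else 0

end Characters

section Regulator

variable (p : ℕ) [hp : Fact p.Prime] {K : Type*} [Field K] [NumberField K]

/-- The product `∏_{φ ∣ θ} P^φ(…, α^ν, …)`, where `K` is seen in the algebraic closure of `ℚ_p`
through `ι`. For `α ≡ α_p(η) (mod p)` this is the local `θ`-regulator `Δ_p^θ(η)` of `η`, which is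
only defined modulo `p`. -/
def localRegulator (ι : K →+* PadicAlgCl p) (θ : Gal(K/ℚ) → PadicAlgCl p) (α : K) :
    PadicAlgCl p :=
  ∏ φ ∈ constituents p θ, groupDeterminantFactor p φ fun ν => ι (ν α)

/-- `x ≡ 0 (mod p)` in the ring of integers (the closed unit ball) of the algebraic closure
of `ℚ_p`. -/
def IsZeroModP (x : PadicAlgCl p) : Prop :=
  ∃ y : PadicAlgCl p, ‖y‖ ≤ 1 ∧ x = (p : PadicAlgCl p) * y

/-- The `θ`-component `ℒ^θ = e_θ ℒ` of the module of relations associated with `α`,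
as an `𝔽_p`-vector space. -/
def relationsTheta (θ : Gal(K/ℚ) → PadicAlgCl p) (α : K) :
    Submodule (ZMod p) (MonoidAlgebra (ZMod p) Gal(K/ℚ)) :=
  ((relations p α).restrictScalars (ZMod p)).map
    (LinearMap.mulLeft (ZMod p) (idempotentThetaModP p θ))

end Regulator

end LocalRegulator

end

/-! Let `O` be the ring of integers of the algebraic closure of `ℚ_p`, `k` its residue field and `R
= ∑ ν(α) ν⁻¹ ∈ O[G]` the resolvent of a `p`-integer `α`. Up to a conjugation in `K`, the
coefficients of `U * R` are the sum `∑ u(ν) ν⁻¹(α)` whose vanishing modulo `p` defines a relation.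
Since `p` is unramified and the primes above it are conjugate, a `p`-integer is divisible by `p` as
soon as all its conjugates reduce to `0` in `k`. Hence `U` is a relation if and only if it kills the
reduction of `R` from the left (`mem_relations_iff`).

A Frobenius of `k` lifts to an automorphism of the algebraic closure of `ℚ_p`, which restricts to
some `σ ∈ G`. It turns the reduced resolvent into its product with `σ`, so the left annihilator over
`k` is stable under Frobenius and, if nonzero, has a nonzero vector over `𝔽_p`. Therefore `ℒ^θ ≠ 0`
if and only if right multiplication by `R e_θ + (1 - e_θ)` is singular over `k`, that is, its
determinant is not a unit of `O`. An irreducible representation sends `e_θ` to `1` or `0` according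
to whether its character divides `θ`, and eigenvalues of elements of `O[G]` are integral; so this
determinant is a unit exactly when each factor of the regulator is
(`prod_groupDeterminantFactor_norm_lt_one_iff`).

This yields `|Δ| < 1` rather than divisibility by `p`. But `Δ` is fixed by every automorphism fixing
`ι(K)`, so it lies in the closure of `ι(K)`, where no absolute value falls strictly between `p⁻¹`
and `1` (`isZeroModP_localRegulator_iff`).

For the dimension, `p ∤ |G|` makes `𝔽_p[G]` semisimple, so `ℒ` is generated by an idempotent, which
lifts to `ℤ_p[G]`. The rank of an idempotent matrix over `ℤ_p` is its trace and survives reduction,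
so the dimension of `ℒ^θ` is a character sum `∑_{φ ∣ θ} φ(1) δ`, where `δ ≤ φ(1)` is the rank of the
idempotent in `ρ_φ`, the same for all conjugates (`finrank_map_mulLeft_idempotentThetaModP`).
Finally the `φ ∣ θ` form one Frobenius orbit, because characters are determined by their reductions,
and its length is `f` (`card_constituents`). -/

noncomputable section

namespace LocalRegulator

/-! ### The ring of integers of the algebraic closure of `ℚ_p` -/

section Integers

variable (p : ℕ) [hp : Fact p.Prime]

/-- The ring of integers of the algebraic closure of `ℚ_p`: the closed unit ball. -/
def integers : Subring (PadicAlgCl p) where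
  carrier := {x | ‖x‖ ≤ 1}
  mul_mem' := by
    intro x y hx hy
    change ‖x * y‖ ≤ 1
    rw [norm_mul]
    exact mul_le_one₀ hx (norm_nonneg _) hy
  one_mem' := by simp
  add_mem' := by
    intro x y hx hy
    exact (IsUltrametricDist.norm_add_le_max x y).trans (max_le hx hy)
  zero_mem' := by simp
  neg_mem' := by
    intro x hx
    simpa using hx

variable {p}

theorem mem_integers {x : PadicAlgCl p} : x ∈ integers p ↔ ‖x‖ ≤ 1 := Iff.rfl

theorem norm_coe_le_one (x : integers p) : ‖(x : PadicAlgCl p)‖ ≤ 1 := x.2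

theorem isUnit_integers_iff {x : integers p} : IsUnit x ↔ ‖(x : PadicAlgCl p)‖ = 1 := by
  constructor
  · rintro ⟨u, rfl⟩
    have h : ((u : integers p) : PadicAlgCl p) * ((u⁻¹ : (integers p)ˣ) : integers p) = 1 := by
      rw [← Subring.coe_mul, Units.mul_inv, Subring.coe_one]
    have h1 := congrArg norm h
    rw [norm_mul, norm_one] at h1
    refine le_antisymm (norm_coe_le_one _) ?_
    by_contra! h2
    have := mul_lt_mul'' h2 (lt_of_le_of_ne (norm_coe_le_one ((u⁻¹ : (integers p)ˣ) : integers p)) ?_)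
      (norm_nonneg _) (norm_nonneg _)
    · rw [h1] at this; simp at this
    · intro h3
      rw [h3, mul_one] at h1
      exact h2.ne h1
  · intro h
    have hx : (x : PadicAlgCl p) ≠ 0 := by
      intro h0; rw [h0] at h; simp at h
    refine IsUnit.of_mul_eq_one (⟨(x : PadicAlgCl p)⁻¹, ?_⟩ : integers p) ?_
    · rw [mem_integers, norm_inv, h, inv_one]
    · ext
      simp [hx]

instance : IsLocalRing (integers p) := by
  refine IsLocalRing.of_nonunits_add ?_
  intro a b ha hb
  rw [mem_nonunits_iff, isUnit_integers_iff] at *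
  have ha' := lt_of_le_of_ne (norm_coe_le_one a) ha
  have hb' := lt_of_le_of_ne (norm_coe_le_one b) hb
  exact ((IsUltrametricDist.norm_add_le_max (a : PadicAlgCl p) b).trans_lt (max_lt ha' hb')).ne

variable (p) in
/-- The residue field of the algebraic closure of `ℚ_p`. -/
abbrev residueField : Type := IsLocalRing.ResidueField (integers p)

variable (p) in
/-- Reduction modulo the maximal ideal. -/
abbrev residue : integers p →+* residueField p := IsLocalRing.residue (integers p)

theorem residue_eq_zero_iff {x : integers p} : residue p x = 0 ↔ ‖(x : PadicAlgCl p)‖ < 1 := by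
  rw [IsLocalRing.residue_eq_zero_iff, IsLocalRing.mem_maximalIdeal, mem_nonunits_iff,
    isUnit_integers_iff]
  exact ⟨fun h => lt_of_le_of_ne x.2 h, fun h => h.ne⟩

theorem residue_eq_iff {x y : integers p} :
    residue p x = residue p y ↔ ‖(x : PadicAlgCl p) - y‖ < 1 := by
  rw [← sub_eq_zero, ← map_sub, residue_eq_zero_iff]
  rfl

theorem norm_natCast_p : ‖(p : PadicAlgCl p)‖ = (p : ℝ)⁻¹ := by
  have := PadicAlgCl.norm_extends p (p : ℚ_[p])
  rw [Padic.norm_p] at this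
  simpa using this

theorem natCast_p_ne_zero : (p : PadicAlgCl p) ≠ 0 := by
  exact_mod_cast hp.out.ne_zero

theorem norm_natCast_p_lt_one : ‖(p : PadicAlgCl p)‖ < 1 := by
  rw [norm_natCast_p]
  exact inv_lt_one_of_one_lt₀ (by exact_mod_cast hp.out.one_lt)

theorem norm_natCast_eq_one {d : ℕ} (hd : ¬ p ∣ d) : ‖(d : PadicAlgCl p)‖ = 1 := by
  have := PadicAlgCl.norm_extends p (d : ℚ_[p])
  rw [Padic.norm_natCast_eq_one_iff.mpr ((Nat.Prime.coprime_iff_not_dvd hp.out).mpr hd)] at this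
  simpa using this

theorem isZeroModP_iff (x : PadicAlgCl p) : IsZeroModP p x ↔ ‖x‖ ≤ (p : ℝ)⁻¹ := by
  constructor
  · rintro ⟨y, hy, rfl⟩
    rw [norm_mul, norm_natCast_p]
    exact mul_le_of_le_one_right (by positivity) hy
  · intro h
    refine ⟨(p : PadicAlgCl p)⁻¹ * x, ?_, by field_simp [natCast_p_ne_zero (p := p)]⟩
    rw [norm_mul, norm_inv, norm_natCast_p, inv_inv]
    have : (0 : ℝ) < p := by exact_mod_cast hp.out.pos
    calc (p : ℝ) * ‖x‖ ≤ p * (p : ℝ)⁻¹ := by gcongr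
      _ = 1 := by field_simp

instance : CharP (residueField p) p := by
  refine (CharP.charP_iff_prime_eq_zero hp.out).mpr ?_
  have : residue p (p : integers p) = 0 := by
    rw [residue_eq_zero_iff]
    simpa using norm_natCast_p_lt_one (p := p)
  simpa using this

instance : Algebra (ZMod p) (residueField p) := ZMod.algebra _ p

/-- A root of a monic polynomial with integral coefficients is integral. -/
theorem norm_le_one_of_root {f : Polynomial (integers p)} (hf : f.Monic) {x : PadicAlgCl p}
    (hx : Polynomial.eval₂ (integers p).subtype x f = 0) : ‖x‖ ≤ 1 := by
  by_contra! h
  have hx0 : x ≠ 0 := by intro h0; rw [h0, norm_zero] at h; linarith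
  rw [Polynomial.eval₂_eq_sum_range, Finset.sum_range_succ, hf.coeff_natDegree, map_one, one_mul,
    add_eq_zero_iff_eq_neg] at hx
  have h1 : ‖∑ i ∈ Finset.range f.natDegree, (integers p).subtype (f.coeff i) * x ^ i‖
      < ‖x‖ ^ f.natDegree := by
    obtain ⟨i, hi, hle⟩ := IsUltrametricDist.exists_norm_finsetSum_le (Finset.range f.natDegree)
      (fun i => (integers p).subtype (f.coeff i) * x ^ i)
    refine hle.trans_lt ?_
    have hpos : 0 < f.natDegree := by
      by_contra! h0
      obtain h0 : f.natDegree = 0 := by omega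
      rw [h0] at hx
      simp at hx
    replace hi := hi ⟨0, Finset.mem_range.mpr hpos⟩
    rw [norm_mul, norm_pow]
    calc _ ≤ 1 * ‖x‖ ^ i := by
          gcongr
          exact norm_coe_le_one _
      _ < _ := by
          rw [one_mul]
          exact pow_lt_pow_right₀ h (Finset.mem_range.mp hi)
  rw [hx, norm_neg, norm_pow] at h1
  exact lt_irrefl _ h1

theorem norm_le_one_of_isIntegral {x : PadicAlgCl p} (hx : IsIntegral ℤ x) : ‖x‖ ≤ 1 := by
  obtain ⟨f, hf, hfx⟩ := hx
  refine norm_le_one_of_root (hf.map (Int.castRingHom (integers p))) ?_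
  rw [Polynomial.eval₂_map]
  have : (integers p).subtype.comp (Int.castRingHom _) = algebraMap ℤ (PadicAlgCl p) :=
    RingHom.ext_int _ _
  rw [this]
  exact hfx

/-- The norm is the spectral norm, which depends only on the minimal polynomial. -/
theorem norm_galois (s : Gal(PadicAlgCl p/ℚ_[p])) (x : PadicAlgCl p) : ‖s x‖ = ‖x‖ := by
  rw [← PadicAlgCl.spectralNorm_eq, ← PadicAlgCl.spectralNorm_eq, ← spectralNorm_eq_of_equiv]

instance : IsGalois ℚ_[p] (PadicAlgCl p) where
  
theorem exists_padicInt_of_fixed {x : PadicAlgCl p} (hx : ‖x‖ ≤ 1)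
    (h : ∀ s : Gal(PadicAlgCl p/ℚ_[p]), s x = x) :
    ∃ z : ℤ_[p], algebraMap ℚ_[p] (PadicAlgCl p) z = x := by
  obtain ⟨y, rfl⟩ := (InfiniteGalois.mem_bot_iff_fixed x).mpr h
  refine ⟨⟨y, ?_⟩, rfl⟩
  rw [← PadicAlgCl.norm_extends]
  exact hx

instance : Algebra ℤ_[p] (integers p) :=
  (((algebraMap ℚ_[p] (PadicAlgCl p)).comp PadicInt.Coe.ringHom).codRestrict (integers p)
    fun z => by
      rw [mem_integers]
      exact (PadicAlgCl.norm_extends p _).trans_le z.2).toAlgebra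

theorem coe_algebraMap_integers (z : ℤ_[p]) :
    ((algebraMap ℤ_[p] (integers p) z : integers p) : PadicAlgCl p) =
      algebraMap ℚ_[p] (PadicAlgCl p) z := rfl

instance : MulSemiringAction Gal(PadicAlgCl p/ℚ_[p]) (integers p) where
  smul s x := ⟨s x, (norm_galois s x).trans_le x.2⟩
  one_smul _ := rfl
  mul_smul _ _ _ := rfl
  smul_zero s := Subtype.ext (map_zero s)
  smul_add s _ _ := Subtype.ext (map_add s _ _)
  smul_one s := Subtype.ext (map_one s)
  smul_mul s _ _ := Subtype.ext (map_mul s _ _)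

theorem coe_galois_smul (s : Gal(PadicAlgCl p/ℚ_[p])) (x : integers p) :
    ((s • x : integers p) : PadicAlgCl p) = s x := rfl

instance : SMulCommClass Gal(PadicAlgCl p/ℚ_[p]) ℤ_[p] (integers p) where
  smul_comm s z x := by
    ext
    rw [Algebra.smul_def, Algebra.smul_def, coe_galois_smul, Subring.coe_mul, Subring.coe_mul,
      map_mul, coe_algebraMap_integers, AlgEquiv.commutes, coe_galois_smul]

/-- This places `ℤ_p ⊆ O` in the setting where the decomposition group surjects onto the
automorphisms of the residue extension. -/
instance : Algebra.IsInvariant ℤ_[p] (integers p) Gal(PadicAlgCl p/ℚ_[p]) where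
  isInvariant x hx := by
    obtain ⟨z, hz⟩ := exists_padicInt_of_fixed x.2 fun s => congrArg Subtype.val (hx s)
    exact ⟨z, Subtype.ext hz⟩

/-- Makes the Frobenius of the residue field surjective. -/
theorem exists_pow_eq_integers (x : integers p) : ∃ y : integers p, y ^ p = x := by
  obtain ⟨y, hy⟩ := IsAlgClosed.exists_pow_nat_eq (x : PadicAlgCl p) hp.out.pos
  refine ⟨⟨y, ?_⟩, Subtype.ext hy⟩
  rw [mem_integers]
  have h := x.2
  rw [mem_integers, ← hy, norm_pow] at h
  exact (pow_le_one_iff_of_nonneg (norm_nonneg _) hp.out.ne_zero).mp h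

instance : (IsLocalRing.maximalIdeal (integers p)).LiesOver (IsLocalRing.maximalIdeal ℤ_[p]) :=
  ⟨by
    ext z
    rw [Ideal.under_def, Ideal.mem_comap, IsLocalRing.mem_maximalIdeal, IsLocalRing.mem_maximalIdeal,
      mem_nonunits_iff, mem_nonunits_iff, isUnit_integers_iff, PadicInt.isUnit_iff,
      coe_algebraMap_integers, PadicAlgCl.norm_extends]
    rfl⟩

variable (p) in
/-- The Frobenius automorphism of the residue field. -/
def residueFrobenius :
    (integers p ⧸ IsLocalRing.maximalIdeal (integers p)) ≃ₐ[ℤ_[p] ⧸ IsLocalRing.maximalIdeal ℤ_[p]]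
      (integers p ⧸ IsLocalRing.maximalIdeal (integers p)) :=
  letI : Field (integers p ⧸ IsLocalRing.maximalIdeal (integers p)) := Ideal.Quotient.field _
  haveI : CharP (integers p ⧸ IsLocalRing.maximalIdeal (integers p)) p :=
    inferInstanceAs (CharP (residueField p) p)
  AlgEquiv.ofBijective
    { frobenius (integers p ⧸ IsLocalRing.maximalIdeal (integers p)) p with
      commutes' := by
        intro a
        obtain ⟨z, rfl⟩ := Ideal.Quotient.mk_surjective a
        obtain ⟨n, -, hn⟩ := PadicInt.exists_mem_range z
        -- The residue field of `ℤ_p` consists of classes of natural numbers, which Frobenius fixes.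
        have : Ideal.Quotient.mk (IsLocalRing.maximalIdeal ℤ_[p]) z = (n : ℤ_[p] ⧸ _) := by
          rw [← map_natCast (Ideal.Quotient.mk _), Ideal.Quotient.eq]
          exact hn
        rw [this, map_natCast]
        exact map_natCast (frobenius _ p) n }
    ⟨(frobenius (integers p ⧸ IsLocalRing.maximalIdeal (integers p)) p).injective, by
      intro a
      obtain ⟨x, rfl⟩ := Ideal.Quotient.mk_surjective a
      obtain ⟨y, rfl⟩ := exists_pow_eq_integers x
      exact ⟨Ideal.Quotient.mk _ y, (map_pow _ _ _).symm⟩⟩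

variable (p) in
/-- There is an automorphism of the algebraic closure of `ℚ_p` which lifts the Frobenius. -/
theorem exists_frobenius : ∃ s : Gal(PadicAlgCl p/ℚ_[p]), ∀ x : integers p,
    residue p (s • x) = residue p x ^ p := by
  -- The surjectivity theorem for profinite groups wants a continuous action on a discrete ring.
  -- With the discrete topology, continuity means that stabilizers are open, which holds because
  -- every element is algebraic over `ℚ_p`.
  let : TopologicalSpace (integers p) := ⊥
  have : DiscreteTopology (integers p) := ⟨rfl⟩
  have : ContinuousSMul Gal(PadicAlgCl p/ℚ_[p]) (integers p) := by
    refine ⟨continuous_prod_of_discrete_right.mpr fun x => ?_⟩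
    rw [continuous_discrete_rng]
    intro y
    rw [isOpen_iff_mem_nhds]
    intro s hs
    have ho : IsOpen (MulAction.stabilizer Gal(PadicAlgCl p/ℚ_[p]) (x : PadicAlgCl p) :
      Set Gal(PadicAlgCl p/ℚ_[p])) := stabilizer_isOpen_of_isIntegral _
    refine Filter.mem_of_superset ((ho.smul s).mem_nhds ⟨1, one_mem _, by simp⟩) ?_
    rintro _ ⟨t, ht, rfl⟩
    have hs' : s • x = y := hs
    change (s * t) • x = y
    rw [mul_smul, ← hs']
    congr 1
    exact Subtype.ext ht
  obtain ⟨⟨s, hs⟩, h⟩ := Ideal.Quotient.stabilizerHom_surjective_of_profinite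
    (G := Gal(PadicAlgCl p/ℚ_[p])) (IsLocalRing.maximalIdeal ℤ_[p])
    (IsLocalRing.maximalIdeal (integers p)) (residueFrobenius p)
  refine ⟨s, fun x => ?_⟩
  exact DFunLike.congr_fun h (Ideal.Quotient.mk _ x)

end Integers

/-! ### Right multiplication in a group algebra -/

section RightMul

variable {R S G : Type*} [CommRing R] [CommRing S] [Group G] [Fintype G] [DecidableEq G]

/-- The matrix of the right multiplication by `y` on `R[G]`. -/
def rightMulMatrix (y : MonoidAlgebra R G) : Matrix G G R :=
  Matrix.of fun g h => y.coeff (h⁻¹ * g)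

omit [DecidableEq G] in
theorem rightMulMatrix_mulVec (y u : MonoidAlgebra R G) :
    (rightMulMatrix y).mulVec u.coeff = (u * y).coeff := by
  ext g
  rw [MonoidAlgebra.coeff_mul_apply_left, Finsupp.sum_fintype _ _ (by simp)]
  exact Finset.sum_congr rfl fun h _ => mul_comm _ _

omit [Fintype G] in
theorem rightMulMatrix_one : rightMulMatrix (1 : MonoidAlgebra R G) = 1 := by
  ext g h
  rw [rightMulMatrix, Matrix.of_apply, MonoidAlgebra.one_def, MonoidAlgebra.coeff_single,
    Finsupp.single_apply, Matrix.one_apply]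
  congr 1
  rw [eq_iff_iff, eq_comm, inv_mul_eq_one, eq_comm]

-- Right multiplications compose in the opposite order.
omit [DecidableEq G] in
theorem rightMulMatrix_mul (y z : MonoidAlgebra R G) :
    rightMulMatrix (y * z) = rightMulMatrix z * rightMulMatrix y := by
  ext g h
  rw [rightMulMatrix, Matrix.of_apply, MonoidAlgebra.coeff_mul_apply_left,
    Finsupp.sum_fintype _ _ (by simp), Matrix.mul_apply]
  refine Fintype.sum_equiv (Equiv.mulLeft h) _ _ fun a => ?_
  simp [rightMulMatrix, mul_comm, mul_assoc]

omit [Fintype G] [DecidableEq G] in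
theorem rightMulMatrix_map (f : R →+* S) (y : MonoidAlgebra R G) :
    rightMulMatrix (MonoidAlgebra.mapRingHom G f y) = (rightMulMatrix y).map f := by
  ext g h
  simp [rightMulMatrix]

theorem det_rightMulMatrix_map (f : R →+* S) (y : MonoidAlgebra R G) :
    (rightMulMatrix (MonoidAlgebra.mapRingHom G f y)).det = f (rightMulMatrix y).det := by
  rw [rightMulMatrix_map, RingHom.map_det]
  rfl

-- Translates an eigenvalue `c` of the matrix into non-invertibility of `y - c` in the group
-- algebra.
omit [DecidableEq G] in
theorem rightMulMatrix_sub_algebraMap [DecidableEq G] (y : MonoidAlgebra R G) (c : R) :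
    rightMulMatrix (y - algebraMap R _ c) = rightMulMatrix y - Matrix.scalar G c := by
  ext g h
  simp only [rightMulMatrix, Matrix.of_apply, MonoidAlgebra.coeff_sub, Matrix.sub_apply,
    Finsupp.coe_sub, Pi.sub_apply, Matrix.scalar_apply, Matrix.diagonal_apply,
    MonoidAlgebra.coe_algebraMap, Function.comp_apply, Algebra.algebraMap_self, RingHom.id_apply,
    MonoidAlgebra.coeff_single, Finsupp.single_apply]
  congr 2
  rw [eq_iff_iff, eq_comm, inv_mul_eq_one, eq_comm]

/-- An element of `R[G]` whose right multiplication has invertible determinant is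
left invertible. -/
theorem exists_mul_eq_one_of_isUnit_det {y : MonoidAlgebra R G}
    (h : IsUnit (rightMulMatrix y).det) : ∃ z, z * y = 1 := by
  let w : G → R := (rightMulMatrix y)⁻¹.mulVec (1 : MonoidAlgebra R G).coeff
  refine ⟨MonoidAlgebra.ofCoeff (Finsupp.equivFunOnFinite.symm w), ?_⟩
  rw [← MonoidAlgebra.coeff_inj, ← DFunLike.coe_fn_eq, ← rightMulMatrix_mulVec]
  change (rightMulMatrix y).mulVec w = _
  rw [Matrix.mulVec_mulVec, Matrix.mul_nonsing_inv _ h, Matrix.one_mulVec]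

theorem isUnit_det_of_mul_eq_one {y z : MonoidAlgebra R G} (h : z * y = 1) :
    IsUnit (rightMulMatrix y).det := by
  refine IsUnit.of_mul_eq_one (rightMulMatrix z).det ?_
  rw [← Matrix.det_mul, ← rightMulMatrix_mul, h, rightMulMatrix_one, Matrix.det_one]

theorem exists_mul_eq_zero_iff {F : Type*} [Field F] {y : MonoidAlgebra F G} :
    (∃ u ≠ 0, u * y = 0) ↔ (rightMulMatrix y).det = 0 := by
  rw [← Matrix.exists_mulVec_eq_zero_iff]
  constructor
  · rintro ⟨u, hu, huy⟩
    refine ⟨u.coeff, ?_, ?_⟩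
    · rw [Ne, ← Finsupp.coe_zero, DFunLike.coe_fn_eq]
      simpa using hu
    · rw [rightMulMatrix_mulVec, huy]
      simp
  · rintro ⟨w, hw, h⟩
    refine ⟨MonoidAlgebra.ofCoeff (Finsupp.equivFunOnFinite.symm w), ?_, ?_⟩
    · intro h0
      apply hw
      have := congrArg (fun u => (u.coeff : G → F)) h0
      simpa using this
    · rw [← MonoidAlgebra.coeff_inj, ← DFunLike.coe_fn_eq, ← rightMulMatrix_mulVec]
      exact h

end RightMul

/-! ### Irreducible representations -/

section Irreducible

variable {F G : Type*} [Field F] [Group G]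

theorem isIrreducible_of_forall {V : Type*} [AddCommGroup V] [Module F V] [Nontrivial V]
    (ρ : Representation F G V)
    (h : ∀ W : Submodule F V, (∀ g, ∀ v ∈ W, ρ g v ∈ W) → W = ⊥ ∨ W = ⊤) : ρ.IsIrreducible where
  exists_pair_ne := by
    refine ⟨⊥, ⊤, fun h0 => ?_⟩
    have h1 := congrArg Subrepresentation.toSubmodule h0
    exact bot_ne_top h1
  eq_bot_or_eq_top W := by
    rcases h W.toSubmodule (fun g v hv => W.apply_mem_toSubmodule g hv) with h1 | h1
    · exact Or.inl (Subrepresentation.toSubmodule_injective h1)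
    · exact Or.inr (Subrepresentation.toSubmodule_injective h1)

theorem eq_bot_or_eq_top_of_isIrreducible {V : Type*} [AddCommGroup V] [Module F V]
    {ρ : Representation F G V} (hρ : ρ.IsIrreducible) (W : Submodule F V)
    (h : ∀ g, ∀ v ∈ W, ρ g v ∈ W) : W = ⊥ ∨ W = ⊤ := by
  rcases hρ.eq_bot_or_eq_top ⟨W, h⟩ with h1 | h1
  · exact Or.inl (congrArg Subrepresentation.toSubmodule h1)
  · exact Or.inr (congrArg Subrepresentation.toSubmodule h1)

theorem nontrivial_of_isIrreducible {V : Type*} [AddCommGroup V] [Module F V]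
    {ρ : Representation F G V} (hρ : ρ.IsIrreducible) : Nontrivial V := by
  by_contra h
  rw [not_nontrivial_iff_subsingleton] at h
  obtain ⟨a, b, hab⟩ := hρ.exists_pair_ne
  exact hab (Subrepresentation.toSubmodule_injective (Subsingleton.elim _ _))

/-- **Schur's lemma**. -/
theorem exists_eq_smul_one_of_commute [IsAlgClosed F] {V : Type*} [AddCommGroup V] [Module F V]
    [FiniteDimensional F V] {ρ : Representation F G V} (hρ : ρ.IsIrreducible)
    (T : Module.End F V) (hT : ∀ g, Commute T (ρ g)) : ∃ c : F, T = c • 1 := by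
  have := nontrivial_of_isIrreducible hρ
  obtain ⟨c, hc⟩ := Module.End.exists_eigenvalue T
  refine ⟨c, ?_⟩
  rcases eq_bot_or_eq_top_of_isIrreducible hρ (Module.End.eigenspace T c) (fun g v hv => by
    rw [Module.End.mem_eigenspace_iff] at hv ⊢
    have := LinearMap.congr_fun (hT g).eq v
    simp only [Module.End.mul_apply] at this
    rw [this, hv, map_smul]) with h | h
  · exact absurd h hc
  · ext v
    have : v ∈ Module.End.eigenspace T c := h ▸ Submodule.mem_top
    simpa using Module.End.mem_eigenspace_iff.mp this

/-- A simple module over the group algebra, as a matrix representation. -/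
theorem exists_irreducible_of_isSimpleModule (M : Type*) [AddCommGroup M] [Module F M]
    [Module (MonoidAlgebra F G) M] [IsScalarTower F (MonoidAlgebra F G) M]
    [FiniteDimensional F M] [hsimple : IsSimpleModule (MonoidAlgebra F G) M] (m₀ : M) :
    ∃ (d : ℕ) (ρ : Representation F G (Fin d → F)) (v : Fin d → F),
      ρ.IsIrreducible ∧ ∀ a, ρ.asAlgebraHom a v = 0 ↔ a • m₀ = 0 := by
  let e : M ≃ₗ[F] (Fin (Module.finrank F M) → F) := (Module.finBasis F M).equivFun
  let Φ : MonoidAlgebra F G →ₐ[F] Module.End F (Fin (Module.finrank F M) → F) :=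
    (e.conjAlgEquiv F).toAlgHom.comp (Algebra.lsmul F F M)
  let ρ : Representation F G (Fin (Module.finrank F M) → F) :=
    (MonoidAlgebra.lift F _ G).symm Φ
  have hρ : ρ.asAlgebraHom = Φ := (MonoidAlgebra.lift F _ G).apply_symm_apply Φ
  have hΦ : ∀ a m, Φ a (e m) = e (a • m) := by
    intro a m
    simp [Φ, LinearEquiv.conjAlgEquiv]
  refine ⟨_, ρ, e m₀, ?_, ?_⟩
  · have : Nontrivial M := hsimple.nontrivial
    have : Nontrivial (Fin (Module.finrank F M) → F) := e.symm.toEquiv.nontrivial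
    refine isIrreducible_of_forall ρ fun W hW => ?_
    have hW' : ∀ a : MonoidAlgebra F G, ∀ v ∈ W, Φ a v ∈ W := by
      intro a v hv
      rw [← hρ]
      induction a using MonoidAlgebra.induction_linear with
      | zero => simp
      | add f g hf hg => rw [map_add]; exact add_mem hf hg
      | single g c =>
        rw [Representation.asAlgebraHom_single]
        exact W.smul_mem c (hW g v hv)
    let N : Submodule (MonoidAlgebra F G) M :=
      { carrier := {m | e m ∈ W}
        add_mem' := fun {a b} ha hb => by
          change e (a + b) ∈ W
          rw [map_add]; exact W.add_mem ha hb
        zero_mem' := by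
          change e 0 ∈ W
          rw [map_zero]; exact W.zero_mem
        smul_mem' := fun a m hm => by
          change e (a • m) ∈ W
          rw [← hΦ]; exact hW' a _ hm }
    have hN : ∀ v, v ∈ W ↔ e.symm v ∈ N := fun v => by
      change _ ↔ e (e.symm v) ∈ W
      rw [e.apply_symm_apply]
    rcases eq_bot_or_eq_top N with h | h
    · left
      rw [eq_bot_iff]
      intro v hv
      rw [hN, h, Submodule.mem_bot] at hv
      simpa using hv
    · right
      rw [eq_top_iff]
      intro v _
      rw [hN, h]
      trivial
  · intro a
    rw [hρ, hΦ, LinearEquiv.map_eq_zero_iff]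

/-- The quotient of the group algebra by a maximal left ideal, as a matrix representation. -/
theorem exists_irreducible_of_isMaximal [Finite G] (I : Ideal (MonoidAlgebra F G))
    (hI : I.IsMaximal) : ∃ (d : ℕ) (ρ : Representation F G (Fin d → F)) (v : Fin d → F),
      ρ.IsIrreducible ∧ ∀ a, ρ.asAlgebraHom a v = 0 ↔ a ∈ I := by
  have : Module.Finite F (MonoidAlgebra F G ⧸ I) :=
    Module.Finite.trans (MonoidAlgebra F G) _
  have hsimple : IsSimpleModule (MonoidAlgebra F G) (MonoidAlgebra F G ⧸ I) :=
    isSimpleModule_iff_isCoatom.mpr hI.out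
  obtain ⟨d, ρ, v, hρ, hv⟩ :=
    exists_irreducible_of_isSimpleModule (F := F) (G := G) (MonoidAlgebra F G ⧸ I) (I.mkQ 1)
  refine ⟨d, ρ, v, hρ, fun a => ?_⟩
  rw [hv, ← map_smul, smul_eq_mul, mul_one, Submodule.mkQ_apply, Submodule.Quotient.mk_eq_zero]

/-- An element of the group algebra that vanishes in all irreducible representations is zero. -/
theorem eq_zero_of_forall_irreducible [Finite G] [NeZero (Nat.card G : F)] (a : MonoidAlgebra F G)
    (h : ∀ (d : ℕ) (ρ : Representation F G (Fin d → F)), ρ.IsIrreducible →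
      ρ.asAlgebraHom a = 0) : a = 0 := by
  -- By Maschke the group algebra is semisimple, so its radical is zero; and the radical is the
  -- intersection of the maximal left ideals, each of which is the annihilator of a vector in an
  -- irreducible representation.
  have hJ : Ring.jacobson (MonoidAlgebra F G) = ⊥ :=
    IsSemisimpleModule.jacobson_eq_bot (MonoidAlgebra F G) (MonoidAlgebra F G)
  have : a ∈ Ring.jacobson (MonoidAlgebra F G) := by
    rw [Ring.jacobson_eq_sInf_isMaximal, Submodule.mem_sInf]
    intro I hI
    obtain ⟨d, ρ, v, hρ, hv⟩ := exists_irreducible_of_isMaximal I hI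
    rw [← hv, h d ρ hρ, LinearMap.zero_apply]
  rw [hJ] at this
  simpa using this

end Irreducible

/-! ### Characters and idempotents -/

section Characters

variable {p : ℕ} [hp : Fact p.Prime] {G : Type*} [Group G]

theorem Affords.isIrreducibleCharacter {d : ℕ} {φ : G → PadicAlgCl p}
    {ρ : Representation (PadicAlgCl p) G (Fin d → PadicAlgCl p)} (h : Affords p φ ρ) :
    IsIrreducibleCharacter p φ := ⟨d, ρ, h⟩

theorem Affords.apply_one {d : ℕ} {φ : G → PadicAlgCl p}
    {ρ : Representation (PadicAlgCl p) G (Fin d → PadicAlgCl p)} (h : Affords p φ ρ) :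
    φ 1 = d := by
  rw [← h.2, Representation.char_one]
  simp

theorem Affords.degree_pos {d : ℕ} {φ : G → PadicAlgCl p}
    {ρ : Representation (PadicAlgCl p) G (Fin d → PadicAlgCl p)} (h : Affords p φ ρ) :
    0 < d := by
  have := nontrivial_of_isIrreducible h.1
  by_contra! h0
  obtain rfl : d = 0 := by omega
  exact not_subsingleton (Fin 0 → PadicAlgCl p) inferInstance

variable [Fintype G]

omit hp in
theorem neZero_card [Fact p.Prime] : NeZero (Nat.card G : PadicAlgCl p) :=
  ⟨by exact_mod_cast Nat.card_pos.ne'⟩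

/-- If the representations were not isomorphic, orthonormality would give the common character norm
both `0` and `1`. -/
theorem nonempty_equiv_of_character_eq {d e : ℕ}
    {ρ : Representation (PadicAlgCl p) G (Fin d → PadicAlgCl p)}
    {σ : Representation (PadicAlgCl p) G (Fin e → PadicAlgCl p)} (hρ : ρ.IsIrreducible)
    (hσ : σ.IsIrreducible) (h : ρ.character = σ.character) :
    Nonempty (Representation.Equiv σ ρ) := by
  have hinv : Invertible (Nat.card G : PadicAlgCl p) := invertibleOfNonzero neZero_card.out
  by_contra hn
  have h1 := Representation.char_orthonormal ρ σ
  have h2 := Representation.char_orthonormal σ σ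
  rw [if_neg hn, h] at h1
  rw [if_pos ⟨Representation.Equiv.refl σ⟩, h1] at h2
  exact zero_ne_one h2

open scoped Classical in
/-- The first orthogonality relation. -/
theorem sum_mul_inv_irreducibleCharacter {φ ψ : G → PadicAlgCl p}
    (hφ : IsIrreducibleCharacter p φ) (hψ : IsIrreducibleCharacter p ψ) :
    ∑ g, φ g * ψ g⁻¹ = if φ = ψ then (Fintype.card G : PadicAlgCl p) else 0 := by
  have hc : (Nat.card G : PadicAlgCl p) ≠ 0 := neZero_card.out
  have hinv : Invertible (Nat.card G : PadicAlgCl p) := invertibleOfNonzero hc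
  obtain ⟨d, ρ, hρ, rfl⟩ := hφ
  obtain ⟨e, σ, hσ, rfl⟩ := hψ
  have h := Representation.char_orthonormal ρ σ
  rw [inv_mul_eq_iff_eq_mul₀ hc] at h
  rw [h, ← Nat.card_eq_fintype_card]
  by_cases he : ρ.character = σ.character
  · rw [if_pos he, if_pos (nonempty_equiv_of_character_eq hρ hσ he), mul_one]
  · rw [if_neg he, if_neg (fun h' => he (Representation.char_iso h'.some).symm), mul_zero]

/-- The element `∑ x(ν) ν⁻¹` of the group algebra. -/
def inverseSum {R : Type*} [CommRing R] (x : G → R) : MonoidAlgebra R G :=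
  ∑ ν, MonoidAlgebra.single ν⁻¹ (x ν)

theorem coeff_inverseSum {R : Type*} [CommRing R] (x : G → R) (g : G) :
    (inverseSum x).coeff g = x g⁻¹ := by
  classical
  rw [inverseSum, MonoidAlgebra.coeff_sum, Finsupp.finsetSum_apply, Finset.sum_eq_single g⁻¹]
  · simp
  · intro b _ hb
    rw [MonoidAlgebra.coeff_single, Finsupp.single_apply, if_neg]
    rintro rfl
    simp at hb
  · simp

/-- The definition picks some representation affording `φ`. Any other one is isomorphic to it, and
conjugation does not change the determinant. -/
theorem groupDeterminantFactor_eq {d : ℕ} {φ : G → PadicAlgCl p}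
    {ρ : Representation (PadicAlgCl p) G (Fin d → PadicAlgCl p)} (h : Affords p φ ρ)
    (x : G → PadicAlgCl p) :
    groupDeterminantFactor p φ x = LinearMap.det (ρ.asAlgebraHom (inverseSum x)) := by
  have key : ∀ (e : ℕ) (σ : Representation (PadicAlgCl p) G (Fin e → PadicAlgCl p)),
      Affords p φ σ →
        LinearMap.det (∑ ν : G, x ν • σ ν⁻¹) = LinearMap.det (ρ.asAlgebraHom (inverseSum x)) := by
    intro e σ hσ
    obtain ⟨f⟩ := nonempty_equiv_of_character_eq h.1 hσ.1 (h.2.trans hσ.2.symm)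
    rw [← LinearMap.det_conj _ f.toLinearEquiv, inverseSum, map_sum]
    congr 1
    refine LinearMap.ext fun v => ?_
    simp only [Representation.asAlgebraHom_single, LinearMap.comp_apply, LinearMap.sum_apply,
      LinearMap.smul_apply, map_sum, map_smul, LinearEquiv.coe_coe]
    refine Finset.sum_congr rfl fun ν _ => ?_
    congr 1
    have := LinearMap.congr_fun (f.isIntertwining' ν⁻¹) (f.toLinearEquiv.symm v)
    refine this.trans ?_
    exact congrArg (ρ ν⁻¹) (f.toLinearEquiv.apply_symm_apply v)
  have h' : IsIrreducibleCharacter p φ := h.isIrreducibleCharacter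
  rw [groupDeterminantFactor, dif_pos h']
  exact key _ _ h'.choose_spec.choose_spec

theorem coeff_idempotentPhi (φ : G → PadicAlgCl p) (g : G) :
    (idempotentPhi p φ).coeff g = φ 1 / (Fintype.card G : PadicAlgCl p) * φ g⁻¹ := by
  classical
  rw [idempotentPhi, MonoidAlgebra.coeff_sum, Finsupp.finsetSum_apply, Finset.sum_eq_single g]
  · simp
  · intro b _ hb
    rw [MonoidAlgebra.coeff_single, Finsupp.single_apply, if_neg hb]
  · simp

omit [Fintype G] in
theorem IsIrreducibleCharacter.conj {φ : G → PadicAlgCl p} (hφ : IsIrreducibleCharacter p φ)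
    (g h : G) : φ (h * g) = φ (g * h) := by
  obtain ⟨d, ρ, hρ, rfl⟩ := hφ
  exact Representation.char_mul_comm ρ g h

/-- The coefficients form a class function. -/
theorem idempotentPhi_commute {φ : G → PadicAlgCl p} (hφ : IsIrreducibleCharacter p φ)
    (a : MonoidAlgebra (PadicAlgCl p) G) : Commute (idempotentPhi p φ) a := by
  induction a using MonoidAlgebra.induction_linear with
  | zero => exact Commute.zero_right _
  | add f g hf hg => exact hf.add_right hg
  | single g c =>
    refine MonoidAlgebra.coeff_injective (Finsupp.ext fun h => ?_)
    rw [MonoidAlgebra.coeff_mul_single_apply, MonoidAlgebra.coeff_single_mul_apply,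
      coeff_idempotentPhi, coeff_idempotentPhi, mul_inv_rev, mul_inv_rev, inv_inv, hφ.conj, mul_comm]

-- By Schur the central element acts as a scalar; the first orthogonality relation gives its trace,
-- and the degree can be cancelled in characteristic `0`.
open scoped Classical in
theorem asAlgebraHom_idempotentPhi {d : ℕ} {φ χ : G → PadicAlgCl p}
    {ρ : Representation (PadicAlgCl p) G (Fin d → PadicAlgCl p)} (h : Affords p χ ρ)
    (hφ : IsIrreducibleCharacter p φ) :
    ρ.asAlgebraHom (idempotentPhi p φ) = if φ = χ then 1 else 0 := by
  obtain ⟨c, hc⟩ := exists_eq_smul_one_of_commute h.1 (ρ.asAlgebraHom (idempotentPhi p φ))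
    (fun g => by
      have := (idempotentPhi_commute hφ (MonoidAlgebra.single g 1)).map ρ.asAlgebraHom
      rwa [Representation.asAlgebraHom_single_one] at this)
  have hd : (d : PadicAlgCl p) ≠ 0 := by exact_mod_cast h.degree_pos.ne'
  have hG : (Fintype.card G : PadicAlgCl p) ≠ 0 := by exact_mod_cast Fintype.card_ne_zero
  have ht := congrArg (LinearMap.trace (PadicAlgCl p) _) hc
  rw [map_smul, LinearMap.trace_one, smul_eq_mul, idempotentPhi, map_sum, map_sum] at ht
  simp only [Representation.asAlgebraHom_single, map_smul, smul_eq_mul] at ht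
  have h1 : ∑ g : G, φ 1 / (Fintype.card G : PadicAlgCl p) * φ g⁻¹ *
      LinearMap.trace (PadicAlgCl p) _ (ρ g) =
      φ 1 / (Fintype.card G : PadicAlgCl p) * ∑ g : G, χ g * φ g⁻¹ := by
    rw [Finset.mul_sum]
    refine Finset.sum_congr rfl fun g _ => ?_
    rw [← h.2, Representation.character]
    ring
  rw [h1, sum_mul_inv_irreducibleCharacter h.isIrreducibleCharacter hφ] at ht
  by_cases hφχ : φ = χ
  · subst hφχ
    rw [if_pos rfl, div_mul_cancel₀ _ hG, h.apply_one] at ht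
    simp only [Module.finrank_fintype_fun_eq_card, Fintype.card_fin] at ht
    have : c = 1 := mul_right_cancel₀ hd (by rw [← ht, one_mul])
    rw [if_pos rfl, hc, this, one_smul]
  · rw [if_neg (Ne.symm hφχ), mul_zero] at ht
    simp only [Module.finrank_fintype_fun_eq_card, Fintype.card_fin] at ht
    have : c = 0 := (mul_eq_zero.mp ht.symm).resolve_right hd
    rw [if_neg hφχ, hc, this, zero_smul]

theorem mem_irreducibleCharacters {φ : G → PadicAlgCl p} :
    φ ∈ irreducibleCharacters p G ↔ IsIrreducibleCharacter p φ := by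
  simp [irreducibleCharacters]

theorem mem_constituents {θ φ : G → PadicAlgCl p} :
    φ ∈ constituents p θ ↔ IsIrreducibleCharacter p φ ∧ padicCharacter p φ = θ := by
  simp [constituents, mem_irreducibleCharacters]

open scoped Classical in
theorem asAlgebraHom_idempotentTheta {d : ℕ} {θ χ : G → PadicAlgCl p}
    {ρ : Representation (PadicAlgCl p) G (Fin d → PadicAlgCl p)} (h : Affords p χ ρ) :
    ρ.asAlgebraHom (idempotentTheta p θ) = if χ ∈ constituents p θ then 1 else 0 := by
  rw [idempotentTheta, map_sum, Finset.sum_congr rfl (fun φ hφ =>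
    asAlgebraHom_idempotentPhi h (mem_constituents.mp hφ).1), Finset.sum_ite_eq']

theorem idempotentTheta_commute (θ : G → PadicAlgCl p) (a : MonoidAlgebra (PadicAlgCl p) G) :
    Commute (idempotentTheta p θ) a :=
  Commute.sum_left _ _ _ fun _ hφ => idempotentPhi_commute (mem_constituents.mp hφ).1 a

/-- It suffices to compare both sides in every irreducible representation, where `e_θ` is `0` or
`1`. -/
theorem isIdempotentElem_idempotentTheta (θ : G → PadicAlgCl p) :
    IsIdempotentElem (idempotentTheta p θ) := by
  have := neZero_card (p := p) (G := G)
  rw [IsIdempotentElem, ← sub_eq_zero]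
  refine eq_zero_of_forall_irreducible _ fun d ρ hρ => ?_
  rw [map_sub, map_mul, asAlgebraHom_idempotentTheta ⟨hρ, rfl⟩]
  split_ifs <;> simp

end Characters

/-! ### Galois conjugates of representations and characters -/

section Conjugates

variable {p : ℕ} [hp : Fact p.Prime] {G : Type*} [Group G]

/-- The conjugate of a matrix representation by an automorphism of the coefficients. -/
def galoisTwist (s : Gal(PadicAlgCl p/ℚ_[p])) {d : ℕ}
    (ρ : Representation (PadicAlgCl p) G (Fin d → PadicAlgCl p)) :
    Representation (PadicAlgCl p) G (Fin d → PadicAlgCl p) :=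
  { toFun := fun g => Matrix.toLin' ((LinearMap.toMatrix' (ρ g)).map s)
    map_one' := by
      rw [map_one, LinearMap.toMatrix'_one, Matrix.map_one _ (map_zero s) (map_one s),
        Matrix.toLin'_one]
      rfl
    map_mul' := fun g h => by
      rw [map_mul, LinearMap.toMatrix'_mul, Matrix.map_mul, Matrix.toLin'_mul]
      rfl }

theorem galoisTwist_apply (s : Gal(PadicAlgCl p/ℚ_[p])) {d : ℕ}
    (ρ : Representation (PadicAlgCl p) G (Fin d → PadicAlgCl p)) (g : G) :
    galoisTwist s ρ g = Matrix.toLin' ((LinearMap.toMatrix' (ρ g)).map s) := rfl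

/-- Applying `s` to coordinates is a semilinear bijection intertwining `ρ` with its twist; it
carries invariant subspaces back and forth in the proof of irreducibility. -/
theorem galoisTwist_apply_comp (s : Gal(PadicAlgCl p/ℚ_[p])) {d : ℕ}
    (ρ : Representation (PadicAlgCl p) G (Fin d → PadicAlgCl p)) (g : G)
    (v : Fin d → PadicAlgCl p) : galoisTwist s ρ g (s ∘ v) = s ∘ (ρ g v) := by
  rw [galoisTwist_apply, Matrix.toLin'_apply]
  conv_rhs => rw [← Matrix.toLin'_toMatrix' (ρ g), Matrix.toLin'_apply]
  ext i
  exact (RingHom.map_mulVec ((s : PadicAlgCl p ≃+* PadicAlgCl p) : PadicAlgCl p →+* PadicAlgCl p)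
    _ v i).symm

theorem character_galoisTwist (s : Gal(PadicAlgCl p/ℚ_[p])) {d : ℕ}
    (ρ : Representation (PadicAlgCl p) G (Fin d → PadicAlgCl p)) :
    (galoisTwist s ρ).character = fun g => s (ρ.character g) := by
  ext g
  rw [Representation.character, galoisTwist_apply, Matrix.trace_toLin'_eq, Representation.character]
  conv_rhs => rw [← Matrix.toLin'_toMatrix' (ρ g), Matrix.trace_toLin'_eq]
  simp [Matrix.trace]

theorem isIrreducible_galoisTwist (s : Gal(PadicAlgCl p/ℚ_[p])) {d : ℕ}
    {ρ : Representation (PadicAlgCl p) G (Fin d → PadicAlgCl p)} (hρ : ρ.IsIrreducible) :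
    (galoisTwist s ρ).IsIrreducible := by
  have := nontrivial_of_isIrreducible hρ
  refine isIrreducible_of_forall _ fun W hW => ?_
  let N : Submodule (PadicAlgCl p) (Fin d → PadicAlgCl p) :=
    { carrier := {v | s ∘ v ∈ W}
      add_mem' := fun {a b} ha hb => by
        have : s ∘ (a + b) = s ∘ a + s ∘ b := by ext; simp
        change s ∘ (a + b) ∈ W
        rw [this]
        exact W.add_mem ha hb
      zero_mem' := by
        have : s ∘ (0 : Fin d → PadicAlgCl p) = 0 := by ext; simp
        change s ∘ (0 : Fin d → PadicAlgCl p) ∈ W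
        rw [this]
        exact W.zero_mem
      smul_mem' := fun c a ha => by
        have : s ∘ (c • a) = s c • (s ∘ a) := by ext; simp
        change s ∘ (c • a) ∈ W
        rw [this]
        exact W.smul_mem _ ha }
  have hN : ∀ v, v ∈ W ↔ s.symm ∘ v ∈ N := fun v => by
    have : s ∘ (s.symm ∘ v) = v := by ext; simp
    change _ ↔ s ∘ (s.symm ∘ v) ∈ W
    rw [this]
  rcases eq_bot_or_eq_top_of_isIrreducible hρ N (fun g v hv => by
    change s ∘ (ρ g v) ∈ W
    rw [← galoisTwist_apply_comp]
    exact hW g _ hv) with h | h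
  · left
    rw [eq_bot_iff]
    intro v hv
    rw [hN, h, Submodule.mem_bot] at hv
    rw [Submodule.mem_bot]
    ext i
    simpa using congrFun hv i
  · right
    rw [eq_top_iff]
    intro v _
    rw [hN, h]
    trivial

theorem Affords.galoisTwist {d : ℕ} {φ : G → PadicAlgCl p}
    {ρ : Representation (PadicAlgCl p) G (Fin d → PadicAlgCl p)} (h : Affords p φ ρ)
    (s : Gal(PadicAlgCl p/ℚ_[p])) :
    Affords p (fun g => s (φ g)) (galoisTwist s ρ) :=
  ⟨isIrreducible_galoisTwist s h.1, by rw [character_galoisTwist, h.2]⟩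

theorem IsIrreducibleCharacter.galois {φ : G → PadicAlgCl p} (h : IsIrreducibleCharacter p φ)
    (s : Gal(PadicAlgCl p/ℚ_[p])) : IsIrreducibleCharacter p fun g => s (φ g) := by
  obtain ⟨d, ρ, h⟩ := h
  exact ⟨d, _, h.galoisTwist s⟩

variable [Fintype G]

theorem asAlgebraHom_galoisTwist_inverseSum (s : Gal(PadicAlgCl p/ℚ_[p])) {d : ℕ}
    (ρ : Representation (PadicAlgCl p) G (Fin d → PadicAlgCl p)) (x : G → PadicAlgCl p) :
    (galoisTwist s ρ).asAlgebraHom (inverseSum fun g => s (x g)) =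
      Matrix.toLin' ((LinearMap.toMatrix' (ρ.asAlgebraHom (inverseSum x))).map s) := by
  have h : ∀ (M : G → Matrix (Fin d) (Fin d) (PadicAlgCl p)),
      (∑ g, M g).map s = ∑ g, (M g).map s := fun M =>
    map_sum (((s : PadicAlgCl p ≃+* PadicAlgCl p) : PadicAlgCl p →+* PadicAlgCl p).mapMatrix) M _
  simp only [inverseSum, map_sum, Representation.asAlgebraHom_single, galoisTwist_apply, h]
  refine Finset.sum_congr rfl fun g _ => ?_
  rw [← map_smul, map_smul]
  ext i j
  simp

theorem galois_groupDeterminantFactor (s : Gal(PadicAlgCl p/ℚ_[p])) {φ : G → PadicAlgCl p}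
    (hφ : IsIrreducibleCharacter p φ) (x : G → PadicAlgCl p) :
    groupDeterminantFactor p (fun g => s (φ g)) (fun g => s (x g)) =
      s (groupDeterminantFactor p φ x) := by
  obtain ⟨d, ρ, h⟩ := hφ
  rw [groupDeterminantFactor_eq (h.galoisTwist s), groupDeterminantFactor_eq h,
    asAlgebraHom_galoisTwist_inverseSum, LinearMap.det_toLin', ← LinearMap.det_toMatrix']
  exact (RingHom.map_det ((s : PadicAlgCl p ≃+* PadicAlgCl p) : PadicAlgCl p →+* PadicAlgCl p)
    _).symm

omit [Group G] [Fintype G] in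
theorem conjugateCharacters_galois (s : Gal(PadicAlgCl p/ℚ_[p])) (φ : G → PadicAlgCl p) :
    conjugateCharacters p (fun g => s (φ g)) = conjugateCharacters p φ := by
  ext ψ
  constructor
  · rintro ⟨t, rfl⟩
    exact ⟨t * s, rfl⟩
  · rintro ⟨t, rfl⟩
    exact ⟨t * s⁻¹, by ext g; simp [AlgEquiv.mul_apply]⟩

theorem padicCharacter_galois (s : Gal(PadicAlgCl p/ℚ_[p])) (φ : G → PadicAlgCl p) :
    padicCharacter p (fun g => s (φ g)) = padicCharacter p φ := by
  rw [padicCharacter, padicCharacter]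
  congr 1
  ext ψ
  simp [conjugateCharacters_galois]

theorem galois_mem_constituents (s : Gal(PadicAlgCl p/ℚ_[p])) {θ φ : G → PadicAlgCl p}
    (h : φ ∈ constituents p θ) : (fun g => s (φ g)) ∈ constituents p θ := by
  rw [mem_constituents] at h ⊢
  exact ⟨h.1.galois s, (padicCharacter_galois s φ).trans h.2⟩

-- Pairing with a `p`-adic character detects its constituents. This is what makes two characters
-- with the same `p`-adic character conjugate.
open scoped Classical in
theorem sum_padicCharacter_mul_inv {φ ψ : G → PadicAlgCl p} (hφ : IsIrreducibleCharacter p φ)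
    (hψ : IsIrreducibleCharacter p ψ) :
    ∑ g, padicCharacter p φ g * ψ g⁻¹ =
      if ψ ∈ conjugateCharacters p φ then (Fintype.card G : PadicAlgCl p) else 0 := by
  simp only [padicCharacter, Finset.sum_apply, Finset.sum_mul]
  rw [Finset.sum_comm, Finset.sum_congr rfl (g := fun χ =>
    if χ = ψ then (Fintype.card G : PadicAlgCl p) else 0), Finset.sum_ite_eq']
  · simp
  · intro χ hχ
    rw [Set.Finite.mem_toFinset] at hχ
    obtain ⟨s, rfl⟩ := hχ
    exact sum_mul_inv_irreducibleCharacter (hφ.galois s) hψ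

omit [Group G] [Fintype G] in
theorem mem_conjugateCharacters_self (φ : G → PadicAlgCl p) : φ ∈ conjugateCharacters p φ :=
  ⟨1, rfl⟩

/-- The constituents of `θ` form a single orbit under the Galois group. -/
theorem coe_constituents_eq {θ φ : G → PadicAlgCl p} (h : φ ∈ constituents p θ) :
    (constituents p θ : Set (G → PadicAlgCl p)) = conjugateCharacters p φ := by
  classical
  ext ψ
  rw [Finset.mem_coe]
  constructor
  · intro hψ
    by_contra hn
    rw [mem_constituents] at h hψ
    -- If `ψ` were not conjugate to `φ`, the pairing of `θ` with `ψ` would be `0` when computed from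
    -- `φ` and `|G|` when computed from `ψ`.
    have h1 := sum_padicCharacter_mul_inv h.1 hψ.1
    rw [if_neg hn, h.2, ← hψ.2, sum_padicCharacter_mul_inv hψ.1 hψ.1,
      if_pos (mem_conjugateCharacters_self ψ)] at h1
    exact Fintype.card_ne_zero (α := G) (by exact_mod_cast h1)
  · rintro ⟨s, rfl⟩
    exact galois_mem_constituents s h

omit [Fintype G] in
/-- Sums over the constituents of `θ` are invariant under the Galois group. -/
theorem sum_galois_constituents [Fintype G] (s : Gal(PadicAlgCl p/ℚ_[p])) (θ : G → PadicAlgCl p)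
    {M : Type*} [AddCommMonoid M] (f : (G → PadicAlgCl p) → M) :
    ∑ φ ∈ constituents p θ, f (fun g => s (φ g)) = ∑ φ ∈ constituents p θ, f φ := by
  refine Finset.sum_bij (fun φ _ g => s (φ g)) (fun φ hφ => galois_mem_constituents s hφ) ?_ ?_
    (fun _ _ => rfl)
  · intro φ _ ψ _ h
    ext g
    exact s.injective (congrFun h g)
  · intro φ hφ
    exact ⟨_, galois_mem_constituents s⁻¹ hφ, by ext g; exact s.apply_symm_apply _⟩

end Conjugates

/-! ### Values of characters, and integrality of the idempotents -/

section Integrality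

variable {p : ℕ} [hp : Fact p.Prime] {G : Type*} [Group G]

theorem hasEigenvalue_of_mem_roots {F V : Type*} [Field F] [AddCommGroup V] [Module F V]
    [FiniteDimensional F V] {T : Module.End F V} {c : F} (hc : c ∈ T.charpoly.roots) :
    ∃ v ≠ 0, T v = c • v := by
  have := (Module.End.hasEigenvalue_iff_isRoot_charpoly T c).mpr (Polynomial.isRoot_of_mem_roots hc)
  obtain ⟨v, hv⟩ := this.exists_hasEigenvector
  exact ⟨v, hv.2, hv.apply_eq_smul⟩

theorem aeval_apply_of_apply_eq_smul {F V : Type*} [Field F] [AddCommGroup V] [Module F V]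
    {T : Module.End F V} {c : F} {v : V} (h : T v = c • v) (f : Polynomial F) :
    Polynomial.aeval T f v = f.eval c • v := by
  induction f using Polynomial.induction_on' with
  | add f g hf hg => simp [hf, hg, add_smul]
  | monomial n a =>
    have hn : ∀ n : ℕ, (T ^ n) v = c ^ n • v := by
      intro n
      induction n with
      | zero => simp
      | succ n ih => rw [pow_succ', Module.End.mul_apply, ih, map_smul, h, smul_smul, pow_succ]
    simp [Polynomial.aeval_monomial, hn, smul_smul, mul_comm]

theorem norm_multiset_prod_le_one (m : Multiset (PadicAlgCl p)) (h : ∀ c ∈ m, ‖c‖ ≤ 1) :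
    ‖m.prod‖ ≤ 1 ∧ (‖m.prod‖ = 1 ↔ ∀ c ∈ m, ‖c‖ = 1) := by
  induction m using Multiset.induction with
  | empty => simp
  | cons a m ih =>
    obtain ⟨h1, h2⟩ := ih fun c hc => h c (Multiset.mem_cons_of_mem hc)
    have ha := h a (Multiset.mem_cons_self a m)
    rw [Multiset.prod_cons, norm_mul]
    refine ⟨mul_le_one₀ ha (norm_nonneg _) h1, ?_⟩
    rw [Multiset.forall_mem_cons, ← h2]
    constructor
    · intro h3
      have h4 : ‖a‖ = 1 := by nlinarith [norm_nonneg a, norm_nonneg m.prod]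
      exact ⟨h4, by rwa [h4, one_mul] at h3⟩
    · rintro ⟨h3, h4⟩
      rw [h3, h4, one_mul]

section Values

variable [Fintype G]

/-- The eigenvalues of `ρ(g)` are roots of unity because `g ^ |G| = 1`. Both the integrality of
character values and their cyclotomic nature come from this. -/
theorem IsIrreducibleCharacter.exists_multiset {φ : G → PadicAlgCl p}
    (hφ : IsIrreducibleCharacter p φ) (g : G) :
    ∃ m : Multiset (PadicAlgCl p), φ g = m.sum ∧ ∀ c ∈ m, c ^ Fintype.card G = 1 := by
  obtain ⟨d, ρ, hρ, rfl⟩ := hφ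
  refine ⟨(ρ g).charpoly.roots, ?_, ?_⟩
  · rw [Representation.character,
      Module.End.trace_eq_sum_roots_charpoly_of_splits (IsAlgClosed.splits _)]
  · intro c hc
    obtain ⟨v, hv, h⟩ := hasEigenvalue_of_mem_roots hc
    have h1 := aeval_apply_of_apply_eq_smul h (Polynomial.X ^ Fintype.card G)
    rw [Polynomial.aeval_X_pow, ← map_pow, pow_card_eq_one, map_one, Module.End.one_apply,
      Polynomial.eval_pow, Polynomial.eval_X] at h1
    have h2 : (c ^ Fintype.card G - 1) • v = 0 := by rw [sub_smul, ← h1, one_smul, sub_self]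
    exact sub_eq_zero.mp ((smul_eq_zero.mp h2).resolve_right hv)

theorem IsIrreducibleCharacter.isIntegral {φ : G → PadicAlgCl p}
    (hφ : IsIrreducibleCharacter p φ) (g : G) : IsIntegral ℤ (φ g) := by
  obtain ⟨m, hm, h⟩ := hφ.exists_multiset g
  rw [hm]
  refine IsIntegral.multiset_sum fun c hc => ?_
  exact IsIntegral.of_pow Fintype.card_pos (by rw [h c hc]; exact isIntegral_one)

theorem IsIrreducibleCharacter.norm_le_one {φ : G → PadicAlgCl p}
    (hφ : IsIrreducibleCharacter p φ) (g : G) : ‖φ g‖ ≤ 1 :=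
  norm_le_one_of_isIntegral (hφ.isIntegral g)

theorem coeff_idempotentTheta (θ : G → PadicAlgCl p) (g : G) :
    (idempotentTheta p θ).coeff g =
      ∑ φ ∈ constituents p θ, φ 1 / (Fintype.card G : PadicAlgCl p) * φ g⁻¹ := by
  rw [idempotentTheta, MonoidAlgebra.coeff_sum, Finsupp.finsetSum_apply]
  exact Finset.sum_congr rfl fun φ _ => coeff_idempotentPhi φ g

/-- Integrality uses `p ∤ |G|` in the denominator; rationality over `ℚ_p` holds because the Galois
group permutes the constituents of `θ`. -/
theorem exists_padicInt_coeff_idempotentTheta (hG : ¬ p ∣ Fintype.card G) (θ : G → PadicAlgCl p)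
    (g : G) : ∃ z : ℤ_[p], algebraMap ℚ_[p] (PadicAlgCl p) z = (idempotentTheta p θ).coeff g := by
  refine exists_padicInt_of_fixed ?_ fun s => ?_
  · rw [coeff_idempotentTheta]
    refine (integers p).sum_mem fun φ hφ => ?_
    have h := (mem_constituents.mp hφ).1
    rw [mem_integers, norm_mul, norm_div, norm_natCast_eq_one hG, div_one]
    exact mul_le_one₀ (h.norm_le_one _) (norm_nonneg _) (h.norm_le_one _)
  · rw [coeff_idempotentTheta, map_sum]
    refine Eq.trans ?_ (sum_galois_constituents s θ
      (fun φ => φ 1 / (Fintype.card G : PadicAlgCl p) * φ g⁻¹))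
    refine Finset.sum_congr rfl fun φ _ => ?_
    simp

/-- The idempotent `e_θ`, seen in `ℤ_p[G]`. -/
def idempotentThetaInt (hG : ¬ p ∣ Fintype.card G) (θ : G → PadicAlgCl p) :
    MonoidAlgebra ℤ_[p] G :=
  MonoidAlgebra.ofCoeff (Finsupp.equivFunOnFinite.symm fun g =>
    (exists_padicInt_coeff_idempotentTheta hG θ g).choose)

variable (p) in
/-- The inclusion of `ℤ_p` in the algebraic closure of `ℚ_p`. -/
def padicIntToAlgCl : ℤ_[p] →+* PadicAlgCl p :=
  (algebraMap ℚ_[p] (PadicAlgCl p)).comp PadicInt.Coe.ringHom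

omit [Fintype G] in
theorem padicIntToAlgCl_injective : Function.Injective (padicIntToAlgCl p) :=
  (algebraMap ℚ_[p] (PadicAlgCl p)).injective.comp Subtype.val_injective

omit [Fintype G] in
theorem mapRingHom_injective {R S : Type*} [CommRing R] [CommRing S] {f : R →+* S}
    (hf : Function.Injective f) : Function.Injective (MonoidAlgebra.mapRingHom G f) := by
  intro a b h
  refine MonoidAlgebra.coeff_injective (Finsupp.ext fun g => hf ?_)
  rw [← MonoidAlgebra.coeff_mapRingHom, h, MonoidAlgebra.coeff_mapRingHom]

theorem map_idempotentThetaInt (hG : ¬ p ∣ Fintype.card G) (θ : G → PadicAlgCl p) :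
    MonoidAlgebra.mapRingHom G (padicIntToAlgCl p) (idempotentThetaInt hG θ) =
      idempotentTheta p θ := by
  refine MonoidAlgebra.coeff_injective (Finsupp.ext fun g => ?_)
  rw [MonoidAlgebra.coeff_mapRingHom]
  exact (exists_padicInt_coeff_idempotentTheta hG θ g).choose_spec

theorem isIdempotentElem_idempotentThetaInt (hG : ¬ p ∣ Fintype.card G) (θ : G → PadicAlgCl p) :
    IsIdempotentElem (idempotentThetaInt hG θ) := by
  apply mapRingHom_injective padicIntToAlgCl_injective
  rw [map_mul, map_idempotentThetaInt]
  exact isIdempotentElem_idempotentTheta θ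

theorem idempotentThetaInt_commute (hG : ¬ p ∣ Fintype.card G) (θ : G → PadicAlgCl p)
    (a : MonoidAlgebra ℤ_[p] G) : Commute (idempotentThetaInt hG θ) a := by
  apply mapRingHom_injective padicIntToAlgCl_injective
  rw [map_mul, map_mul, map_idempotentThetaInt]
  exact idempotentTheta_commute θ _

/-- At most one class is within distance less than `1`, so the chosen class is the expected one. -/
theorem reduceModP_padicInt (z : ℤ_[p]) :
    reduceModP p (algebraMap ℚ_[p] (PadicAlgCl p) z) = PadicInt.toZMod z := by
  have key : ∀ a : ZMod p, ‖algebraMap ℚ_[p] (PadicAlgCl p) z - (a.val : PadicAlgCl p)‖ < 1 ↔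
      a = PadicInt.toZMod z := by
    intro a
    have : algebraMap ℚ_[p] (PadicAlgCl p) z - (a.val : PadicAlgCl p) =
        algebraMap ℚ_[p] (PadicAlgCl p) ((z - (a.val : ℤ_[p]) : ℤ_[p]) : ℚ_[p]) := by
      push_cast
      simp
    rw [this, PadicAlgCl.norm_extends]
    have h2 : ‖((z - (a.val : ℤ_[p]) : ℤ_[p]) : ℚ_[p])‖ = ‖z - (a.val : ℤ_[p])‖ := rfl
    rw [h2, PadicInt.norm_lt_one_iff_dvd, ← Ideal.mem_span_singleton,
      ← PadicInt.maximalIdeal_eq_span_p, ← PadicInt.ker_toZMod, RingHom.mem_ker, map_sub,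
      map_natCast, ZMod.natCast_zmod_val, sub_eq_zero, eq_comm]
  have hex : ∃ a : ZMod p, ‖algebraMap ℚ_[p] (PadicAlgCl p) z - (a.val : PadicAlgCl p)‖ < 1 :=
    ⟨PadicInt.toZMod z, (key _).mpr rfl⟩
  rw [reduceModP, dif_pos hex]
  exact (key _).mp hex.choose_spec

theorem map_toZMod_idempotentThetaInt (hG : ¬ p ∣ Fintype.card G) (θ : G → PadicAlgCl p) :
    MonoidAlgebra.mapRingHom G PadicInt.toZMod (idempotentThetaInt hG θ) =
      idempotentThetaModP p θ := by
  classical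
  refine MonoidAlgebra.coeff_injective (Finsupp.ext fun g => ?_)
  rw [MonoidAlgebra.coeff_mapRingHom, idempotentThetaModP, MonoidAlgebra.coeff_sum,
    Finsupp.finsetSum_apply, Finset.sum_eq_single g]
  · rw [← map_idempotentThetaInt hG θ, MonoidAlgebra.coeff_mapRingHom]
    simp only [MonoidAlgebra.coeff_single, Finsupp.single_eq_same]
    exact (reduceModP_padicInt _).symm
  · intro b _ hb
    rw [MonoidAlgebra.coeff_single, Finsupp.single_apply, if_neg hb]
  · simp

end Values

/-! ### Units of the group algebra over the ring of integers -/

/-- Eigenvalues of integral elements of the group algebra are integral. -/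
theorem norm_le_one_of_mem_roots [Finite G] {d : ℕ}
    (ρ : Representation (PadicAlgCl p) G (Fin d → PadicAlgCl p))
    (z : MonoidAlgebra (integers p) G) {c : PadicAlgCl p}
    (hc : c ∈ (ρ.asAlgebraHom
      (MonoidAlgebra.mapRingHom G (integers p).subtype z)).charpoly.roots) : ‖c‖ ≤ 1 := by
  obtain ⟨v, hv, h⟩ := hasEigenvalue_of_mem_roots hc
  -- `O[G]` is a finite `O`-module, so `z` is a root of a monic polynomial over `O`, and hence so is
  -- every eigenvalue of its image.
  obtain ⟨f, hf, hfz⟩ := IsIntegral.of_finite (integers p) z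
  refine norm_le_one_of_root hf ?_
  have h1 := aeval_apply_of_apply_eq_smul h (f.map (integers p).subtype)
  have h2 : Polynomial.aeval (ρ.asAlgebraHom (MonoidAlgebra.mapRingHom G (integers p).subtype z))
      (f.map (integers p).subtype) = ρ.asAlgebraHom (MonoidAlgebra.mapRingHom G
        (integers p).subtype (Polynomial.eval₂ (algebraMap _ _) z f)) := by
    rw [Polynomial.aeval_algHom_apply, Polynomial.aeval_def, Polynomial.eval₂_map,
      Polynomial.hom_eval₂]
    congr 2
    ext r : 1
    refine MonoidAlgebra.coeff_injective (Finsupp.ext fun g => ?_)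
    simp [MonoidAlgebra.coe_algebraMap]
  rw [h2, hfz, map_zero, map_zero, LinearMap.zero_apply, Polynomial.eval_map] at h1
  exact (smul_eq_zero.mp h1.symm).resolve_right hv

/-- The determinant is the product of eigenvalues of norm at most `1`. -/
theorem norm_det_asAlgebraHom [Finite G] {d : ℕ}
    (ρ : Representation (PadicAlgCl p) G (Fin d → PadicAlgCl p))
    (z : MonoidAlgebra (integers p) G) :
    ‖LinearMap.det (ρ.asAlgebraHom (MonoidAlgebra.mapRingHom G (integers p).subtype z))‖ ≤ 1 ∧
    (‖LinearMap.det (ρ.asAlgebraHom (MonoidAlgebra.mapRingHom G (integers p).subtype z))‖ = 1 ↔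
      ∀ c ∈ (ρ.asAlgebraHom
        (MonoidAlgebra.mapRingHom G (integers p).subtype z)).charpoly.roots, ‖c‖ = 1) := by
  rw [Module.End.det_eq_prod_roots_charpoly_of_splits (IsAlgClosed.splits _)]
  exact norm_multiset_prod_le_one _ fun c hc => norm_le_one_of_mem_roots ρ z hc

variable [Fintype G]

variable [DecidableEq G]

/-- An inverse in `O[G]` has integral determinants too, which forces norm `1` in every
representation. Conversely, each eigenvalue of right multiplication is an eigenvalue in some
irreducible representation, so no decomposition of the regular representation is required. -/
theorem isUnit_det_rightMulMatrix_iff (y : MonoidAlgebra (integers p) G) :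
    IsUnit (rightMulMatrix y).det ↔
      ∀ (d : ℕ) (ρ : Representation (PadicAlgCl p) G (Fin d → PadicAlgCl p)), ρ.IsIrreducible →
        ‖LinearMap.det (ρ.asAlgebraHom
          (MonoidAlgebra.mapRingHom G (integers p).subtype y))‖ = 1 := by
  constructor
  · intro h d ρ _
    obtain ⟨z, hz⟩ := exists_mul_eq_one_of_isUnit_det h
    have h1 := congrArg (fun a => ‖LinearMap.det (ρ.asAlgebraHom
      (MonoidAlgebra.mapRingHom G (integers p).subtype a))‖) hz
    simp only [map_mul, map_one, norm_mul, norm_one] at h1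
    have h2 := (norm_det_asAlgebraHom ρ z).1
    have h3 := (norm_det_asAlgebraHom ρ y).1
    nlinarith [norm_nonneg (LinearMap.det (ρ.asAlgebraHom
      (MonoidAlgebra.mapRingHom G (integers p).subtype y)))]
  · intro h
    rw [isUnit_integers_iff]
    have h0 := det_rightMulMatrix_map (integers p).subtype y
    rw [Subring.subtype_apply] at h0
    rw [← h0, Matrix.det_eq_prod_roots_charpoly]
    have key : ∀ c ∈ (rightMulMatrix
        (MonoidAlgebra.mapRingHom G (integers p).subtype y)).charpoly.roots, ‖c‖ = 1 := by
      intro c hc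
      have hroot := Polynomial.isRoot_of_mem_roots hc
      rw [Polynomial.IsRoot, Matrix.eval_charpoly] at hroot
      set Y := MonoidAlgebra.mapRingHom G (integers p).subtype y
      have hdet : (rightMulMatrix (Y - algebraMap (PadicAlgCl p) _ c)).det = 0 := by
        rw [rightMulMatrix_sub_algebraMap, ← neg_sub, Matrix.det_neg, hroot, mul_zero]
      -- `Y - c` is not left invertible, so it lies in a maximal left ideal; the vector whose
      -- annihilator is that ideal is then an eigenvector for `c`.
      obtain ⟨I, hI, hle⟩ := Ideal.exists_le_maximal
        (Ideal.span {Y - algebraMap (PadicAlgCl p) _ c}) (by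
          intro htop
          rw [Ideal.eq_top_iff_one, Ideal.mem_span_singleton'] at htop
          obtain ⟨a, ha⟩ := htop
          have := isUnit_det_of_mul_eq_one ha
          rw [hdet] at this
          exact not_isUnit_zero this)
      obtain ⟨d, ρ, v, hρ, hv⟩ := exists_irreducible_of_isMaximal I hI
      have h1 := (hv _).mpr (hle (Ideal.mem_span_singleton_self _))
      have hv0 : v ≠ 0 := by
        rintro rfl
        exact hI.ne_top ((Ideal.eq_top_iff_one _).mpr ((hv 1).mp (map_zero _)))
      rw [map_sub, AlgHom.commutes, LinearMap.sub_apply, sub_eq_zero] at h1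
      refine ((norm_det_asAlgebraHom ρ y).2.mp (h d ρ hρ)) c ?_
      rw [Polynomial.mem_roots (LinearMap.charpoly_monic _).ne_zero,
        ← Module.End.hasEigenvalue_iff_isRoot_charpoly]
      exact Module.End.hasEigenvalue_of_hasEigenvector
        ⟨Module.End.mem_eigenspace_iff.mpr (h1.trans (by simp)), hv0⟩
    exact (norm_multiset_prod_le_one _ fun c hc => (key c hc).le).2.mpr key

end Integrality

/-! ### Primes above `p` in a number field -/

section Primes

variable {p : ℕ} [hp : Fact p.Prime] {L : Type*} [Field L]

theorem norm_embedding_le_one (ι : L →+* PadicAlgCl p) {a : L} (ha : a ∈ pIntegers p L) :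
    ‖ι a‖ ≤ 1 := by
  obtain ⟨d, hd, h⟩ := ha
  have h1 := norm_le_one_of_isIntegral (h.map ι.toIntAlgHom)
  simpa [norm_natCast_eq_one hd] using h1

/-- The embedding of the ring of integers induced by an embedding of fields. -/
def ringOfIntegersMap (ι : L →+* PadicAlgCl p) : 𝓞 L →+* integers p :=
  (ι.comp (algebraMap (𝓞 L) L)).codRestrict (integers p) fun x =>
    norm_le_one_of_isIntegral (x.2.map ι.toIntAlgHom)

theorem coe_ringOfIntegersMap (ι : L →+* PadicAlgCl p) (x : 𝓞 L) :
    (ringOfIntegersMap ι x : PadicAlgCl p) = ι x := rfl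

/-- The prime of the ring of integers defined by an embedding. -/
def primeOfEmbedding (ι : L →+* PadicAlgCl p) : Ideal (𝓞 L) :=
  RingHom.ker ((residue p).comp (ringOfIntegersMap ι))

theorem mem_primeOfEmbedding {ι : L →+* PadicAlgCl p} {x : 𝓞 L} :
    x ∈ primeOfEmbedding ι ↔ ‖ι x‖ < 1 := by
  rw [primeOfEmbedding, RingHom.mem_ker, RingHom.comp_apply, residue_eq_zero_iff,
    coe_ringOfIntegersMap]

instance (ι : L →+* PadicAlgCl p) : (primeOfEmbedding ι).IsPrime := RingHom.ker_isPrime _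

variable (p) in
theorem isPrime_span_p : (Ideal.span {(p : ℤ)}).IsPrime :=
  (Ideal.span_singleton_prime (by exact_mod_cast hp.out.ne_zero)).mpr
    (Nat.prime_iff_prime_int.mp hp.out)

variable (p) in
theorem isMaximal_span_p : (Ideal.span {(p : ℤ)}).IsMaximal :=
  (isPrime_span_p p).isMaximal (by simpa using hp.out.ne_zero)

theorem liesOver_of_natCast_mem (Q : Ideal (𝓞 L)) [Q.IsPrime] (h : (p : 𝓞 L) ∈ Q) :
    Q.LiesOver (Ideal.span {(p : ℤ)}) := by
  refine ⟨(isMaximal_span_p p).eq_of_le (Ideal.IsPrime.ne_top inferInstance) ?_⟩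
  rw [Ideal.span_singleton_le_iff_mem, Ideal.under_def, Ideal.mem_comap]
  simpa using h

instance (ι : L →+* PadicAlgCl p) : (primeOfEmbedding ι).LiesOver (Ideal.span {(p : ℤ)}) :=
  liesOver_of_natCast_mem _ (by
    rw [mem_primeOfEmbedding]
    simpa using norm_natCast_p_lt_one (p := p))

variable [NumberField L]

omit hp [NumberField L] in
theorem map_span_p : (Ideal.span {(p : ℤ)}).map (algebraMap ℤ (𝓞 L)) = Ideal.span {(p : 𝓞 L)} := by
  rw [Ideal.map_span]
  simp

theorem span_p_ne_bot : Ideal.span {(p : 𝓞 L)} ≠ ⊥ := by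
  simpa using hp.out.ne_zero

/-- Ramification indices are the multiplicities in the factorization of `(p)`. -/
theorem squarefree_span_p (h : IsUnramifiedIn p L) : Squarefree (Ideal.span {(p : 𝓞 L)}) := by
  classical
  rw [UniqueFactorizationMonoid.squarefree_iff_nodup_normalizedFactors span_p_ne_bot,
    Multiset.nodup_iff_count_le_one]
  intro Q
  by_cases hQ : Q ∈ UniqueFactorizationMonoid.normalizedFactors (Ideal.span {(p : 𝓞 L)})
  · have hprime : Q.IsPrime :=
      Ideal.isPrime_of_prime (UniqueFactorizationMonoid.prime_of_normalized_factor Q hQ)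
    have hmem : (p : 𝓞 L) ∈ Q := by
      rw [← Ideal.span_singleton_le_iff_mem, ← Ideal.dvd_iff_le]
      exact UniqueFactorizationMonoid.dvd_of_mem_normalizedFactors hQ
    have := liesOver_of_natCast_mem Q hmem
    rw [← map_span_p, ← Ideal.IsDedekindDomain.ramificationIdx_eq_normalizedFactors_count (Ideal.span {(p : ℤ)}) Q
      (by rw [map_span_p]; exact span_p_ne_bot), h Q hprime this]
  · rw [Multiset.count_eq_zero_of_notMem hQ]
    exact zero_le_one

theorem isRadical_span_p (h : IsUnramifiedIn p L) : (Ideal.span {(p : 𝓞 L)}).IsRadical := by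
  intro x hx
  obtain ⟨n, hn⟩ := hx
  rw [← Ideal.span_singleton_le_iff_mem, ← Ideal.dvd_iff_le]
  refine (squarefree_span_p h).isRadical n _ ?_
  rw [Ideal.span_singleton_pow, Ideal.dvd_iff_le, Ideal.span_singleton_le_iff_mem]
  exact hn

variable [IsGalois ℚ L]

/-- When `p` is unramified, an algebraic integer all of whose conjugates reduce to `0`
is divisible by `p`. -/
theorem natCast_dvd_of_forall (h : IsUnramifiedIn p L) (ι : L →+* PadicAlgCl p) {x : 𝓞 L}
    (hx : ∀ σ : Gal(L/ℚ), ‖ι (σ x)‖ < 1) : (p : 𝓞 L) ∣ x := by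
  -- Being radical, `(p)` is the intersection of the primes containing it, and the Galois group
  -- moves the prime of `ι` to each of them.
  rw [← Ideal.mem_span_singleton, ← (isRadical_span_p h).radical, Ideal.radical_eq_sInf,
    Submodule.mem_sInf]
  rintro Q ⟨hle, hQ⟩
  have := liesOver_of_natCast_mem Q (hle (Ideal.mem_span_singleton_self _))
  obtain ⟨σ, rfl⟩ := Ideal.exists_smul_eq_of_isGaloisGroup (Ideal.span {(p : ℤ)})
    (primeOfEmbedding ι) Q Gal(L/ℚ)
  rw [Ideal.mem_pointwise_smul_iff_inv_smul_mem, mem_primeOfEmbedding]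
  exact hx σ⁻¹

theorem exists_eq_mul_of_forall_norm_lt_one (h : IsUnramifiedIn p L) (ι : L →+* PadicAlgCl p)
    {a : L} (ha : a ∈ pIntegers p L) (hx : ∀ σ : Gal(L/ℚ), ‖ι (σ a)‖ < 1) :
    ∃ z ∈ pIntegers p L, a = p * z := by
  obtain ⟨d, hd, hint⟩ := ha
  have hd0 : (d : L) ≠ 0 := by
    intro h0
    have : d = 0 := by exact_mod_cast h0
    exact hd (this ▸ dvd_zero p)
  obtain ⟨x, hxa⟩ : ∃ x : 𝓞 L, algebraMap (𝓞 L) L x = d * a := ⟨⟨d * a, hint⟩, rfl⟩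
  have hxa' : (x : L) = d * a := hxa
  obtain ⟨y, hy⟩ := natCast_dvd_of_forall h ι (x := x) fun σ => by
    rw [hxa', map_mul, map_mul, map_natCast, map_natCast, norm_mul, norm_natCast_eq_one hd, one_mul]
    exact hx σ
  have hy' : (d : L) * a = p * y := by
    rw [← hxa, hy, map_mul, map_natCast]
  refine ⟨(d : L)⁻¹ * y, ⟨d, hd, ?_⟩, ?_⟩
  · rw [mul_inv_cancel_left₀ hd0]
    exact y.2
  · field_simp
    linear_combination hy'

omit [IsGalois ℚ L] in
/-- When `p` is unramified, it is a uniformizer for each embedding. -/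
theorem exists_mul_eq_of_norm_lt_one (h : IsUnramifiedIn p L) (ι : L →+* PadicAlgCl p)
    {a : L} (ha : a ∈ pIntegers p L) (hx : ‖ι a‖ < 1) :
    ∃ c z : L, ‖ι c‖ = 1 ∧ z ∈ pIntegers p L ∧ c * a = p * z := by
  obtain ⟨d, hd, hint⟩ := ha
  obtain ⟨x, hxa⟩ : ∃ x : 𝓞 L, algebraMap (𝓞 L) L x = d * a := ⟨⟨d * a, hint⟩, rfl⟩
  have hxa' : (x : L) = d * a := hxa
  have hmem : x ∈ primeOfEmbedding ι := by
    rw [mem_primeOfEmbedding, hxa', map_mul, norm_mul, map_natCast, norm_natCast_eq_one hd, one_mul]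
    exact hx
  have hle : Ideal.span {(p : 𝓞 L)} ≤ primeOfEmbedding ι := by
    rw [Ideal.span_singleton_le_iff_mem, mem_primeOfEmbedding]
    simpa using norm_natCast_p_lt_one (p := p)
  -- Write `(p) = P J` with `P` the prime of `ι`. Squarefreeness gives an element `c` of `J` outside
  -- `P`: it is a unit at `ι`, and its product with an element of `P` is divisible by `p`.
  obtain ⟨J, hJ⟩ := Ideal.dvd_iff_le.mpr hle
  have hJ' : ¬ J ≤ primeOfEmbedding ι := by
    intro hJle
    obtain ⟨J', hJ'⟩ := Ideal.dvd_iff_le.mpr hJle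
    have := squarefree_span_p h (primeOfEmbedding ι) ⟨J', by rw [hJ, hJ', mul_assoc]⟩
    rw [Ideal.isUnit_iff] at this
    exact Ideal.IsPrime.ne_top inferInstance this
  obtain ⟨c, hc, hc'⟩ := SetLike.not_le_iff_exists.mp hJ'
  have h1 := Ideal.mul_mem_mul hmem hc
  rw [← hJ, Ideal.mem_span_singleton] at h1
  obtain ⟨y, hy⟩ := h1
  have h2 : (d : L) * a * c = p * y := by
    rw [← hxa, ← map_mul, hy, map_mul, map_natCast]
  have h4 : ‖ι c‖ = 1 := by
    rw [mem_primeOfEmbedding, not_lt] at hc'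
    exact le_antisymm (norm_coe_le_one (ringOfIntegersMap ι c)) hc'
  refine ⟨d * c, y, ?_, ⟨1, (Fact.out : p.Prime).not_dvd_one, ?_⟩, ?_⟩
  · rw [map_mul, map_natCast, norm_mul, norm_natCast_eq_one hd, h4, one_mul]
  · rw [Nat.cast_one, one_mul]
    exact y.2
  · rw [← h2]
    ring

-- Up to a factor of norm `1`, an element of norm below `1` is `p` times another `p`-integer, so
-- induction on `k` reduces to the gap between `p⁻¹` and `1`.
omit [IsGalois ℚ L] in
theorem norm_le_pow_of_norm_lt_pow (h : IsUnramifiedIn p L) (ι : L →+* PadicAlgCl p) (k : ℕ)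
    {a : L} (ha : a ∈ pIntegers p L) (hx : ‖ι a‖ < (p : ℝ)⁻¹ ^ k) :
    ‖ι a‖ ≤ (p : ℝ)⁻¹ ^ (k + 1) := by
  have hp0 : (0 : ℝ) < (p : ℝ)⁻¹ := by
    have := hp.out.pos
    positivity
  have hp1 : (p : ℝ)⁻¹ ≤ 1 := inv_le_one_of_one_le₀ (by exact_mod_cast hp.out.one_le)
  induction k generalizing a with
  | zero =>
    obtain ⟨c, z, hc, hz, he⟩ := exists_mul_eq_of_norm_lt_one h ι ha (by simpa using hx)
    have h3 := congrArg (fun z => ‖ι z‖) he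
    simp only [map_mul, norm_mul, map_natCast, hc, one_mul, norm_natCast_p] at h3
    rw [h3, zero_add, pow_one]
    exact mul_le_of_le_one_right hp0.le (norm_embedding_le_one ι hz)
  | succ k ih =>
    obtain ⟨c, z, hc, hz, he⟩ := exists_mul_eq_of_norm_lt_one h ι ha
      (hx.trans_le (pow_le_one₀ hp0.le hp1))
    have h3 := congrArg (fun z => ‖ι z‖) he
    simp only [map_mul, norm_mul, map_natCast, hc, one_mul, norm_natCast_p] at h3
    rw [h3, pow_succ' _ k] at hx
    rw [h3, pow_succ' _ (k + 1)]
    exact mul_le_mul_of_nonneg_left (ih hz (lt_of_mul_lt_mul_left hx hp0.le)) hp0.le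

omit [IsGalois ℚ L] in
/-- When `p` is unramified, the absolute value defined by an embedding takes no value strictly
between `p⁻¹` and `1`. -/
theorem norm_le_of_norm_lt_one (h : IsUnramifiedIn p L) (ι : L →+* PadicAlgCl p)
    {a : L} (hx : ‖ι a‖ < 1) : ‖ι a‖ ≤ (p : ℝ)⁻¹ := by
  have hp0 : (0 : ℝ) < (p : ℝ)⁻¹ := by
    have := hp.out.pos
    positivity
  obtain ⟨m, hm0, hm⟩ : ∃ m : ℕ, m ≠ 0 ∧ IsIntegral ℤ ((m : L) * a) := by
    obtain ⟨y, hy0, hy⟩ := IsAlgebraic.exists_integral_multiple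
      ((IsFractionRing.isAlgebraic_iff ℤ ℚ L).mpr (Algebra.IsAlgebraic.isAlgebraic (R := ℚ) a))
    refine ⟨y.natAbs, Int.natAbs_ne_zero.mpr hy0, ?_⟩
    have h1 : IsIntegral ℤ ((y : L) * a) := by simpa [Algebra.smul_def] using hy
    rw [← Int.cast_natCast]
    rcases Int.natAbs_eq y with h2 | h2
    · rw [← h2]
      exact h1
    · rw [show ((y.natAbs : ℕ) : ℤ) = -y by lia]
      simpa using h1
  -- Norm below `1` at one embedding does not make `a` a `p`-integer. Only `p ^ k * a` is one, which
  -- is why the gap is needed at every power of `p`.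
  obtain ⟨k, m', hm', rfl⟩ := Nat.exists_eq_pow_mul_and_not_dvd hm0 p hp.out.ne_one
  have hb : (p : L) ^ k * a ∈ pIntegers p L := ⟨m', hm', by
    rw [← mul_assoc, mul_comm (m' : L)]
    exact_mod_cast hm⟩
  have hn : ‖ι ((p : L) ^ k * a)‖ = (p : ℝ)⁻¹ ^ k * ‖ι a‖ := by
    rw [map_mul, map_pow, map_natCast, norm_mul, norm_pow, norm_natCast_p]
  have h2 := norm_le_pow_of_norm_lt_pow h ι k hb (by
    rw [hn]
    exact mul_lt_of_lt_one_right (by positivity) hx)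
  rw [hn, pow_succ] at h2
  exact le_of_mul_le_mul_left h2 (by positivity)

/-- The cardinality of the residue field. -/
theorem card_quotient_primeOfEmbedding (ι : L →+* PadicAlgCl p) :
    Nat.card (𝓞 L ⧸ primeOfEmbedding ι) = p ^ residueDegree p L := by
  have := isMaximal_span_p p
  rw [residueDegree, Ideal.inertiaDegIn_eq_inertiaDeg (Ideal.span {(p : ℤ)}) (primeOfEmbedding ι)
    Gal(L/ℚ)]
  have h := Ideal.natAbs_pow_inertiaDeg (p : ℤ) (primeOfEmbedding ι)
  rw [Int.natAbs_natCast] at h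
  rw [h, Ideal.absNorm_apply, Submodule.cardQuot_apply]

theorem residue_pow_residueDegree (ι : L →+* PadicAlgCl p) (x : 𝓞 L) :
    residue p (ringOfIntegersMap ι x) ^ p ^ residueDegree p L =
      residue p (ringOfIntegersMap ι x) := by
  have hcard := card_quotient_primeOfEmbedding ι
  have hfin : Finite (𝓞 L ⧸ primeOfEmbedding ι) := Nat.finite_of_card_ne_zero (by
    rw [hcard]
    exact (pow_pos hp.out.pos _).ne')
  have := Fintype.ofFinite (𝓞 L ⧸ primeOfEmbedding ι)
  have hmax : (primeOfEmbedding ι).IsMaximal :=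
    Ideal.Quotient.maximal_of_isField _ (Finite.isField_of_domain _)
  let : Field (𝓞 L ⧸ primeOfEmbedding ι) := Ideal.Quotient.field _
  have h1 := FiniteField.pow_card (Ideal.Quotient.mk (primeOfEmbedding ι) x)
  rw [← Nat.card_eq_fintype_card, hcard, ← map_pow, Ideal.Quotient.eq] at h1
  have h2 : ((residue p).comp (ringOfIntegersMap ι)) (x ^ p ^ residueDegree p L - x) = 0 := h1
  rw [map_sub, map_pow, sub_eq_zero] at h2
  exact h2

/-- The residue field embeds in the roots of `X ^ p ^ N - X`, of which there are at most `p ^ N`.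
Positivity of `N` keeps this polynomial nonzero. -/
theorem residueDegree_le {N : ℕ} (hN : 0 < N) (ι : L →+* PadicAlgCl p)
    (h : ∀ x : 𝓞 L, residue p (ringOfIntegersMap ι x) ^ p ^ N = residue p (ringOfIntegersMap ι x)) :
    residueDegree p L ≤ N := by
  classical
  have hcard := card_quotient_primeOfEmbedding ι
  have hfin : Finite (𝓞 L ⧸ primeOfEmbedding ι) := Nat.finite_of_card_ne_zero (by
    rw [hcard]
    exact (pow_pos hp.out.pos _).ne')
  have hne : (Polynomial.X ^ p ^ N - Polynomial.X : Polynomial (residueField p)) ≠ 0 :=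
    FiniteField.X_pow_card_pow_sub_X_ne_zero _ hN.ne' hp.out.one_lt
  have hsub : Set.range ((residue p).comp (ringOfIntegersMap ι)) ⊆
      (Polynomial.X ^ p ^ N - Polynomial.X : Polynomial (residueField p)).roots.toFinset := by
    rintro _ ⟨x, rfl⟩
    rw [Finset.mem_coe, Multiset.mem_toFinset, Polynomial.mem_roots hne]
    simp [h x]
  have h1 : Nat.card (𝓞 L ⧸ primeOfEmbedding ι) =
      (Set.range ((residue p).comp (ringOfIntegersMap ι))).ncard := by
    rw [← Nat.card_coe_set_eq]
    exact Nat.card_congr (RingHom.quotientKerEquivRangeS _).toEquiv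
  have h2 := Set.ncard_le_ncard hsub (Finset.finite_toSet _)
  rw [Set.ncard_coe_finset, ← h1, hcard] at h2
  have h3 := (Multiset.toFinset_card_le _).trans (Polynomial.card_roots' 
    (Polynomial.X ^ p ^ N - Polynomial.X : Polynomial (residueField p)))
  rw [FiniteField.X_pow_card_pow_sub_X_natDegree_eq _ hN.ne' hp.out.one_lt] at h3
  exact (Nat.pow_le_pow_iff_right hp.out.one_lt).mp (h2.trans h3)

end Primes

/-! ### Reduction of `p`-integers, and Frobenius elements -/

section PIntegers

variable {p : ℕ} [hp : Fact p.Prime] {K : Type*} [Field K]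

/-- The embedding of the `p`-integers in the ring of integers of the algebraic closure of `ℚ_p`. -/
def pIntegersMap (ι : K →+* PadicAlgCl p) : pIntegers p K →+* integers p :=
  (ι.comp (pIntegers p K).subtype).codRestrict (integers p) fun x => norm_embedding_le_one ι x.2

theorem coe_pIntegersMap (ι : K →+* PadicAlgCl p) (x : pIntegers p K) :
    (pIntegersMap ι x : PadicAlgCl p) = ι x := rfl

/-- Reduction of the `p`-integers. -/
def reduction (ι : K →+* PadicAlgCl p) : pIntegers p K →+* residueField p :=
  (residue p).comp (pIntegersMap ι)

theorem reduction_eq_zero_iff {ι : K →+* PadicAlgCl p} {x : pIntegers p K} :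
    reduction ι x = 0 ↔ ‖ι x‖ < 1 := residue_eq_zero_iff

theorem natCast_residueField_ne_zero {d : ℕ} (hd : ¬ p ∣ d) : (d : residueField p) ≠ 0 := by
  rwa [Ne, CharP.cast_eq_zero_iff (residueField p) p]

theorem coe_natCast_pIntegers (d : ℕ) : ((d : pIntegers p K) : K) = d := by simp

theorem reduction_pow_residueDegree [NumberField K] [IsGalois ℚ K] (ι : K →+* PadicAlgCl p)
    (x : pIntegers p K) : reduction ι x ^ p ^ residueDegree p K = reduction ι x := by
  obtain ⟨d, hd, hint⟩ := x.2
  obtain ⟨y, hy⟩ : ∃ y : 𝓞 K, algebraMap (𝓞 K) K y = d * x := ⟨⟨d * x, hint⟩, rfl⟩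
  have h1 : residue p (ringOfIntegersMap ι y) = d * reduction ι x := by
    rw [← map_natCast (reduction ι) d, ← map_mul]
    refine congrArg (residue p) (Subtype.ext ?_)
    rw [coe_ringOfIntegersMap, coe_pIntegersMap, Subring.coe_mul, coe_natCast_pIntegers, ← hy]
  have h2 := residue_pow_residueDegree ι y
  rw [h1, mul_pow] at h2
  have h3 : (d : residueField p) ^ p ^ residueDegree p K = d := by
    rw [← iterateFrobenius_def, map_natCast]
  rw [h3] at h2
  exact mul_left_cancel₀ (natCast_residueField_ne_zero hd) h2

/-- The Fermat quotient is a `p`-integer. -/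
theorem fermatQuotient_mem [NumberField K] [IsGalois ℚ K] (h : IsUnramifiedIn p K)
    (ι : K →+* PadicAlgCl p) (η : Kˣ) (hη : IsPrimeTo p η) :
    fermatQuotient p η ∈ pIntegers p K := by
  have hp0 : (p : K) ≠ 0 := by exact_mod_cast hp.out.ne_zero
  have hq : 0 < p ^ residueDegree p K := pow_pos hp.out.pos _
  -- Each conjugate of `η` reduces to a nonzero element fixed by the `p ^ n_p`-th power, so its
  -- power of exponent `p ^ n_p - 1` reduces to `1`.
  obtain ⟨z, hz, hez⟩ := exists_eq_mul_of_forall_norm_lt_one h ι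
    (a := (η : K) ^ (p ^ residueDegree p K - 1) - 1)
    (sub_mem (pow_mem hη.1 _) (one_mem _)) (fun σ => by
      have h1 : σ (η : K) ∈ pIntegers p K := map_mem_pIntegers p σ hη.1
      have h2 : σ ((η⁻¹ : Kˣ) : K) ∈ pIntegers p K := map_mem_pIntegers p σ hη.2
      have h3 : (⟨_, h1⟩ : pIntegers p K) * ⟨_, h2⟩ = 1 := by
        ext
        simp
      have h4 : reduction ι ⟨_, h1⟩ ≠ 0 := by
        intro h0
        have := congrArg (reduction ι) h3
        rw [map_mul, h0, zero_mul, map_one] at this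
        exact zero_ne_one this
      have h5 : reduction ι (⟨_, h1⟩ ^ (p ^ residueDegree p K - 1) - 1) = 0 := by
        rw [map_sub, map_pow, map_one, sub_eq_zero]
        refine mul_right_cancel₀ h4 ?_
        rw [← pow_succ, Nat.sub_add_cancel hq, one_mul, reduction_pow_residueDegree]
      rw [reduction_eq_zero_iff] at h5
      simpa using h5)
  rw [fermatQuotient, hez, mul_div_cancel_left₀ _ hp0]
  exact hz

/-- Each automorphism of the algebraic closure of `ℚ_p` restricts to a Galois extension. -/
theorem exists_galois_restrict [CharZero K] [IsGalois ℚ K] (ι : K →+* PadicAlgCl p)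
    (s : Gal(PadicAlgCl p/ℚ_[p])) : ∃ σ : Gal(K/ℚ), ∀ a, ι (σ a) = s (ι a) := by
  let : Algebra K (PadicAlgCl p) := ι.toAlgebra
  have : IsScalarTower ℚ K (PadicAlgCl p) := IsScalarTower.of_algebraMap_eq fun q => by simp
  let t : PadicAlgCl p ≃ₐ[ℚ] PadicAlgCl p :=
    AlgEquiv.ofRingEquiv (f := (s : PadicAlgCl p ≃+* PadicAlgCl p)) fun q => by simp
  exact ⟨t.restrictNormal K, fun a => AlgEquiv.restrictNormal_commutes t K a⟩

theorem reduction_ratCast [CharZero K] (ι : K →+* PadicAlgCl p) {q : ℚ} (hq : q ∈ pIntegers p ℚ)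
    (hq' : (q : K) ∈ pIntegers p K) :
    reduction ι ⟨q, hq'⟩ = algebraMap (ZMod p) (residueField p) (q : ZMod p) := by
  have hden := den_ne_zero p hq
  have h1 : (q.den : pIntegers p K) * ⟨q, hq'⟩ = (q.num : pIntegers p K) := by
    ext
    push_cast
    have := Rat.den_mul_eq_num q
    exact_mod_cast this
  have h2 := congrArg (reduction ι) h1
  rw [map_mul, map_natCast, map_intCast] at h2
  have h3 : algebraMap (ZMod p) (residueField p) (q.den : ZMod p) ≠ 0 := by
    rwa [Ne, FaithfulSMul.algebraMap_eq_zero_iff]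
  rw [map_natCast] at h3
  rw [show ((q : ℚ) : ZMod p) = _ from Rat.cast_def q, map_div₀, map_natCast, map_intCast, eq_div_iff h3, mul_comm, h2]

theorem ratCast_mem_pIntegers [CharZero K] {q : ℚ} (hq : q ∈ pIntegers p ℚ) :
    (q : K) ∈ pIntegers p K := by
  obtain ⟨d, hd, h⟩ := hq
  refine ⟨d, hd, ?_⟩
  have := h.map (algebraMap ℚ K).toIntAlgHom
  simpa using this

end PIntegers

/-! ### Descent from the residue field to the prime field -/

section Descent

variable {p : ℕ} [hp : Fact p.Prime]

theorem exists_algebraMap_eq_of_pow_eq {F : Type*} [Field F] [CharP F p] [Algebra (ZMod p) F]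
    {x : F} (hx : x ^ p = x) : ∃ a : ZMod p, algebraMap (ZMod p) F a = x := by
  have := (Subfield.mem_bot_iff_pow_eq_self (F := F) (p := p)).mpr hx
  rw [← ZMod.fieldRange_castHom_eq_bot p] at this
  obtain ⟨a, ha⟩ := this
  exact ⟨a, (RingHom.congr_fun (Subsingleton.elim _ _) a).trans ha⟩

/-- A nonzero subspace stable under the Frobenius has a nonzero vector over the prime field. -/
theorem exists_primeField_vector {F G : Type*} [Field F] [CharP F p] [Algebra (ZMod p) F]
    [Fintype G] (V : Submodule F (G → F)) (hV : ∀ v ∈ V, (fun g => v g ^ p) ∈ V)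
    (hne : V ≠ ⊥) : ∃ w : G → ZMod p, w ≠ 0 ∧ (fun g => algebraMap (ZMod p) F (w g)) ∈ V := by
  classical
  -- Choose a nonzero vector with the smallest support.
  have hex : ∃ n : ℕ, ∃ v ∈ V, v ≠ 0 ∧ (Finset.univ.filter fun g => v g ≠ 0).card = n := by
    obtain ⟨v, hv, h0⟩ := (Submodule.ne_bot_iff V).mp hne
    exact ⟨_, v, hv, h0, rfl⟩
  obtain ⟨v, hv, h0, hcard⟩ := Nat.find_spec hex
  have hmin : ∀ u ∈ V, (Finset.univ.filter fun g => u g ≠ 0).card <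
      (Finset.univ.filter fun g => v g ≠ 0).card → u = 0 := by
    intro u hu hlt
    by_contra hu0
    rw [hcard] at hlt
    exact Nat.find_min hex hlt ⟨u, hu, hu0, rfl⟩
  obtain ⟨g₀, hg₀⟩ : ∃ g, v g ≠ 0 := Function.ne_iff.mp h0
  let u : G → F := (v g₀)⁻¹ • v
  have hu : u ∈ V := V.smul_mem _ hv
  have hu1 : u g₀ = 1 := inv_mul_cancel₀ hg₀
  -- With one coordinate normalized to `1`, subtracting the vector from its Frobenius image kills
  -- that coordinate. By minimality the difference vanishes, so all coordinates lie in the prime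
  -- field.
  have hsub : (fun g => u g ^ p) - u = 0 := by
    refine hmin _ (V.sub_mem (hV u hu) hu) (Finset.card_lt_card ?_)
    rw [Finset.ssubset_iff_of_subset]
    · refine ⟨g₀, by simpa using hg₀, ?_⟩
      simp [hu1]
    · intro g
      simp only [Finset.mem_filter, Finset.mem_univ, true_and]
      contrapose!
      intro hg
      simp [u, hg, hp.out.ne_zero]
  have hfix : ∀ g, ∃ a : ZMod p, algebraMap (ZMod p) F a = u g := fun g =>
    exists_algebraMap_eq_of_pow_eq (by
      have := congrFun hsub g
      simpa [sub_eq_zero] using this)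
  choose w hw using hfix
  refine ⟨w, ?_, ?_⟩
  · rintro rfl
    have := hw g₀
    rw [Pi.zero_apply, map_zero, hu1] at this
    exact zero_ne_one this
  · simpa only [hw] using hu

end Descent

/-! ### Relations as annihilators -/

section Relations

variable {p : ℕ} [hp : Fact p.Prime] {K : Type*} [Field K] [NumberField K]

/-- The element `∑ ν(α) ν⁻¹` of the group algebra over the ring of integers. -/
def resolvent (ι : K →+* PadicAlgCl p) (α : pIntegers p K) :
    MonoidAlgebra (integers p) Gal(K/ℚ) :=
  inverseSum fun ν => pIntegersMap ι ⟨ν α, map_mem_pIntegers p ν α.2⟩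

/-- The reduction of the resolvent. -/
def resolventModP (ι : K →+* PadicAlgCl p) (α : pIntegers p K) :
    MonoidAlgebra (residueField p) Gal(K/ℚ) :=
  MonoidAlgebra.mapRingHom _ (residue p) (resolvent ι α)

theorem coeff_resolventModP (ι : K →+* PadicAlgCl p) (α : pIntegers p K) (g : Gal(K/ℚ)) :
    (resolventModP ι α).coeff g =
      reduction ι ⟨g⁻¹ α, map_mem_pIntegers p g⁻¹ α.2⟩ := by
  rw [resolventModP, MonoidAlgebra.coeff_mapRingHom, resolvent, coeff_inverseSum]
  rfl

/-- Thus one product in the group algebra records the reductions of all conjugates of the sum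
defining a relation. -/
theorem coeff_mul_resolventModP (ι : K →+* PadicAlgCl p) (α : pIntegers p K)
    (u : Gal(K/ℚ) → ℚ) (hu : ∀ ν, u ν ∈ pIntegers p ℚ)
    (hmem : ∑ ν, (u ν : K) * ν⁻¹ (α : K) ∈ pIntegers p K) (g : Gal(K/ℚ)) :
    (MonoidAlgebra.mapRingHom _ (algebraMap (ZMod p) (residueField p))
      (inverseSum fun ν => (u ν : ZMod p)) * resolventModP ι α).coeff g =
    reduction ι ⟨g⁻¹ (∑ ν, (u ν : K) * ν⁻¹ (α : K)), map_mem_pIntegers p g⁻¹ hmem⟩ := by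
  rw [MonoidAlgebra.coeff_mul_apply_left, Finsupp.sum_fintype _ _ (by simp)]
  have h : (⟨g⁻¹ (∑ ν, (u ν : K) * ν⁻¹ (α : K)), map_mem_pIntegers p g⁻¹ hmem⟩ : pIntegers p K) =
      ∑ ν, ⟨u ν, ratCast_mem_pIntegers (hu ν)⟩ *
        ⟨(ν * g)⁻¹ (α : K), map_mem_pIntegers p _ α.2⟩ := by
    ext
    rw [AddSubmonoidClass.coe_finsetSum]
    simp [AlgEquiv.mul_apply]
  rw [h, map_sum]
  refine Fintype.sum_equiv (Equiv.inv _) _ _ fun ν => ?_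
  rw [map_mul (reduction ι), reduction_ratCast ι (hu _), MonoidAlgebra.coeff_mapRingHom, coeff_inverseSum,
    coeff_resolventModP]
  simp

/-- Unramifiedness enters here: vanishing of all conjugates modulo the prime of `ι` is divisibility
by `p`. -/
theorem mem_relations_iff [IsGalois ℚ K] (h : IsUnramifiedIn p K) (ι : K →+* PadicAlgCl p)
    (α : pIntegers p K) (U : MonoidAlgebra (ZMod p) Gal(K/ℚ)) :
    U ∈ relations p (α : K) ↔
      MonoidAlgebra.mapRingHom _ (algebraMap (ZMod p) (residueField p)) U *
        resolventModP ι α = 0 := by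
  have hsum : ∀ u : Gal(K/ℚ) → ℚ, (∀ ν, u ν ∈ pIntegers p ℚ) →
      ∑ ν, (u ν : K) * ν⁻¹ (α : K) ∈ pIntegers p K := fun u hu =>
    sum_mem fun ν _ => mul_mem (ratCast_mem_pIntegers (hu ν)) (map_mem_pIntegers p _ α.2)
  constructor
  · rintro ⟨u, ⟨hu, z, hz, hzu⟩, rfl⟩
    refine MonoidAlgebra.coeff_injective (Finsupp.ext fun g => ?_)
    refine (coeff_mul_resolventModP ι α u hu (hsum u hu) g).trans ?_
    refine reduction_eq_zero_iff.mpr ?_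
    rw [sub_zero] at hzu
    simp only [hzu, map_mul, map_natCast, norm_mul]
    exact mul_lt_one_of_nonneg_of_lt_one_left (norm_nonneg _) norm_natCast_p_lt_one
      (norm_embedding_le_one ι (map_mem_pIntegers p _ hz))
  · intro hU
    let u : Gal(K/ℚ) → ℚ := fun ν => ((U.coeff ν⁻¹).val : ℚ)
    have hu : ∀ ν, u ν ∈ pIntegers p ℚ := fun ν => natCast_mem _ _
    have hUu : U = inverseSum fun ν => (u ν : ZMod p) := by
      refine MonoidAlgebra.coeff_injective (Finsupp.ext fun g => ?_)
      rw [coeff_inverseSum]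
      simp only [u]
      rw [inv_inv, Rat.cast_natCast, ZMod.natCast_zmod_val]
    refine ⟨u, ⟨hu, ?_⟩, hUu⟩
    obtain ⟨z, hz, hze⟩ := exists_eq_mul_of_forall_norm_lt_one h ι (hsum u hu) fun σ => by
      have h1 := coeff_mul_resolventModP ι α u hu (hsum u hu) σ⁻¹
      rw [← hUu, hU] at h1
      have h2 := reduction_eq_zero_iff.mp h1.symm
      simpa using h2
    exact ⟨z, hz, by rw [sub_zero, hze]⟩

/-- The Frobenius acts on the resolvent by right translation. -/
theorem exists_map_frobenius_resolventModP [IsGalois ℚ K] (ι : K →+* PadicAlgCl p)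
    (α : pIntegers p K) : ∃ σ : Gal(K/ℚ),
      MonoidAlgebra.mapRingHom _ (frobenius (residueField p) p) (resolventModP ι α) =
        resolventModP ι α * MonoidAlgebra.single σ 1 := by
  obtain ⟨s, hs⟩ := exists_frobenius p
  obtain ⟨σ, hσ⟩ := exists_galois_restrict ι s
  refine ⟨σ, MonoidAlgebra.coeff_injective (Finsupp.ext fun g => ?_)⟩
  -- The coefficient of the product at `g` is that of the resolvent at `g σ⁻¹`, the reduction of `(g
  -- σ⁻¹)⁻¹ α = σ (g⁻¹ α)`, on which `σ` acts through the lifted Frobenius.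
  rw [MonoidAlgebra.coeff_mapRingHom, MonoidAlgebra.coeff_mul_single_apply, mul_one,
    coeff_resolventModP, coeff_resolventModP, frobenius_def]
  refine (hs _).symm.trans (congrArg (residue p) (Subtype.ext ?_))
  rw [coe_galois_smul, coe_pIntegersMap, coe_pIntegersMap]
  simp [AlgEquiv.mul_apply, hσ]

end Relations

/-! ### Vanishing of the regulator and existence of relations -/

section Criterion

variable {p : ℕ} [hp : Fact p.Prime] {G : Type*} [Group G] [Fintype G]

/-- The idempotent `e_θ` over the ring of integers of the algebraic closure of `ℚ_p`. -/
def idempotentThetaIntegers (hG : ¬ p ∣ Fintype.card G) (θ : G → PadicAlgCl p) :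
    MonoidAlgebra (integers p) G :=
  MonoidAlgebra.mapRingHom G (algebraMap ℤ_[p] (integers p)) (idempotentThetaInt hG θ)

omit [Fintype G] in
theorem mapRingHom_mapRingHom {R S T : Type*} [CommRing R] [CommRing S] [CommRing T]
    (f : R →+* S) (g : S →+* T) (a : MonoidAlgebra R G) :
    MonoidAlgebra.mapRingHom G g (MonoidAlgebra.mapRingHom G f a) =
      MonoidAlgebra.mapRingHom G (g.comp f) a := by
  refine MonoidAlgebra.coeff_injective (Finsupp.ext fun g => ?_)
  simp only [MonoidAlgebra.coeff_mapRingHom, RingHom.comp_apply]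

theorem map_subtype_idempotentThetaIntegers (hG : ¬ p ∣ Fintype.card G) (θ : G → PadicAlgCl p) :
    MonoidAlgebra.mapRingHom G (integers p).subtype (idempotentThetaIntegers hG θ) =
      idempotentTheta p θ := by
  rw [idempotentThetaIntegers, mapRingHom_mapRingHom, ← map_idempotentThetaInt hG θ]
  rfl

omit [Fintype G] in
theorem residue_algebraMap (z : ℤ_[p]) : residue p (algebraMap ℤ_[p] (integers p) z) =
    algebraMap (ZMod p) (residueField p) (PadicInt.toZMod z) := by
  obtain ⟨a, ha⟩ : ∃ n : ℕ, (n : ZMod p) = PadicInt.toZMod z :=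
    ⟨_, ZMod.natCast_zmod_val (PadicInt.toZMod z)⟩
  rw [← ha, map_natCast, ← map_natCast (residue p), residue_eq_iff, ← map_natCast (algebraMap ℤ_[p] (integers p)),
    coe_algebraMap_integers, coe_algebraMap_integers, ← map_sub, PadicAlgCl.norm_extends]
  have : z - a ∈ RingHom.ker (PadicInt.toZMod (p := p)) := by
    rw [RingHom.mem_ker, map_sub, map_natCast, ha, sub_self]
  rw [PadicInt.ker_toZMod, PadicInt.maximalIdeal_eq_span_p, Ideal.mem_span_singleton,
    ← PadicInt.norm_lt_one_iff_dvd] at this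
  exact this

theorem map_residue_idempotentThetaIntegers (hG : ¬ p ∣ Fintype.card G) (θ : G → PadicAlgCl p) :
    MonoidAlgebra.mapRingHom G (residue p) (idempotentThetaIntegers hG θ) =
      MonoidAlgebra.mapRingHom G (algebraMap (ZMod p) (residueField p))
        (idempotentThetaModP p θ) := by
  rw [idempotentThetaIntegers, mapRingHom_mapRingHom, ← map_toZMod_idempotentThetaInt hG θ,
    mapRingHom_mapRingHom]
  congr 2
  ext z
  exact residue_algebraMap z

theorem isIdempotentElem_idempotentThetaModP (hG : ¬ p ∣ Fintype.card G) (θ : G → PadicAlgCl p) :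
    IsIdempotentElem (idempotentThetaModP p θ) := by
  rw [← map_toZMod_idempotentThetaInt hG θ]
  exact (isIdempotentElem_idempotentThetaInt hG θ).map _

theorem mapRingHom_surjective {R S : Type*} [CommRing R] [CommRing S] {f : R →+* S}
    (hf : Function.Surjective f) : Function.Surjective (MonoidAlgebra.mapRingHom G f) := by
  intro a
  choose g hg using fun x => hf (a.coeff x)
  refine ⟨MonoidAlgebra.ofCoeff (Finsupp.equivFunOnFinite.symm g),
    MonoidAlgebra.coeff_injective (Finsupp.ext fun x => ?_)⟩
  rw [MonoidAlgebra.coeff_mapRingHom]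
  exact hg x

theorem idempotentThetaIntegers_commute (hG : ¬ p ∣ Fintype.card G) (θ : G → PadicAlgCl p)
    (a : MonoidAlgebra (integers p) G) : Commute (idempotentThetaIntegers hG θ) a := by
  apply mapRingHom_injective (f := (integers p).subtype) Subtype.val_injective
  rw [map_mul, map_mul, map_subtype_idempotentThetaIntegers]
  exact idempotentTheta_commute θ _

/-- Centrality is inherited from `O[G]`, which surjects onto the group algebra of the residue field.
-/
theorem idempotentThetaModP_commute_map (hG : ¬ p ∣ Fintype.card G) (θ : G → PadicAlgCl p)
    (a : MonoidAlgebra (residueField p) G) :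
    Commute (MonoidAlgebra.mapRingHom G (algebraMap (ZMod p) (residueField p))
      (idempotentThetaModP p θ)) a := by
  obtain ⟨a, rfl⟩ := mapRingHom_surjective (IsLocalRing.residue_surjective (R := integers p)) a
  rw [← map_residue_idempotentThetaIntegers hG]
  exact (idempotentThetaIntegers_commute hG θ a).map _

theorem idempotentThetaModP_commute (hG : ¬ p ∣ Fintype.card G) (θ : G → PadicAlgCl p)
    (a : MonoidAlgebra (ZMod p) G) : Commute (idempotentThetaModP p θ) a := by
  obtain ⟨a, rfl⟩ := mapRingHom_surjective (ZMod.ringHom_surjective (PadicInt.toZMod (p := p))) a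
  rw [← map_toZMod_idempotentThetaInt hG]
  exact (idempotentThetaInt_commute hG θ a).map _

/-- Adding `1 - e_θ` makes the element act as the identity in representations outside `θ`, so only
the factors of the regulator can fail to be units. -/
theorem prod_groupDeterminantFactor_norm_lt_one_iff [DecidableEq G] (hG : ¬ p ∣ Fintype.card G)
    (θ : G → PadicAlgCl p) (x : G → integers p) :
    ‖∏ φ ∈ constituents p θ, groupDeterminantFactor p φ fun g => (x g : PadicAlgCl p)‖ < 1 ↔
      ¬ IsUnit (rightMulMatrix (inverseSum x * idempotentThetaIntegers hG θ +
        (1 - idempotentThetaIntegers hG θ))).det := by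
  classical
  have hx : MonoidAlgebra.mapRingHom G (integers p).subtype (inverseSum x) =
      inverseSum fun g => (x g : PadicAlgCl p) := by
    refine MonoidAlgebra.coeff_injective (Finsupp.ext fun g => ?_)
    rw [MonoidAlgebra.coeff_mapRingHom, coeff_inverseSum, coeff_inverseSum]
    rfl
  have hle : ∀ φ ∈ constituents p θ,
      ‖groupDeterminantFactor p φ fun g => (x g : PadicAlgCl p)‖ ≤ 1 := by
    intro φ hφ
    obtain ⟨d, ρ, h⟩ := (mem_constituents.mp hφ).1
    rw [groupDeterminantFactor_eq h, ← hx]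
    exact (norm_det_asAlgebraHom ρ _).1
  have h1 := norm_multiset_prod_le_one (Multiset.map
    (fun φ => groupDeterminantFactor p φ fun g => (x g : PadicAlgCl p)) (constituents p θ).val)
    (by simpa using hle)
  rw [isUnit_det_rightMulMatrix_iff]
  have h2 : ‖∏ φ ∈ constituents p θ,
      groupDeterminantFactor p φ fun g => (x g : PadicAlgCl p)‖ < 1 ↔
      ¬ ∀ φ ∈ constituents p θ,
        ‖groupDeterminantFactor p φ fun g => (x g : PadicAlgCl p)‖ = 1 := by
    have h3 := h1.2
    simp only [Multiset.mem_map, Finset.mem_val, forall_exists_index, and_imp,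
      forall_apply_eq_imp_iff₂] at h3
    rw [← h3]
    exact ⟨fun h => h.ne, fun h => lt_of_le_of_ne h1.1 h⟩
  rw [h2, not_iff_not]
  constructor
  · intro h d ρ hρ
    rw [map_add, map_mul, map_sub, map_one, map_subtype_idempotentThetaIntegers, map_add, map_mul,
      map_sub, map_one, asAlgebraHom_idempotentTheta ⟨hρ, rfl⟩, hx]
    split_ifs with hc
    · rw [mul_one, sub_self, add_zero, ← groupDeterminantFactor_eq ⟨hρ, rfl⟩]
      exact h _ hc
    · simp
  · intro h φ hφ
    obtain ⟨d, ρ, hρ⟩ := (mem_constituents.mp hφ).1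
    have := h d ρ hρ.1
    rw [map_add, map_mul, map_sub, map_one, map_subtype_idempotentThetaIntegers, map_add, map_mul,
      map_sub, map_one, asAlgebraHom_idempotentTheta hρ, hx, if_pos hφ, mul_one, sub_self,
      add_zero, ← groupDeterminantFactor_eq hρ] at this
    exact this

end Criterion

/-! ### Nonvanishing of the `θ`-component of the relations -/

section Main

variable {p : ℕ} [hp : Fact p.Prime] {K : Type*} [Field K] [NumberField K] [IsGalois ℚ K]

/-- The module `ℒ^θ` is nonzero if and only if the local regulator is not a unit. -/
theorem relationsTheta_ne_bot_iff (h : IsUnramifiedIn p K)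
    (hG : ¬ p ∣ Fintype.card Gal(K/ℚ)) (ι : K →+* PadicAlgCl p) (θ : Gal(K/ℚ) → PadicAlgCl p)
    (α : pIntegers p K) :
    relationsTheta p θ (α : K) ≠ ⊥ ↔ ‖localRegulator p ι θ α‖ < 1 := by
  classical
  refine Iff.trans ?_ (prod_groupDeterminantFactor_norm_lt_one_iff hG θ
    (fun ν => pIntegersMap ι ⟨ν α, map_mem_pIntegers p ν α.2⟩)).symm
  set E := MonoidAlgebra.mapRingHom Gal(K/ℚ) (algebraMap (ZMod p) (residueField p))
    (idempotentThetaModP p θ) with hE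
  have hEE : E * E = E := ((isIdempotentElem_idempotentThetaModP hG θ).map _).eq
  have hEc : ∀ a, E * a = a * E := fun a => (idempotentThetaModP_commute_map hG θ a).eq
  have hunit : ¬ IsUnit (rightMulMatrix (resolvent ι α * idempotentThetaIntegers hG θ +
        (1 - idempotentThetaIntegers hG θ))).det ↔
      ∃ u ≠ 0, u * (resolventModP ι α * E + (1 - E)) = 0 := by
    rw [exists_mul_eq_zero_iff]
    have : resolventModP ι α * E + (1 - E) = MonoidAlgebra.mapRingHom _ (residue p)
        (resolvent ι α * idempotentThetaIntegers hG θ + (1 - idempotentThetaIntegers hG θ)) := by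
      rw [map_add, map_mul, map_sub, map_one, map_residue_idempotentThetaIntegers]
      rfl
    rw [this, det_rightMulMatrix_map, IsLocalRing.residue_eq_zero_iff,
      IsLocalRing.mem_maximalIdeal, mem_nonunits_iff]
  refine Iff.trans ?_ hunit.symm
  -- Multiplying on the right by `1 - E` and by `E` separates the equation into membership in the
  -- `θ`-component and annihilation of the resolvent.
  have hker : ∀ u, u * (resolventModP ι α * E + (1 - E)) = 0 ↔
      u * E = u ∧ u * resolventModP ι α = 0 := by
    intro u
    constructor
    · intro hu
      have h1 : u * E = u := by
        have h2 : u * (resolventModP ι α * E + (1 - E)) * (1 - E) = u * (1 - E) := by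
          have : (resolventModP ι α * E + (1 - E)) * (1 - E) = 1 - E := by
            rw [add_mul, mul_assoc, mul_sub, mul_one, hEE, sub_self, mul_zero, zero_add, mul_sub,
              mul_one, sub_mul, one_mul, hEE, sub_self, sub_zero]
          rw [mul_assoc, this]
        rw [hu, zero_mul, mul_sub, mul_one, eq_comm, sub_eq_zero] at h2
        exact h2.symm
      refine ⟨h1, ?_⟩
      rw [mul_add, ← mul_assoc, mul_sub, mul_one, h1, sub_self, add_zero, mul_assoc, ← hEc,
        ← mul_assoc, h1] at hu
      exact hu
    · rintro ⟨h1, h2⟩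
      rw [mul_add, ← mul_assoc, h2, zero_mul, zero_add, mul_sub, mul_one, h1, sub_self]
  simp only [hker]
  rw [Submodule.ne_bot_iff]
  constructor
  · rintro ⟨_, ⟨U, hU, rfl⟩, hne⟩
    rw [LinearMap.mulLeft_apply] at hne
    refine ⟨MonoidAlgebra.mapRingHom _ (algebraMap (ZMod p) (residueField p))
      (idempotentThetaModP p θ * U), ?_, ?_, ?_⟩
    · rw [Ne, ← map_zero (MonoidAlgebra.mapRingHom Gal(K/ℚ)
        (algebraMap (ZMod p) (residueField p)))]
      exact fun h0 => hne (mapRingHom_injective (algebraMap (ZMod p) (residueField p)).injective h0)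
    · rw [map_mul, ← hE, hEc, mul_assoc, hEE]
    · have hU' : U ∈ relations p (α : K) := hU
      exact (mem_relations_iff h ι α _).mp ((relations p (α : K)).smul_mem _ hU')
  · rintro ⟨u, hu0, huE, hux⟩
    let V : Submodule (residueField p) (Gal(K/ℚ) → residueField p) :=
      { carrier := {w | MonoidAlgebra.ofCoeff (Finsupp.equivFunOnFinite.symm w) * E =
            MonoidAlgebra.ofCoeff (Finsupp.equivFunOnFinite.symm w) ∧
            MonoidAlgebra.ofCoeff (Finsupp.equivFunOnFinite.symm w) * resolventModP ι α = 0}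
        add_mem' := fun {a b} ha hb => by
          have : MonoidAlgebra.ofCoeff (Finsupp.equivFunOnFinite.symm (a + b)) =
              MonoidAlgebra.ofCoeff (Finsupp.equivFunOnFinite.symm a) +
              MonoidAlgebra.ofCoeff (Finsupp.equivFunOnFinite.symm b) :=
            MonoidAlgebra.coeff_injective (Finsupp.ext fun g => rfl)
          change _ ∧ _
          rw [this, add_mul, add_mul, ha.1, hb.1, ha.2, hb.2, add_zero]
          exact ⟨rfl, rfl⟩
        zero_mem' := by
          have : MonoidAlgebra.ofCoeff (Finsupp.equivFunOnFinite.symm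
              (0 : Gal(K/ℚ) → residueField p)) = 0 :=
            MonoidAlgebra.coeff_injective (Finsupp.ext fun g => rfl)
          change _ ∧ _
          rw [this, zero_mul, zero_mul]
          exact ⟨rfl, rfl⟩
        smul_mem' := fun c a ha => by
          have : MonoidAlgebra.ofCoeff (Finsupp.equivFunOnFinite.symm (c • a)) =
              c • MonoidAlgebra.ofCoeff (Finsupp.equivFunOnFinite.symm a) :=
            MonoidAlgebra.coeff_injective (Finsupp.ext fun g => rfl)
          change _ ∧ _
          rw [this, smul_mul_assoc, smul_mul_assoc, ha.1, ha.2, smul_zero]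
          exact ⟨rfl, rfl⟩ }
    -- `E` has coefficients in `𝔽_p`, so Frobenius fixes it; the resolvent is only multiplied by the
    -- invertible element `σ`, so annihilation is preserved.
    have hV : ∀ v ∈ V, (fun g => v g ^ p) ∈ V := by
      rintro v ⟨hv1, hv2⟩
      have hF : MonoidAlgebra.ofCoeff (Finsupp.equivFunOnFinite.symm fun g => v g ^ p) =
          MonoidAlgebra.mapRingHom _ (frobenius (residueField p) p)
            (MonoidAlgebra.ofCoeff (Finsupp.equivFunOnFinite.symm v)) := by
        refine MonoidAlgebra.coeff_injective (Finsupp.ext fun g => ?_)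
        rw [MonoidAlgebra.coeff_mapRingHom]
        rfl
      have hFE : MonoidAlgebra.mapRingHom _ (frobenius (residueField p) p) E = E := by
        rw [hE, mapRingHom_mapRingHom]
        congr 2
        exact Subsingleton.elim _ _
      obtain ⟨σ, hσ⟩ := exists_map_frobenius_resolventModP ι α
      change _ ∧ _
      rw [hF]
      refine ⟨?_, ?_⟩
      · conv_rhs => rw [← hv1, map_mul, hFE]
      · have h3 := congrArg (MonoidAlgebra.mapRingHom _ (frobenius (residueField p) p)) hv2
        rw [map_mul, hσ, map_zero] at h3
        have h4 := congrArg (· * MonoidAlgebra.single σ⁻¹ 1) h3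
        simp only [mul_assoc, MonoidAlgebra.single_mul_single, mul_inv_cancel, one_mul,
          zero_mul] at h4
        rwa [← MonoidAlgebra.one_def, mul_one] at h4
    obtain ⟨w, hw0, hw⟩ := exists_primeField_vector V hV (by
      rw [Submodule.ne_bot_iff]
      refine ⟨u.coeff, ⟨?_, ?_⟩, ?_⟩
      · rw [Finsupp.equivFunOnFinite_symm_coe]
        exact huE
      · rw [Finsupp.equivFunOnFinite_symm_coe]
        exact hux
      · intro h0
        exact hu0 (MonoidAlgebra.coeff_injective (DFunLike.coe_injective h0)))
    let W : MonoidAlgebra (ZMod p) Gal(K/ℚ) :=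
      MonoidAlgebra.ofCoeff (Finsupp.equivFunOnFinite.symm w)
    have hWm : MonoidAlgebra.mapRingHom _ (algebraMap (ZMod p) (residueField p)) W =
        MonoidAlgebra.ofCoeff (Finsupp.equivFunOnFinite.symm
          fun g => algebraMap (ZMod p) (residueField p) (w g)) := by
      refine MonoidAlgebra.coeff_injective (Finsupp.ext fun g => ?_)
      rw [MonoidAlgebra.coeff_mapRingHom]
      rfl
    obtain ⟨hw1, hw2⟩ := hw
    rw [← hWm] at hw1 hw2
    refine ⟨W, ⟨W, (mem_relations_iff h ι α W).mpr hw2, ?_⟩, ?_⟩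
    · rw [LinearMap.mulLeft_apply]
      apply mapRingHom_injective (algebraMap (ZMod p) (residueField p)).injective
      rw [map_mul, ← hE, hEc, hw1]
    · intro h0
      apply hw0
      have := congrArg (fun a => (a.coeff : Gal(K/ℚ) → ZMod p)) h0
      simpa [W] using this

end Main

/-! ### Values of the regulator -/

section Values

variable {p : ℕ} [hp : Fact p.Prime] {K : Type*} [Field K]

/-- An element fixed by the automorphisms which fix `ι(K)` is approximated by elements
of `ι(K)`. -/
theorem mem_closure_of_fixed (ι : K →+* PadicAlgCl p) {x : PadicAlgCl p}
    (hx : ∀ s : Gal(PadicAlgCl p/ℚ_[p]), (∀ a, s (ι a) = ι a) → s x = x) :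
    x ∈ closure (Set.range ι) := by
  let F := IntermediateField.adjoin ℚ_[p] (Set.range ι)
  have h1 : x ∈ F := by
    rw [← InfiniteGalois.fixedField_fixingSubgroup F, IntermediateField.mem_fixedField_iff]
    intro s hs
    rw [IntermediateField.mem_fixingSubgroup_iff] at hs
    exact hx s fun a => hs _ (IntermediateField.subset_adjoin _ _ ⟨a, rfl⟩)
  -- The closure of `ι(K)` is a field containing `ℚ_p`, since `ℚ` is dense there; so it contains the
  -- field generated by `ι(K)` over `ℚ_p`.
  let T : IntermediateField ℚ_[p] (PadicAlgCl p) :=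
    { ι.fieldRange.topologicalClosure with
      algebraMap_mem' := fun c => by
        have h2 : c ∈ closure (Set.range ((↑) : ℚ → ℚ_[p])) := Padic.denseRange_ratCast p c
        have h3 : Continuous (algebraMap ℚ_[p] (PadicAlgCl p)) := continuous_algebraMap _ _
        have h4 := image_closure_subset_closure_image h3 ⟨c, h2, rfl⟩
        refine closure_mono ?_ h4
        rintro _ ⟨_, ⟨q, rfl⟩, rfl⟩
        rw [map_ratCast]
        exact SubfieldClass.ratCast_mem ι.fieldRange q }
  have hFT : F ≤ T := IntermediateField.adjoin_le_iff.mpr fun y hy => subset_closure hy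
  exact hFT h1

/-- An approximation of `x` from `ι(K)` with error below `‖x‖` has the same norm, so the gap for
`ι(K)` passes to its closure. -/
theorem norm_le_of_fixed [NumberField K] (h : IsUnramifiedIn p K) (ι : K →+* PadicAlgCl p)
    {x : PadicAlgCl p} (hx : ∀ s : Gal(PadicAlgCl p/ℚ_[p]), (∀ a, s (ι a) = ι a) → s x = x)
    (hlt : ‖x‖ < 1) : ‖x‖ ≤ (p : ℝ)⁻¹ := by
  rcases eq_or_ne x 0 with rfl | h0
  · simp
  obtain ⟨_, ⟨b, rfl⟩, hb⟩ := Metric.mem_closure_iff.mp (mem_closure_of_fixed ι hx) ‖x‖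
    (norm_pos_iff.mpr h0)
  have h1 : ‖ι b‖ = ‖x‖ := by
    rw [dist_comm, dist_eq_norm] at hb
    have := IsUltrametricDist.norm_eq_of_add_norm_lt_max (x := -x) (y := ι b)
    rw [neg_add_eq_sub, norm_neg] at this
    exact (this (lt_max_of_lt_left hb)).symm
  rw [← h1] at hlt ⊢
  exact norm_le_of_norm_lt_one h ι hlt

theorem prod_galois_constituents {G : Type*} [Group G] [Fintype G]
    (s : Gal(PadicAlgCl p/ℚ_[p])) (θ : G → PadicAlgCl p)
    {M : Type*} [CommMonoid M] (f : (G → PadicAlgCl p) → M) :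
    ∏ φ ∈ constituents p θ, f (fun g => s (φ g)) = ∏ φ ∈ constituents p θ, f φ :=
  sum_galois_constituents s θ (M := Additive M) f

variable [NumberField K]

/-- Such an `s` fixes the arguments `ι(ν α)` and permutes the factors. -/
theorem localRegulator_fixed (ι : K →+* PadicAlgCl p) (θ : Gal(K/ℚ) → PadicAlgCl p) (α : K)
    (s : Gal(PadicAlgCl p/ℚ_[p])) (hs : ∀ a, s (ι a) = ι a) :
    s (localRegulator p ι θ α) = localRegulator p ι θ α := by
  rw [localRegulator, map_prod,
    ← prod_galois_constituents s θ fun φ => groupDeterminantFactor p φ fun ν => ι (ν α)]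
  refine Finset.prod_congr rfl fun φ hφ => ?_
  rw [← galois_groupDeterminantFactor s (mem_constituents.mp hφ).1]
  simp only [hs]

theorem isZeroModP_localRegulator_iff (h : IsUnramifiedIn p K) (ι : K →+* PadicAlgCl p)
    (θ : Gal(K/ℚ) → PadicAlgCl p) (α : K) :
    IsZeroModP p (localRegulator p ι θ α) ↔ ‖localRegulator p ι θ α‖ < 1 := by
  rw [isZeroModP_iff]
  refine ⟨fun h1 => h1.trans_lt (inv_lt_one_of_one_lt₀ (by exact_mod_cast hp.out.one_lt)),
    norm_le_of_fixed h ι (localRegulator_fixed ι θ α)⟩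

/-- The relations only depend on `α` modulo `p`. -/
theorem relations_eq_of_congrModP [IsGalois ℚ K] (h : IsUnramifiedIn p K) (ι : K →+* PadicAlgCl p)
    {α β : pIntegers p K} (hαβ : CongrModP p (α : K) β) :
    relations p (α : K) = relations p (β : K) := by
  have : resolventModP ι α = resolventModP ι β := by
    refine MonoidAlgebra.coeff_injective (Finsupp.ext fun g => ?_)
    rw [coeff_resolventModP, coeff_resolventModP, ← sub_eq_zero, ← map_sub, reduction_eq_zero_iff]
    obtain ⟨z, hz, hzz⟩ := hαβ
    rw [AddSubgroupClass.coe_sub, ← map_sub g⁻¹, hzz]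
    simp only [map_mul, map_natCast, norm_mul]
    exact mul_lt_one_of_nonneg_of_lt_one_left (norm_nonneg _) norm_natCast_p_lt_one
      (norm_embedding_le_one ι (map_mem_pIntegers p _ hz))
  ext U
  rw [mem_relations_iff h ι, mem_relations_iff h ι, this]

theorem relationsTheta_fermatQuotient_ne_bot_iff [IsGalois ℚ K] (h : IsUnramifiedIn p K)
    (hG : ¬ p ∣ Fintype.card Gal(K/ℚ)) (ι : K →+* PadicAlgCl p) (θ : Gal(K/ℚ) → PadicAlgCl p)
    {α β : K} (hβ : β ∈ pIntegers p K) (hα : CongrModP p α β) :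
    relationsTheta p θ β ≠ ⊥ ↔ IsZeroModP p (localRegulator p ι θ α) := by
  have hα' : α ∈ pIntegers p K := by
    obtain ⟨z, hz, hzz⟩ := hα
    rw [sub_eq_iff_eq_add.mp hzz]
    exact add_mem (mul_mem (natCast_mem _ _) hz) hβ
  rw [isZeroModP_localRegulator_iff h, ← relationsTheta_ne_bot_iff h hG ι θ ⟨α, hα'⟩,
    relationsTheta, relationsTheta,
    relations_eq_of_congrModP h ι (α := ⟨α, hα'⟩) (β := ⟨β, hβ⟩) hα]

end Values

/-! ### Lifting of idempotents to `ℤ_p[G]` -/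

section Lifting

variable {p : ℕ} [hp : Fact p.Prime] {G : Type*} [Group G] [Fintype G]

omit [Fintype G] in
theorem norm_coeff_le_of_pow_dvd {k : ℕ} {a : MonoidAlgebra ℤ_[p] G}
    (h : (p : MonoidAlgebra ℤ_[p] G) ^ k ∣ a) (g : G) : ‖a.coeff g‖ ≤ (p : ℝ)⁻¹ ^ k := by
  obtain ⟨c, rfl⟩ := h
  have : (p : MonoidAlgebra ℤ_[p] G) ^ k * c = ((p : ℤ_[p]) ^ k) • c := by
    rw [Algebra.smul_def, map_pow, map_natCast]
  rw [this, MonoidAlgebra.coeff_smul, Finsupp.smul_apply, smul_eq_mul, norm_mul, norm_pow,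
    PadicInt.norm_p]
  exact mul_le_of_le_one_right (by positivity) (PadicInt.norm_le_one _)

theorem natCast_dvd_of_map_toZMod_eq_zero {a : MonoidAlgebra ℤ_[p] G}
    (h : MonoidAlgebra.mapRingHom G PadicInt.toZMod a = 0) :
    (p : MonoidAlgebra ℤ_[p] G) ∣ a := by
  have h1 : ∀ g, ∃ c : ℤ_[p], a.coeff g = p * c := fun g => by
    have h2 : a.coeff g ∈ RingHom.ker (PadicInt.toZMod (p := p)) := by
      rw [RingHom.mem_ker, ← MonoidAlgebra.coeff_mapRingHom, h]
      rfl
    rwa [PadicInt.ker_toZMod, PadicInt.maximalIdeal_eq_span_p, Ideal.mem_span_singleton] at h2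
  choose c hc using h1
  refine ⟨MonoidAlgebra.ofCoeff (Finsupp.equivFunOnFinite.symm c), ?_⟩
  refine MonoidAlgebra.coeff_injective (Finsupp.ext fun g => ?_)
  have : (p : MonoidAlgebra ℤ_[p] G) * MonoidAlgebra.ofCoeff (Finsupp.equivFunOnFinite.symm c) =
      (p : ℤ_[p]) • MonoidAlgebra.ofCoeff (Finsupp.equivFunOnFinite.symm c) := by
    rw [Algebra.smul_def, map_natCast]
  rw [this, MonoidAlgebra.coeff_smul, Finsupp.smul_apply, smul_eq_mul, hc]
  rfl

/-- The Newton step `3t² - 2t³` for idempotents. -/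
theorem pow_succ_dvd_idempotent_step {A : Type*} [Ring A] (q k : ℕ) {t : A}
    (h : (q : A) ^ (k + 1) ∣ t * t - t) :
    (q : A) ^ (k + 1) ∣ (3 * t * t - 2 * t * t * t) - t ∧
      (q : A) ^ (k + 2) ∣ (3 * t * t - 2 * t * t * t) * (3 * t * t - 2 * t * t * t) -
        (3 * t * t - 2 * t * t * t) := by
  obtain ⟨c, hc⟩ := h
  constructor
  · have : (3 * t * t - 2 * t * t * t) - t = (t * t - t) * (1 - 2 * t) := by noncomm_ring
    rw [this, hc, mul_assoc]
    exact dvd_mul_right _ _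
  -- The new defect is the square of the old one times a factor, and `2(k + 1) ≥ k + 2`.
  · have : (3 * t * t - 2 * t * t * t) * (3 * t * t - 2 * t * t * t) -
        (3 * t * t - 2 * t * t * t) = (t * t - t) * (t * t - t) * (4 * (t * t - t) - 3) := by
      noncomm_ring
    have hcomm : Commute c ((q : A) ^ (k + 1)) := (Nat.cast_commute q c).symm.pow_right _
    rw [this, hc, mul_assoc _ c, ← mul_assoc c, hcomm.eq, ← mul_assoc, ← mul_assoc, ← pow_add,
      mul_assoc, mul_assoc]
    exact (pow_dvd_pow _ (by lia)).mul_right _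

theorem tendsto_coeff_mul {t u : ℕ → MonoidAlgebra ℤ_[p] G} {a b : MonoidAlgebra ℤ_[p] G}
    (ht : ∀ g, Filter.Tendsto (fun k => (t k).coeff g) Filter.atTop (nhds (a.coeff g)))
    (hu : ∀ g, Filter.Tendsto (fun k => (u k).coeff g) Filter.atTop (nhds (b.coeff g))) (g : G) :
    Filter.Tendsto (fun k => (t k * u k).coeff g) Filter.atTop (nhds ((a * b).coeff g)) := by
  have : ∀ x y : MonoidAlgebra ℤ_[p] G, (x * y).coeff g = ∑ h, x.coeff h * y.coeff (h⁻¹ * g) :=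
    fun x y => by rw [MonoidAlgebra.coeff_mul_apply_left, Finsupp.sum_fintype _ _ (by simp)]
  simp only [this]
  exact tendsto_finsetSum _ fun h _ => (ht h).mul (hu _)

/-- Idempotents of `𝔽_p[G]` lift to `ℤ_p[G]`. -/
theorem exists_isIdempotentElem_map_toZMod {ε : MonoidAlgebra (ZMod p) G}
    (hε : IsIdempotentElem ε) : ∃ E : MonoidAlgebra ℤ_[p] G, IsIdempotentElem E ∧
      MonoidAlgebra.mapRingHom G PadicInt.toZMod E = ε := by
  have hp0 : (0 : ℝ) < p := by exact_mod_cast hp.out.pos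
  have hp1 : (p : ℝ)⁻¹ < 1 := inv_lt_one_of_one_lt₀ (by exact_mod_cast hp.out.one_lt)
  obtain ⟨x, hx⟩ := mapRingHom_surjective (G := G)
    (ZMod.ringHom_surjective (PadicInt.toZMod (p := p))) ε
  let step : MonoidAlgebra ℤ_[p] G → MonoidAlgebra ℤ_[p] G := fun t => 3 * t * t - 2 * t * t * t
  let t : ℕ → MonoidAlgebra ℤ_[p] G := fun k => step^[k] x
  have ht : ∀ k, t (k + 1) = step (t k) := fun k => Function.iterate_succ_apply' step k x
  have hidem : ∀ k, (p : MonoidAlgebra ℤ_[p] G) ^ (k + 1) ∣ t k * t k - t k := by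
    intro k
    induction k with
    | zero =>
      rw [zero_add, pow_one]
      apply natCast_dvd_of_map_toZMod_eq_zero
      rw [map_sub, map_mul, sub_eq_zero]
      change MonoidAlgebra.mapRingHom G PadicInt.toZMod x *
        MonoidAlgebra.mapRingHom G PadicInt.toZMod x = MonoidAlgebra.mapRingHom G PadicInt.toZMod x
      rw [hx, hε.eq]
    | succ k ih =>
      rw [ht]
      exact (pow_succ_dvd_idempotent_step p k ih).2
  have hdiff : ∀ k, (p : MonoidAlgebra ℤ_[p] G) ^ (k + 1) ∣ t (k + 1) - t k := fun k => by
    rw [ht]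
    exact (pow_succ_dvd_idempotent_step p k (hidem k)).1
  have hcauchy : ∀ g, CauchySeq fun k => (t k).coeff g := fun g => by
    refine cauchySeq_of_le_geometric (p : ℝ)⁻¹ (p : ℝ)⁻¹ hp1 fun k => ?_
    have := norm_coeff_le_of_pow_dvd (hdiff k) g
    rw [MonoidAlgebra.coeff_sub, Finsupp.sub_apply, pow_succ', ← dist_eq_norm, dist_comm] at this
    exact this
  choose e he using fun g => cauchySeq_tendsto_of_complete (hcauchy g)
  let E : MonoidAlgebra ℤ_[p] G := MonoidAlgebra.ofCoeff (Finsupp.equivFunOnFinite.symm e)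
  have hE : ∀ g, Filter.Tendsto (fun k => (t k).coeff g) Filter.atTop (nhds (E.coeff g)) := he
  refine ⟨E, MonoidAlgebra.coeff_injective (Finsupp.ext fun g => ?_), ?_⟩
  · refine tendsto_nhds_unique (tendsto_coeff_mul hE hE g) ?_
    have h0 : Filter.Tendsto (fun k => (t k * t k - t k).coeff g) Filter.atTop (nhds 0) := by
      refine squeeze_zero_norm (fun k => norm_coeff_le_of_pow_dvd (hidem k) g) ?_
      exact (tendsto_pow_atTop_nhds_zero_of_lt_one (by positivity) hp1).comp
        (Filter.tendsto_add_atTop_nat 1)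
    have h1 := h0.add (hE g)
    simpa using h1
  · rw [← hx]
    refine MonoidAlgebra.coeff_injective (Finsupp.ext fun g => ?_)
    rw [MonoidAlgebra.coeff_mapRingHom, MonoidAlgebra.coeff_mapRingHom, ← sub_eq_zero, ← map_sub,
      ← RingHom.mem_ker, PadicInt.ker_toZMod, PadicInt.maximalIdeal_eq_span_p,
      Ideal.mem_span_singleton, ← PadicInt.norm_lt_one_iff_dvd]
    -- All iterates are congruent to `x` modulo `p`, a closed condition that passes to the limit.
    have hdvd : ∀ k, (p : MonoidAlgebra ℤ_[p] G) ∣ t k - x := by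
      intro k
      induction k with
      | zero => exact ⟨0, by simp [t]⟩
      | succ k ih =>
        rw [← sub_add_sub_cancel _ (t k)]
        exact dvd_add ((dvd_pow_self _ k.succ_ne_zero).trans (hdiff k)) ih
    refine lt_of_le_of_lt (le_of_tendsto ((hE g).sub_const (x.coeff g)).norm
      (Filter.Eventually.of_forall fun k => ?_)) hp1
    have := norm_coeff_le_of_pow_dvd (k := 1) (a := t k - x) (by rw [pow_one]; exact hdvd k) g
    rwa [pow_one, MonoidAlgebra.coeff_sub, Finsupp.sub_apply] at this

end Lifting

/-! ### Ranks of idempotents -/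

section Rank

/-- The rank of an idempotent matrix over a principal ideal domain is unchanged under
extensions of scalars to a field, and it is equal to the trace. -/
theorem cast_rank_map_eq_trace {R k n : Type*} [CommRing R] [IsDomain R] [IsPrincipalIdealRing R]
    [Field k] [Fintype n] [DecidableEq n] (f : R →+* k) {M : Matrix n n R}
    (hM : IsIdempotentElem M) : ((M.map f).rank : R) = M.trace := by
  let : Algebra R k := f.toAlgebra
  let b := Pi.basisFun R n
  let φ : (n → R) →ₗ[R] (n → R) := Matrix.toLin b b M
  have hφ : IsIdempotentElem φ := by
    change φ * φ = φ
    rw [Module.End.mul_eq_comp, ← Matrix.toLin_mul, hM.eq]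
  -- The range of a projection of a free module over a principal ideal domain is free, and the trace
  -- is its rank.
  have hproj := LinearMap.IsIdempotentElem.isProj_range φ hφ
  have h1 : LinearMap.toMatrix b b φ = M := LinearMap.toMatrix_toLin b b M
  have h2 := hproj.trace
  rw [LinearMap.trace_eq_matrix_trace R b, h1] at h2
  rw [h2]
  congr 1
  have h3 : M.map f = LinearMap.toMatrix (Algebra.TensorProduct.basis k b)
      (Algebra.TensorProduct.basis k b) (φ.baseChange k) := by
    rw [LinearMap.toMatrix_baseChange, h1]
    rfl
  rw [h3, Matrix.rank_eq_finrank_range_toLin _ (Algebra.TensorProduct.basis k b)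
    (Algebra.TensorProduct.basis k b), Matrix.toLin_toMatrix,
    ← Module.finrank_baseChange (R := k) (S := R) (M' := φ.range)]
  have h4 : φ = φ.range.subtype ∘ₗ φ.rangeRestrict := rfl
  have h5 : (φ.baseChange k) = (φ.range.subtype.baseChange k) ∘ₗ (φ.rangeRestrict.baseChange k) := by
    rw [← LinearMap.baseChange_comp]
    rfl
  have h6 : Function.Surjective (φ.rangeRestrict.baseChange k) :=
    LinearMap.lTensor_surjective _ φ.surjective_rangeRestrict
  -- The inclusion of the range is split, so it stays injective after base change even though `k`
  -- need not be flat over `R`.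
  have h7 : (φ.rangeRestrict.baseChange k) ∘ₗ (φ.range.subtype.baseChange k) = LinearMap.id := by
    rw [← LinearMap.baseChange_comp, ← LinearMap.baseChange_id]
    congr 1
    ext x
    exact congrFun (hproj.map_id x x.2) _
  have h8 : Function.Injective (φ.range.subtype.baseChange k) :=
    Function.LeftInverse.injective (g := φ.rangeRestrict.baseChange k) (LinearMap.congr_fun h7)
  rw [h5, LinearMap.range_comp_of_range_eq_top _ (LinearMap.range_eq_top.mpr h6)]
  exact LinearMap.finrank_range_of_inj h8

end Rank

/-! ### Dimensions of left ideals in terms of characters -/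

section Dimension

variable {p : ℕ} [hp : Fact p.Prime] {G : Type*} [Group G] [Fintype G]

theorem trace_asAlgebraHom {d : ℕ} {φ : G → PadicAlgCl p}
    {ρ : Representation (PadicAlgCl p) G (Fin d → PadicAlgCl p)} (h : Affords p φ ρ)
    (a : MonoidAlgebra (PadicAlgCl p) G) :
    LinearMap.trace (PadicAlgCl p) _ (ρ.asAlgebraHom a) = ∑ g, a.coeff g * φ g := by
  classical
  induction a using MonoidAlgebra.induction_linear with
  | zero => simp
  | add a b ha hb => simp [ha, hb, add_mul, Finset.sum_add_distrib]
  | single g c =>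
    rw [Representation.asAlgebraHom_single, map_smul, smul_eq_mul, ← h.2]
    simp [Finsupp.single_apply, Representation.character]

/-- The multiplicity of an irreducible character in the left ideal generated by an idempotent. -/
theorem exists_multiplicity {d : ℕ} {φ : G → PadicAlgCl p}
    {ρ : Representation (PadicAlgCl p) G (Fin d → PadicAlgCl p)} (h : Affords p φ ρ)
    {a : MonoidAlgebra (PadicAlgCl p) G} (ha : IsIdempotentElem a) :
    ∃ δ ≤ d, ∑ g, a.coeff g * φ g = (δ : PadicAlgCl p) := by
  refine ⟨Module.finrank (PadicAlgCl p) (ρ.asAlgebraHom a).range, ?_, ?_⟩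
  · exact (Submodule.finrank_le _).trans (Module.finrank_fin_fun _).le
  · rw [← trace_asAlgebraHom h]
    exact (LinearMap.IsIdempotentElem.isProj_range _ (ha.map _)).trace

/-- The left side is the trace of right multiplication by the product; the formula is the `θ`-part
of the decomposition of the regular character. -/
theorem coeff_one_idempotentTheta_mul (θ : G → PadicAlgCl p)
    (a : MonoidAlgebra (PadicAlgCl p) G) :
    (Fintype.card G : PadicAlgCl p) * (idempotentTheta p θ * a).coeff 1 =
      ∑ φ ∈ constituents p θ, φ 1 * ∑ g, a.coeff g * φ g := by
  have hn : (Fintype.card G : PadicAlgCl p) ≠ 0 := by exact_mod_cast Fintype.card_ne_zero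
  rw [MonoidAlgebra.coeff_mul_apply_left, Finsupp.sum_fintype _ _ (by simp), Finset.mul_sum]
  simp only [coeff_idempotentTheta, Finset.sum_mul, Finset.mul_sum, mul_one]
  rw [Finset.sum_comm]
  refine Finset.sum_congr rfl fun φ _ => Fintype.sum_equiv (Equiv.inv _) _ _ fun g => ?_
  rw [Equiv.inv_apply]
  field_simp

/-- The dimension of the left ideal generated by `ε` is the rank of its matrix. -/
theorem finrank_eq_rank_rightMulMatrix {k : Type*} [Field k] {ε : MonoidAlgebra k G}
    (V : Submodule k (MonoidAlgebra k G)) (hV : ∀ x, x ∈ V ↔ ∃ a, a * ε = x) :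
    Module.finrank k V = (rightMulMatrix ε).rank := by
  let e : MonoidAlgebra k G ≃ₗ[k] (G → k) :=
    (MonoidAlgebra.coeffLinearEquiv k).trans (Finsupp.linearEquivFunOnFinite k k G)
  have he : ∀ u, (rightMulMatrix ε).mulVec (e u) = e (u * ε) := rightMulMatrix_mulVec ε
  have h1 : (rightMulMatrix ε).mulVecLin.range = V.map (e : MonoidAlgebra k G →ₗ[k] (G → k)) := by
    ext y
    rw [LinearMap.mem_range, Submodule.mem_map]
    constructor
    · rintro ⟨u, rfl⟩
      refine ⟨e.symm u * ε, (hV _).mpr ⟨_, rfl⟩, ?_⟩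
      rw [Matrix.mulVecLin_apply]
      conv_rhs => rw [← e.apply_symm_apply u, he]
      rfl
    · rintro ⟨x, hx, rfl⟩
      obtain ⟨a, rfl⟩ := (hV x).mp hx
      exact ⟨e a, he a⟩
  rw [Matrix.rank, h1]
  exact (LinearEquiv.finrank_map_eq e V).symm

omit [Group G] in
theorem neZero_card_zmod (hG : ¬ p ∣ Fintype.card G) : NeZero (Nat.card G : ZMod p) :=
  ⟨by rwa [Nat.card_eq_fintype_card, Ne, ZMod.natCast_eq_zero_iff]⟩

/-- The dimension of `e_θ I` for a left ideal `I` of `𝔽_p[G]`. -/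
theorem finrank_map_mulLeft_idempotentThetaModP (hG : ¬ p ∣ Fintype.card G)
    {θ : G → PadicAlgCl p} {d : ℕ} (hd : ∀ φ ∈ constituents p θ, φ 1 = d)
    (hne : (constituents p θ).Nonempty) (I : Ideal (MonoidAlgebra (ZMod p) G)) :
    ∃ δ ≤ d, Module.finrank (ZMod p) ((I.restrictScalars (ZMod p)).map
      (LinearMap.mulLeft (ZMod p) (idempotentThetaModP p θ))) =
        δ * (constituents p θ).card * d := by
  classical
  have := neZero_card_zmod hG
  set e := idempotentThetaModP p θ with he
  have hee : e * e = e := isIdempotentElem_idempotentThetaModP hG θ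
  have hec : ∀ a, e * a = a * e := fun a => (idempotentThetaModP_commute hG θ a).eq
  -- Semisimplicity gives an idempotent generator of `I`. Its lift to `ℤ_p[G]` times `e_θ` is again
  -- idempotent because `e_θ` is central.
  obtain ⟨ε, hε, hI⟩ := IsSemisimpleRing.ideal_eq_span_idempotent I
  obtain ⟨E₀, hE₀, hE₀ε⟩ := exists_isIdempotentElem_map_toZMod hε
  set E := idempotentThetaInt hG θ * E₀ with hE
  have hEidem : IsIdempotentElem E := by
    have h1 := (isIdempotentElem_idempotentThetaInt hG θ).eq
    have h2 := (idempotentThetaInt_commute hG θ E₀).eq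
    change _ * _ * (_ * _) = _ * _
    rw [mul_assoc, ← mul_assoc E₀, ← h2, mul_assoc, hE₀.eq, ← mul_assoc, h1]
  have hEmod : MonoidAlgebra.mapRingHom G PadicInt.toZMod E = e * ε := by
    rw [map_mul, map_toZMod_idempotentThetaInt, hE₀ε]
  set F := MonoidAlgebra.mapRingHom G (padicIntToAlgCl p) E with hF
  have hFidem : IsIdempotentElem F := hEidem.map _
  have hFθ : idempotentTheta p θ * F = F := by
    rw [hF, hE, map_mul, map_idempotentThetaInt, ← mul_assoc, ← map_idempotentThetaInt hG θ,
      ← map_mul, (isIdempotentElem_idempotentThetaInt hG θ).eq]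
  have hdim : Module.finrank (ZMod p) ((I.restrictScalars (ZMod p)).map
      (LinearMap.mulLeft (ZMod p) e)) =
      ((rightMulMatrix E).map (PadicInt.toZMod (p := p))).rank := by
    rw [← rightMulMatrix_map, hEmod]
    refine finrank_eq_rank_rightMulMatrix _ fun x => ?_
    rw [Submodule.mem_map]
    constructor
    · rintro ⟨y, hy, rfl⟩
      rw [Submodule.restrictScalars_mem, hI, Ideal.mem_span_singleton'] at hy
      obtain ⟨a, rfl⟩ := hy
      exact ⟨a, by rw [LinearMap.mulLeft_apply, ← mul_assoc, ← mul_assoc, hec]⟩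
    · rintro ⟨a, rfl⟩
      refine ⟨a * ε, ?_, ?_⟩
      · rw [Submodule.restrictScalars_mem, hI, Ideal.mem_span_singleton']
        exact ⟨a, rfl⟩
      · rw [LinearMap.mulLeft_apply, ← mul_assoc, ← mul_assoc, hec]
  have hM : IsIdempotentElem (rightMulMatrix E) := by
    change _ * _ = _
    rw [← rightMulMatrix_mul, hEidem.eq]
  -- This equality lives in `ℤ_p`, of characteristic `0`, so it determines the dimension itself and
  -- not only its class modulo `p`.
  have htr := cast_rank_map_eq_trace (PadicInt.toZMod (p := p)) hM
  rw [← hdim] at htr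
  have htrace : (rightMulMatrix E).trace = Fintype.card G * E.coeff 1 := by
    simp [Matrix.trace, rightMulMatrix]
  rw [htrace] at htr
  have h1 := congrArg (padicIntToAlgCl p) htr
  rw [map_natCast, map_mul, map_natCast, ← MonoidAlgebra.coeff_mapRingHom, ← hF, ← hFθ,
    coeff_one_idempotentTheta_mul] at h1
  obtain ⟨φ, hφ⟩ := hne
  obtain ⟨d', ρ, hρ⟩ := (mem_constituents.mp hφ).1
  have hd' : d' = d := by
    have := hρ.apply_one
    rw [hd φ hφ] at this
    exact_mod_cast this.symm
  subst hd'
  obtain ⟨δ, hδ, hδe⟩ := exists_multiplicity hρ hFidem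
  -- The coefficients of `F` lie in `ℚ_p`, so conjugating the character conjugates the integer `δ`,
  -- which does not change.
  have hconst : ∀ ψ ∈ constituents p θ, ∑ g, F.coeff g * ψ g = (δ : PadicAlgCl p) := by
    intro ψ hψ
    have hψ' : ψ ∈ (constituents p θ : Set (G → PadicAlgCl p)) := hψ
    rw [coe_constituents_eq hφ] at hψ'
    obtain ⟨s, rfl⟩ := hψ'
    have h2 := congrArg s hδe
    rw [map_sum, map_natCast] at h2
    rw [← h2]
    refine Finset.sum_congr rfl fun g _ => ?_
    rw [map_mul, hF, MonoidAlgebra.coeff_mapRingHom]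
    congr 1
    exact (s.commutes _).symm
  refine ⟨δ, hδ, ?_⟩
  rw [Finset.sum_congr rfl fun ψ hψ => by rw [hconst ψ hψ, hd ψ hψ], Finset.sum_const,
    nsmul_eq_mul] at h1
  have h3 : Module.finrank (ZMod p) ((I.restrictScalars (ZMod p)).map
      (LinearMap.mulLeft (ZMod p) e)) = (constituents p θ).card * (d' * δ) := by exact_mod_cast h1
  rw [h3]
  ring

end Dimension

/-! ### The number of constituents of a `p`-adic character -/

section FieldOfValues

variable {p : ℕ} [hp : Fact p.Prime] {G : Type*} [Group G] [Fintype G]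

/-- The field of values of an irreducible character is contained in a cyclotomic field. -/
theorem IsIrreducibleCharacter.exists_fieldOfValues_le {φ : G → PadicAlgCl p}
    (hφ : IsIrreducibleCharacter p φ) : ∃ ζ : PadicAlgCl p,
      IsPrimitiveRoot ζ (Fintype.card G) ∧ fieldOfValues p φ ≤ IntermediateField.adjoin ℚ {ζ} := by
  have : NeZero (Fintype.card G : PadicAlgCl p) :=
    ⟨by exact_mod_cast Fintype.card_ne_zero⟩
  obtain ⟨ζ, hζ⟩ := HasEnoughRootsOfUnity.exists_primitiveRoot (PadicAlgCl p) (Fintype.card G)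
  refine ⟨ζ, hζ, IntermediateField.adjoin_le_iff.mpr ?_⟩
  rintro _ ⟨g, rfl⟩
  obtain ⟨m, hm, hroot⟩ := hφ.exists_multiset g
  change φ g ∈ IntermediateField.adjoin ℚ {ζ}
  rw [hm]
  refine multiset_sum_mem _ fun c hc => ?_
  obtain ⟨i, -, rfl⟩ := hζ.eq_pow_of_pow_eq_one (hroot c hc)
  exact pow_mem (IntermediateField.mem_adjoin_simple_self ℚ ζ) i

/-- A subfield of an abelian extension is Galois. -/
theorem IsIrreducibleCharacter.isGalois_fieldOfValues {φ : G → PadicAlgCl p}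
    (hφ : IsIrreducibleCharacter p φ) : IsGalois ℚ (fieldOfValues p φ) := by
  obtain ⟨ζ, hζ, hle⟩ := hφ.exists_fieldOfValues_le
  have : IsCyclotomicExtension {Fintype.card G} ℚ (IntermediateField.adjoin ℚ {ζ}) := by
    change IsCyclotomicExtension {Fintype.card G} ℚ
      (IntermediateField.adjoin ℚ {ζ}).toSubalgebra
    rw [IntermediateField.adjoin_simple_toSubalgebra_of_isAlgebraic
      ((hζ.isIntegral Fintype.card_pos).tower_top (A := ℚ)).isAlgebraic]
    exact hζ.adjoin_isCyclotomicExtension ℚ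
  have h1 := IsCyclotomicExtension.isAbelianGalois {Fintype.card G} ℚ
    (IntermediateField.adjoin ℚ {ζ})
  have h2 := @IsAbelianGalois.of_algHom ℚ _ _ _ _ _ _ _ (IntermediateField.inclusion hle) h1
  exact h2.toIsGalois

theorem IsIrreducibleCharacter.numberField_fieldOfValues {φ : G → PadicAlgCl p}
    (hφ : IsIrreducibleCharacter p φ) : NumberField (fieldOfValues p φ) := by
  obtain ⟨ζ, hζ, hle⟩ := hφ.exists_fieldOfValues_le
  have : FiniteDimensional ℚ (IntermediateField.adjoin ℚ {ζ}) :=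
    IntermediateField.adjoin.finiteDimensional
      ((hζ.isIntegral Fintype.card_pos).tower_top)
  have : FiniteDimensional ℚ (fieldOfValues p φ) :=
    Module.Finite.of_injective (IntermediateField.inclusion hle).toLinearMap
      (IntermediateField.inclusion_injective hle)
  exact { }

/-- The values of an irreducible character, as algebraic integers of its field of values. -/
def IsIrreducibleCharacter.value {φ : G → PadicAlgCl p} (hφ : IsIrreducibleCharacter p φ) (g : G) :
    𝓞 (fieldOfValues p φ) :=
  ⟨⟨φ g, IntermediateField.subset_adjoin ℚ _ ⟨g, rfl⟩⟩,
    (isIntegral_algHom_iff ((fieldOfValues p φ).val.restrictScalars ℤ)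
      Subtype.val_injective).mp (hφ.isIntegral g)⟩

/-- The values of an irreducible character, in the ring of integers of the algebraic closure
of `ℚ_p`. -/
def IsIrreducibleCharacter.integerValue {φ : G → PadicAlgCl p} (hφ : IsIrreducibleCharacter p φ)
    (g : G) : integers p :=
  ⟨φ g, hφ.norm_le_one g⟩

/-- Irreducible characters with the same reduction are equal when `p` does not divide the order
of the group. -/
theorem IsIrreducibleCharacter.eq_of_residue_eq (hG : ¬ p ∣ Fintype.card G)
    {φ ψ : G → PadicAlgCl p} (hφ : IsIrreducibleCharacter p φ) (hψ : IsIrreducibleCharacter p ψ)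
    (h : ∀ g, residue p (hφ.integerValue g) = residue p (hψ.integerValue g)) : φ = ψ := by
  by_contra hne
  have h1 : ∑ g, hφ.integerValue g * hφ.integerValue g⁻¹ = (Fintype.card G : integers p) := by
    refine Subtype.ext ?_
    have := sum_mul_inv_irreducibleCharacter hφ hφ
    rw [if_pos rfl] at this
    rw [AddSubmonoidClass.coe_finsetSum, Subring.coe_natCast]
    exact this
  have h2 : ∑ g, hψ.integerValue g * hφ.integerValue g⁻¹ = 0 := by
    refine Subtype.ext ?_
    have := sum_mul_inv_irreducibleCharacter hψ hφ
    rw [if_neg (Ne.symm hne)] at this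
    rw [AddSubmonoidClass.coe_finsetSum]
    exact this
  -- With equal reductions the two orthogonality sums agree in the residue field, where `|G|` is not
  -- zero.
  have h3 := congrArg (residue p) h1
  have h4 := congrArg (residue p) h2
  simp only [map_sum, map_mul, h, map_natCast, map_zero] at h3 h4
  rw [h4] at h3
  exact natCast_residueField_ne_zero hG h3.symm

end FieldOfValues

/-! ### Frobenius orbits of irreducible characters -/

section Frobenius

/-- An endomorphism of a field of characteristic `p` acts as a power of the Frobenius on the
subfield with `p ^ f` elements. -/
theorem exists_eq_pow_of_pow_eq {p : ℕ} [hp : Fact p.Prime] {F : Type*} [Field F] [CharP F p]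
    {f : ℕ} (hf : f ≠ 0) (τ : F →+* F) : ∃ j, ∀ x, x ^ p ^ f = x → τ x = x ^ p ^ j := by
  let k : Subfield F := RingHom.eqLocusField (iterateFrobenius F p f) (RingHom.id F)
  have hk : ∀ x, x ∈ k ↔ x ^ p ^ f = x := fun x => Iff.rfl
  have hfin : Finite k := by
    have hq : 1 < p ^ f := Nat.one_lt_pow hf hp.out.one_lt
    refine Set.Finite.to_subtype (Set.Finite.subset
      ((Polynomial.X ^ p ^ f - Polynomial.X : Polynomial F).rootSet_finite F) fun x hx => ?_)
    rw [Polynomial.mem_rootSet]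
    refine ⟨FiniteField.X_pow_card_pow_sub_X_ne_zero F hf hp.out.one_lt, ?_⟩
    have := (hk x).mp hx
    simp [this]
  let : Algebra (ZMod p) k := ZMod.algebra _ p
  let τ' : k →+* k := (τ.comp k.subtype).codRestrict k fun x => by
    rw [hk]
    change τ x ^ p ^ f = τ x
    rw [← map_pow, (hk _).mp x.2]
  have hτ' : τ'.comp (algebraMap (ZMod p) k) = algebraMap (ZMod p) k := Subsingleton.elim _ _
  let τ'' : k →ₐ[ZMod p] k :=
    { τ' with commutes' := RingHom.congr_fun hτ' }
  -- Endomorphisms of a finite field over its prime field are powers of Frobenius.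
  obtain ⟨j, hj⟩ := (FiniteField.bijective_frobeniusAlgHom_pow (ZMod p) k).2 τ''
  refine ⟨j, fun x hx => ?_⟩
  have h1 := AlgHom.congr_fun hj ⟨x, hx⟩
  simp only [AlgHom.coe_pow, FiniteField.coe_frobeniusAlgHom, pow_iterate, ZMod.card] at h1
  exact (congrArg Subtype.val h1).symm

variable {p : ℕ} [hp : Fact p.Prime] {G : Type*} [Group G] [Fintype G]

theorem residueDegree_ne_zero {L : Type*} [Field L] [NumberField L] [IsGalois ℚ L]
    (ι : L →+* PadicAlgCl p) : residueDegree p L ≠ 0 := by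
  intro h0
  have h1 := card_quotient_primeOfEmbedding ι
  rw [h0, pow_zero, Nat.card_eq_one_iff_unique] at h1
  have : Nontrivial (𝓞 L ⧸ primeOfEmbedding ι) :=
    Ideal.Quotient.nontrivial_iff.mpr (Ideal.IsPrime.ne_top inferInstance)
  exact not_subsingleton _ h1.1

theorem residue_pow_smul {s : Gal(PadicAlgCl p/ℚ_[p])}
    (hs : ∀ x : integers p, residue p (s • x) = residue p x ^ p) (j : ℕ) (x : integers p) :
    residue p (s ^ j • x) = residue p x ^ p ^ j := by
  induction j with
  | zero => simp
  | succ j ih => rw [pow_succ', mul_smul, hs, ih, ← pow_mul, ← pow_succ]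

/-- The number of constituents of a `p`-adic character is the residue degree of the field of
values of each of them. -/
theorem card_constituents (hG : ¬ p ∣ Fintype.card G) {θ φ : G → PadicAlgCl p}
    (hφ : φ ∈ constituents p θ) :
    (constituents p θ).card = residueDegree p (fieldOfValues p φ) := by
  classical
  have hirr := (mem_constituents.mp hφ).1
  have := hirr.numberField_fieldOfValues
  have := hirr.isGalois_fieldOfValues
  let ι : fieldOfValues p φ →+* PadicAlgCl p := algebraMap _ _
  obtain ⟨s, hs⟩ := exists_frobenius p
  set f := residueDegree p (fieldOfValues p φ) with hf
  have hf0 : f ≠ 0 := residueDegree_ne_zero ι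
  have hpow : ∀ g, residue p (hirr.integerValue g) ^ p ^ f = residue p (hirr.integerValue g) :=
    fun g => residue_pow_residueDegree ι (hirr.value g)
  let T : (G → PadicAlgCl p) → G → PadicAlgCl p := fun ψ g => s (ψ g)
  have hT : ∀ j, T^[j] φ = fun g => (s ^ j) (φ g) := by
    intro j
    induction j with
    | zero => rfl
    | succ j ih =>
      rw [Function.iterate_succ_apply', ih, pow_succ']
      rfl
  -- `s ^ f` acts trivially on the reduced values of `φ`, and a character is determined by its
  -- reduction.
  have hfper : Function.IsPeriodicPt T f φ := by
    change T^[f] φ = φ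
    rw [hT]
    refine IsIrreducibleCharacter.eq_of_residue_eq hG (hirr.galois (s ^ f)) hirr fun g => ?_
    rw [← hpow g, ← residue_pow_smul hs]
    rfl
  set m := Function.minimalPeriod T φ with hm
  have hm0 : 0 < m := hfper.minimalPeriod_pos (Nat.pos_of_ne_zero hf0)
  -- Conversely, if `s ^ m` fixes `φ`, it fixes its field of values, whose residue field then
  -- satisfies `x ^ p ^ m = x`; so `f ≤ m`.
  have hmf : m = f := by
    refine le_antisymm (hfper.minimalPeriod_le (Nat.pos_of_ne_zero hf0))
      (residueDegree_le hm0 ι fun x => ?_)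
    have h1 : T^[m] φ = φ := Function.isPeriodicPt_minimalPeriod T φ
    rw [hT] at h1
    rw [← residue_pow_smul hs]
    refine congrArg (residue p) (Subtype.ext ?_)
    rw [coe_galois_smul, coe_ringOfIntegersMap]
    have h2 : ∀ y ∈ fieldOfValues p φ, (s ^ m) y = y := fun y hy => by
      induction hy using IntermediateField.adjoin_induction with
      | mem y hy =>
        obtain ⟨g, rfl⟩ := hy
        exact congrFun h1 g
      | algebraMap q => simp
      | add x y _ _ hx hy => rw [map_add, hx, hy]
      | inv x _ hx => rw [map_inv₀, hx]
      | mul x y _ _ hx hy => rw [map_mul, hx, hy]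
    exact h2 _ (x : fieldOfValues p φ).2
  rw [← hmf]
  have himage : constituents p θ = (Finset.range m).image fun j => T^[j] φ := by
    ext ψ
    rw [Finset.mem_image]
    constructor
    · intro hψ
      have hψ' : ψ ∈ (constituents p θ : Set (G → PadicAlgCl p)) := hψ
      rw [coe_constituents_eq hφ] at hψ'
      obtain ⟨t, rfl⟩ := hψ'
      -- An arbitrary `t` need not be a power of `s`, but on the finite field containing the reduced
      -- values it acts as a power of Frobenius, so `t` and `s ^ j` send `φ` to the same character.
      obtain ⟨j, hj⟩ := exists_eq_pow_of_pow_eq hf0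
        (MulSemiringAction.toRingHom Gal(PadicAlgCl p/ℚ_[p]) (residueField p) t)
      refine ⟨j % m, Finset.mem_range.mpr (Nat.mod_lt _ hm0), ?_⟩
      rw [Function.iterate_mod_minimalPeriod_eq, hT]
      refine IsIrreducibleCharacter.eq_of_residue_eq hG (hirr.galois (s ^ j)) (hirr.galois t)
        fun g => ?_
      have h1 := hj _ (hpow g)
      rw [← residue_pow_smul hs, MulSemiringAction.toRingHom_apply,
        ← IsLocalRing.ResidueField.residue_smul] at h1
      exact h1.symm
    · rintro ⟨j, -, rfl⟩
      rw [hT]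
      exact galois_mem_constituents (s ^ j) hφ
  rw [himage, Finset.card_image_of_injOn, Finset.card_range]
  intro i hi j hj hij
  exact Function.iterate_injOn_Iio_minimalPeriod (Finset.mem_range.mp hi)
    (Finset.mem_range.mp hj) hij

end Frobenius

end LocalRegulator

end

/-! ### The main theorem -/

theorem theorem3p9 {K : Type*} [Field K] [NumberField K] [IsGalois ℚ K]
    (η : Kˣ)
    (hrank : Module.finrank ℤ (Additive (LocalRegulator.conjugateGroup η)) = Module.finrank ℚ K)
    (p : ℕ) [Fact p.Prime] (hp : 2 < p)
    (hunram : LocalRegulator.IsUnramifiedIn p K)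
    (hpn : ¬ p ∣ Module.finrank ℚ K)
    (hpη : LocalRegulator.IsPrimeTo p η)
    (ι : K →+* PadicAlgCl p)
    (θ : Gal(K/ℚ) → PadicAlgCl p)
    (hθ : LocalRegulator.IsIrreduciblePadicCharacter p θ) :
    LocalRegulator.fermatQuotient p η ∈ LocalRegulator.pIntegers p K ∧
    (∀ α : K, LocalRegulator.CongrModP p α (LocalRegulator.fermatQuotient p η) →
      (LocalRegulator.relationsTheta p θ (LocalRegulator.fermatQuotient p η) ≠ ⊥ ↔
        LocalRegulator.IsZeroModP p (LocalRegulator.localRegulator p ι θ α))) ∧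
    (LocalRegulator.relationsTheta p θ (LocalRegulator.fermatQuotient p η) ≠ ⊥ →
      ∃ δ d f : ℕ, 1 ≤ δ ∧ δ ≤ d ∧
        (∀ φ ∈ LocalRegulator.constituents p θ, φ 1 = (d : PadicAlgCl p) ∧
          f = LocalRegulator.residueDegree p (LocalRegulator.fieldOfValues p φ)) ∧
        Module.finrank (ZMod p)
          (LocalRegulator.relationsTheta p θ (LocalRegulator.fermatQuotient p η)) = δ * f * d) := by
  classical
  have hG : ¬ p ∣ Fintype.card Gal(K/ℚ) := by
    rwa [← Nat.card_eq_fintype_card, IsGalois.card_aut_eq_finrank]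
  have hmem := LocalRegulator.fermatQuotient_mem hunram ι η hpη
  refine ⟨hmem, fun α hα =>
    LocalRegulator.relationsTheta_fermatQuotient_ne_bot_iff hunram hG ι θ hmem hα, fun hne => ?_⟩
  obtain ⟨φ, hφ, hφθ⟩ := hθ
  have hφ' : φ ∈ LocalRegulator.constituents p θ :=
    LocalRegulator.mem_constituents.mpr ⟨LocalRegulator.mem_irreducibleCharacters.mp hφ, hφθ.symm⟩
  obtain ⟨d, ρ, hρ⟩ := (LocalRegulator.mem_constituents.mp hφ').1
  have hd : ∀ ψ ∈ LocalRegulator.constituents p θ, ψ 1 = (d : PadicAlgCl p) := by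
    intro ψ hψ
    have hψ' : ψ ∈ (LocalRegulator.constituents p θ : Set (Gal(K/ℚ) → PadicAlgCl p)) := hψ
    rw [LocalRegulator.coe_constituents_eq hφ'] at hψ'
    obtain ⟨s, rfl⟩ := hψ'
    simp only [hρ.apply_one, map_natCast]
  obtain ⟨δ, hδ, hdim⟩ := LocalRegulator.finrank_map_mulLeft_idempotentThetaModP hG hd ⟨φ, hφ'⟩
    (LocalRegulator.relations p (LocalRegulator.fermatQuotient p η))
  -- The number of constituents serves as `f`, a choice that visibly does not depend on `φ ∣ θ`.
  refine ⟨δ, d, (LocalRegulator.constituents p θ).card, Nat.one_le_iff_ne_zero.mpr ?_, hδ,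
    fun ψ hψ => ⟨hd ψ hψ, LocalRegulator.card_constituents hG hψ⟩, hdim⟩
  rintro rfl
  rw [zero_mul, zero_mul, Submodule.finrank_eq_zero] at hdim
  exact hne hdim
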